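/- All graphs are finite and simple; a class of graphs is closed under isomorphism. For a graph $G$ with adjacency matrix $\mathrm{Adj}(G)$, its complement is $G^c$ and $G+H$ denotes the disjoint union. For a class $\mathcal F$, the class $\mathrm{co}(\mathcal F)$ of $\mathcal F$-cographs is the smallest class of graphs that contains $\mathcal F$ and is stable under sums $G+H$ and complements. Let $\mathcal G_5$ be the class of graphs with at most $5$ vertices. A magic unitary over a unital $*$-algebra $A$ is a square matrix $u=(u_{ij})$ over $A$ with $u_{ij}=u_{ij}^*=u_{ij}^2$, $\sum_j u_{ij}=1=\sum_j u_{ji}$ for all $i$, and $u_{ij}u_{ik}=0=u_{ji}u_{ki}$ whenever $j\neq k$. A quantum permutation group of size $n$ is a pair $(A,u)$ where $A$ is a unital $*$-algebra generated by the entries of an $n\times n$ magic unitary $u$ such that there is a unital $*$-homomorphism $\Delta:A\to A\otimes A$ (algebraic tensor product) with $\Delta(u_{ij})=\sum_k u_{ik}\otimes u_{kj}$. An isomorphism $(A,u)\to(B,v)$, where the sizes may differ, is a $*$-isomorphism $f:A\to B$ with $\Delta_B f=(f\otimes f)\Delta_A$. The quantum automorphism group $\mathrm{Qu}(G)$ is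 $(\mathcal O(\mathrm{Qu}(G)),p)$, where $\mathcal O(\mathrm{Qu}(G))$ is the universal unital $*$-algebra generated by the entries of a magic unitary $p$ indexed by $V(G)$ with $p\,\mathrm{Adj}(G)=\mathrm{Adj}(G)\,p$. It is trivial if $\mathcal O(\mathrm{Qu}(G))=\mathbb C$, and $G$ has quantum symmetry if $\mathcal O(\mathrm{Qu}(G))$ is not commutative. $S_n^+=(S,p)$ is the quantum permutation group given by the universal unital $*$-algebra $S$ generated by the entries of an $n\times n$ magic unitary $p$. Graphs $G,H$ are quantum isomorphic if they have the same number of vertices and there is a magic unitary $P$ over some nonzero unital $C^*$-algebra, with rows indexed by $V(H)$ and columns by $V(G)$, such that $P\,\mathrm{Adj}(G)=\mathrm{Adj}(H)\,P$. A graph satisfies Schmidt's criterion if it has two nontrivial automorphisms with disjoint supports. A class $\mathcal F$ is tractable if - (QA) for every $G\in\mathcal F$, $\mathrm{Qu}(G)$ is trivial if and only if $\mathrm{Aut}(G)$ is trivial; - (QI) for all $G,H\in\mathcal F$, $G$ and $H$ are quantum isomorphic if and only if they are isomorphic; - (SA) for every $G\in\mathcal F$, $G$ has quantum symmetry if and only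 if it satisfies Schmidt's criterion. It is superrigid if, whenever $G\in\mathcal F$ and $H$ is any graph quantum isomorphic to $G$, $H$ is isomorphic to $G$. The free product of $(A,u)$ and $(B,v)$ is the unital free product $A*B$ with the matrix $\mathrm{diag}(u,v)$. For $(A,u)$ of size $m\ge1$ and $n\ge 1$, the wreath product $(A,u)\wr S_n^+$ is the algebra $A^{*n}*S/\langle[\nu_i(a),p_{ij}]: a\in A,\ 1\le i,j\le n\rangle$ ($\nu_i$ the inclusion of the $i$-th copy of $A$) with the matrix $w_{(i,k),(j,l)}=\nu_i(u_{kl})p_{ij}$ of size $mn$. The Jordan closure $\mathrm{Jor}(\mathcal Q)$ of a family $\mathcal Q$ of quantum permutation groups is the smallest family of quantum permutation groups that contains $\mathcal Q$, is closed under isomorphism, and is stable under free products and under wreath products with $S_n^+$ for all $n\geq1$. Write $\mathrm{Qu}(\mathcal F)$ for the family of all quantum permutation groups isomorphic to $\mathrm{Qu}(G)$ for some $G\in\mathcal F$. **Theorem.** The class $\mathrm{co}(\mathcal G_5)$ is tractable and superrigid, and $\mathrm{Qu}(\mathrm{co}(\mathcal G_5))=\mathrm{Jor}(\mathrm{Qu}(\mathcal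 G_5))$. -/

import Mathlib

open scoped TensorProduct

/-! ### Noncommutative `*`-polynomials and universal unital `*`-algebras -/

/-- Noncommutative complex `*`-polynomials in the variables `x ∈ X`: the free unital algebra on the
symbols `x = Sum.inl x` and `x* = Sum.inr x`. -/
def StarPoly (X : Type) : Type := FreeAlgebra ℂ (X ⊕ X)

namespace StarPoly

variable {X : Type}

noncomputable instance : Ring (StarPoly X) := inferInstanceAs (Ring (FreeAlgebra ℂ (X ⊕ X)))

noncomputable instance : Algebra ℂ (StarPoly X) :=
  inferInstanceAs (Algebra ℂ (FreeAlgebra ℂ (X ⊕ X)))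

/-- The symbols `x` and `x*`. -/
noncomputable def symb (x : X ⊕ X) : StarPoly X := FreeAlgebra.ι ℂ x

/-- The variable `x`. -/
noncomputable def var (x : X) : StarPoly X := symb (Sum.inl x)

theorem induction_on {motive : StarPoly X → Prop} (a : StarPoly X)
    (scalar : ∀ c : ℂ, motive (algebraMap ℂ (StarPoly X) c))
    (gen : ∀ x : X ⊕ X, motive (symb x))
    (mul : ∀ a b : StarPoly X, motive a → motive b → motive (a * b))
    (add : ∀ a b : StarPoly X, motive a → motive b → motive (a + b)) : motive a :=
  FreeAlgebra.induction ℂ (X ⊕ X) (motive := motive) scalar gen mul add a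

/-- The algebra homomorphism out of the free algebra with prescribed values on the symbols. -/
noncomputable def liftSymb {B : Type*} [Ring B] [Algebra ℂ B] (f : X ⊕ X → B) :
    StarPoly X →ₐ[ℂ] B :=
  (FreeAlgebra.lift ℂ f : FreeAlgebra ℂ (X ⊕ X) →ₐ[ℂ] B)

theorem liftSymb_symb {B : Type*} [Ring B] [Algebra ℂ B] (f : X ⊕ X → B) (x : X ⊕ X) :
    liftSymb f (symb x) = f x :=
  FreeAlgebra.lift_ι_apply f x

/-- The conjugate-linear antimultiplicative map exchanging `x` and `x*`. -/
noncomputable def conjOp : StarPoly X →+* (StarPoly X)ᵐᵒᵖ :=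
  letI : Algebra ℂ (StarPoly X)ᵐᵒᵖ :=
    RingHom.toAlgebra' ((algebraMap ℂ (StarPoly X)ᵐᵒᵖ).comp (starRingEnd ℂ))
      (fun c x => Algebra.commutes (starRingEnd ℂ c) x)
  (liftSymb (fun x : X ⊕ X => MulOpposite.op (symb x.swap))).toRingHom

theorem conjOp_symb (x : X ⊕ X) : conjOp (symb x) = MulOpposite.op (symb x.swap) := by
  let : Algebra ℂ (StarPoly X)ᵐᵒᵖ :=
    RingHom.toAlgebra' ((algebraMap ℂ (StarPoly X)ᵐᵒᵖ).comp (starRingEnd ℂ))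
      (fun c x => Algebra.commutes (starRingEnd ℂ c) x)
  exact liftSymb_symb (fun x : X ⊕ X => MulOpposite.op (symb x.swap)) x

theorem conjOp_algebraMap (c : ℂ) :
    conjOp (algebraMap ℂ (StarPoly X) c) =
      MulOpposite.op (algebraMap ℂ (StarPoly X) (star c)) := by
  let : Algebra ℂ (StarPoly X)ᵐᵒᵖ :=
    RingHom.toAlgebra' ((algebraMap ℂ (StarPoly X)ᵐᵒᵖ).comp (starRingEnd ℂ))
      (fun c x => Algebra.commutes (starRingEnd ℂ c) x)
  exact AlgHom.commutes (liftSymb (fun x : X ⊕ X => MulOpposite.op (symb x.swap))) c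

/-- The involution is the conjugate-linear antiautomorphism exchanging `x` and `x*`. -/
noncomputable instance : StarRing (StarPoly X) where
  star a := (conjOp a).unop
  star_involutive a := by
    induction a using induction_on with
    | scalar c => simp [conjOp_algebraMap]
    | gen x => simp [conjOp_symb]
    | mul a b ha hb => simp [ha, hb]
    | add a b ha hb => simp [ha, hb]
  star_mul a b := by simp
  star_add a b := by simp

theorem star_def (a : StarPoly X) : star a = (conjOp a).unop := rfl

theorem star_symb (x : X ⊕ X) : star (symb x) = symb x.swap := by
  simp [star_def, conjOp_symb]

theorem star_algebraMap (c : ℂ) :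
    star (algebraMap ℂ (StarPoly X) c) = algebraMap ℂ (StarPoly X) (star c) := by
  simp [star_def, conjOp_algebraMap]

instance : StarModule ℂ (StarPoly X) where
  star_smul c a := by
    rw [Algebra.smul_def, star_mul, star_algebraMap, Algebra.smul_def, Algebra.commutes]

/-- Evaluation of `*`-polynomials at a family `f` of elements of a unital `*`-algebra. -/
noncomputable def eval {B : Type*} [Ring B] [StarRing B] [Algebra ℂ B] [StarModule ℂ B]
    (f : X → B) : StarPoly X →⋆ₐ[ℂ] B where
  toAlgHom := liftSymb (Sum.elim f (fun x => star (f x)))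
  map_star' a := by
    change liftSymb _ (star a) = star (liftSymb _ a)
    induction a using induction_on with
    | scalar c => rw [star_algebraMap, AlgHom.commutes, AlgHom.commutes, ← algebraMap_star_comm]
    | gen x => rw [star_symb, liftSymb_symb, liftSymb_symb]; cases x <;> simp
    | mul a b ha hb => rw [star_mul, map_mul, map_mul, star_mul, ha, hb]
    | add a b ha hb => rw [star_add, map_add, map_add, star_add, ha, hb]

theorem eval_var {B : Type*} [Ring B] [StarRing B] [Algebra ℂ B] [StarModule ℂ B]
    (f : X → B) (x : X) : eval f (var x) = f x :=
  liftSymb_symb _ _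

end StarPoly

open StarPoly

/-- The relations `r = 0` and `r* = 0` for `r ∈ R`. -/
def starRel {X : Type} (R : Set (StarPoly X)) (a b : StarPoly X) : Prop :=
  (a ∈ R ∨ star a ∈ R) ∧ b = 0

/-- The universal unital `*`-algebra generated by a family indexed by `X` and subject to the
relations `r = 0`, `r ∈ R`: the quotient of the `*`-polynomials by the two-sided `*`-ideal
generated by `R`. -/
def UnivStar {X : Type} (R : Set (StarPoly X)) : Type := RingQuot (starRel R)

namespace UnivStar

variable {X : Type} {R : Set (StarPoly X)}

noncomputable instance : Ring (UnivStar R) := inferInstanceAs (Ring (RingQuot (starRel R)))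

noncomputable instance : Algebra ℂ (UnivStar R) :=
  inferInstanceAs (Algebra ℂ (RingQuot (starRel R)))

/-- The quotient map, as a homomorphism of algebras. -/
noncomputable def mkAlg (R : Set (StarPoly X)) : StarPoly X →ₐ[ℂ] UnivStar R :=
  RingQuot.mkAlgHom ℂ (starRel R)

theorem mkAlg_surjective (R : Set (StarPoly X)) : Function.Surjective (mkAlg R) :=
  RingQuot.mkAlgHom_surjective ℂ (starRel R)

theorem mkAlg_rel {r : StarPoly X} (h : r ∈ R ∨ star r ∈ R) : mkAlg R r = 0 := by
  have := RingQuot.mkAlgHom_rel ℂ (s := starRel R) (x := r) (y := 0) ⟨h, rfl⟩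
  rw [map_zero] at this
  exact this

/-- The involution of the quotient, with values in the opposite ring. -/
noncomputable def conjOp (R : Set (StarPoly X)) : UnivStar R →+* (UnivStar R)ᵐᵒᵖ :=
  RingQuot.lift ⟨((mkAlg R).toRingHom.op).comp (starRingEquiv (R := StarPoly X)).toRingHom, by
    rintro a b ⟨h, rfl⟩
    have h' : mkAlg R (star a) = 0 := mkAlg_rel (by rw [star_star]; exact h.symm)
    simp [h']⟩

theorem conjOp_mk (a : StarPoly X) : conjOp R (mkAlg R a) = MulOpposite.op (mkAlg R (star a)) := by
  have h : (mkAlg R a) = (RingQuot.mkRingHom (starRel R) a : RingQuot (starRel R)) :=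
    DFunLike.congr_fun (RingQuot.mkAlgHom_coe ℂ (starRel R)) a
  rw [h]
  exact RingQuot.lift_mkRingHom_apply _ _ _

noncomputable instance : StarRing (UnivStar R) where
  star a := (conjOp R a).unop
  star_involutive a := by
    obtain ⟨a, rfl⟩ := mkAlg_surjective R a
    simp [conjOp_mk]
  star_mul a b := by simp
  star_add a b := by simp

theorem star_mk (a : StarPoly X) : star (mkAlg R a) = mkAlg R (star a) :=
  congrArg MulOpposite.unop (conjOp_mk a)

instance : StarModule ℂ (UnivStar R) where
  star_smul c a := by
    obtain ⟨a, rfl⟩ := mkAlg_surjective R a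
    rw [← map_smul, star_mk, star_mk, star_smul, map_smul]

/-- The quotient map. -/
noncomputable def mk (R : Set (StarPoly X)) : StarPoly X →⋆ₐ[ℂ] UnivStar R where
  toAlgHom := mkAlg R
  map_star' a := (star_mk a).symm

theorem mk_surjective (R : Set (StarPoly X)) : Function.Surjective (mk R) := mkAlg_surjective R

theorem mk_rel {r : StarPoly X} (h : r ∈ R) : mk R r = 0 := mkAlg_rel (Or.inl h)

/-- The canonical generators. -/
noncomputable def gen (R : Set (StarPoly X)) (x : X) : UnivStar R := mk R (var x)

theorem eq_top_of_gen_mem (S : StarSubalgebra ℂ (UnivStar R)) (h : ∀ x, gen R x ∈ S) :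
    S = ⊤ := by
  rw [eq_top_iff]
  rintro a -
  obtain ⟨a, rfl⟩ := mk_surjective R a
  induction a using StarPoly.induction_on with
  | scalar c => rw [AlgHomClass.commutes]; exact algebraMap_mem S c
  | gen x =>
    cases x with
    | inl x => exact h x
    | inr x =>
      have h1 : (symb (Sum.inr x) : StarPoly X) = star (var x) := by
        simp [var, star_symb]
      rw [h1, map_star]
      exact star_mem (h x)
  | mul a b ha hb => rw [map_mul]; exact mul_mem ha hb
  | add a b ha hb => rw [map_add]; exact add_mem ha hb

theorem eval_gen (a : StarPoly X) : eval (gen R) a = mk R a := by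
  induction a using StarPoly.induction_on with
  | scalar c => rw [AlgHomClass.commutes, AlgHomClass.commutes]
  | gen x =>
    cases x with
    | inl x => exact eval_var _ _
    | inr x =>
      have h1 : (symb (Sum.inr x) : StarPoly X) = star (var x) := by
        simp [var, star_symb]
      rw [h1, map_star, map_star, eval_var]; rfl
  | mul a b ha hb => rw [map_mul, map_mul, ha, hb]
  | add a b ha hb => rw [map_add, map_add, ha, hb]

/-- The universal property. -/
noncomputable def lift {B : Type*} [Ring B] [StarRing B] [Algebra ℂ B] [StarModule ℂ B]
    (f : X → B) (hf : ∀ r ∈ R, eval f r = 0) : UnivStar R →⋆ₐ[ℂ] B :=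
  let g : UnivStar R →ₐ[ℂ] B := RingQuot.liftAlgHom ℂ ⟨(eval f).toAlgHom, by
    rintro a b ⟨h, rfl⟩
    rw [map_zero]
    change eval f a = 0
    rcases h with h | h
    · exact hf a h
    · rw [← star_star a, map_star, hf _ h, star_zero]⟩
  have hg : ∀ a, g (mkAlg R a) = eval f a := fun a =>
    RingQuot.liftAlgHom_mkAlgHom_apply ℂ (eval f).toAlgHom _ a
  { toAlgHom := g
    map_star' := by
      intro a
      obtain ⟨a, rfl⟩ := mkAlg_surjective R a
      change g (star (mkAlg R a)) = star (g (mkAlg R a))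
      rw [star_mk, hg, hg, map_star] }

theorem lift_mk {B : Type*} [Ring B] [StarRing B] [Algebra ℂ B] [StarModule ℂ B]
    (f : X → B) (hf : ∀ r ∈ R, eval f r = 0) (a : StarPoly X) :
    lift f hf (mk R a) = eval f a :=
  RingQuot.liftAlgHom_mkAlgHom_apply ℂ (eval f).toAlgHom _ a

theorem lift_gen {B : Type*} [Ring B] [StarRing B] [Algebra ℂ B] [StarModule ℂ B]
    (f : X → B) (hf : ∀ r ∈ R, eval f r = 0) (x : X) : lift f hf (gen R x) = f x := by
  rw [gen, lift_mk, eval_var]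

end UnivStar

/-- The `*`-polynomials expressing that a family `j : A → StarPoly X` is a homomorphism of unital
`*`-algebras. -/
def homRel {X A : Type} [Ring A] [StarRing A] [Algebra ℂ A] (j : A → StarPoly X) :
    Set (StarPoly X) :=
  {j 1 - 1} ∪ {r | ∃ a b, r = j (a + b) - (j a + j b)} ∪ {r | ∃ a b, r = j (a * b) - j a * j b} ∪
    {r | ∃ (c : ℂ) (a : A), r = j (c • a) - c • j a} ∪ {r | ∃ a, r = j (star a) - star (j a)}

/-- If the relations contain `homRel j`, then `j` induces a `*`-homomorphism to the quotient. -/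
noncomputable def UnivStar.incl {X A : Type} [Ring A] [StarRing A] [Algebra ℂ A]
    {R : Set (StarPoly X)} (j : A → StarPoly X) (h : homRel j ⊆ R) : A →⋆ₐ[ℂ] UnivStar R where
  toAlgHom := AlgHom.ofLinearMap
    { toFun := fun a => mk R (j a)
      map_add' := fun a b => by
        have := mk_rel (h (Or.inl (Or.inl (Or.inl (Or.inr ⟨a, b, rfl⟩)))))
        rwa [map_sub, map_add, sub_eq_zero] at this
      map_smul' := fun c a => by
        have := mk_rel (h (Or.inl (Or.inr ⟨c, a, rfl⟩)))
        rwa [map_sub, map_smul, sub_eq_zero] at this }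
    (by
      have := mk_rel (h (Or.inl (Or.inl (Or.inl (Or.inl rfl)))))
      rwa [map_sub, map_one, sub_eq_zero] at this)
    (fun a b => by
      have := mk_rel (h (Or.inl (Or.inl (Or.inr ⟨a, b, rfl⟩))))
      rwa [map_sub, map_mul, sub_eq_zero] at this)
  map_star' a := by
    have := mk_rel (h (Or.inr ⟨a, rfl⟩))
    rwa [map_sub, map_star, sub_eq_zero] at this

theorem UnivStar.incl_apply {X A : Type} [Ring A] [StarRing A] [Algebra ℂ A]
    {R : Set (StarPoly X)} (j : A → StarPoly X) (h : homRel j ⊆ R) (a : A) :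
    UnivStar.incl j h a = UnivStar.mk R (j a) := rfl

theorem eval_homRel {X A B : Type} [Ring A] [StarRing A] [Algebra ℂ A]
    [Ring B] [StarRing B] [Algebra ℂ B] [StarModule ℂ B] (f : X → B) (j : A → StarPoly X)
    (g : A →⋆ₐ[ℂ] B) (hg : ∀ a, eval f (j a) = g a) : ∀ r ∈ homRel j, eval f r = 0 := by
  rintro r ((((rfl | ⟨a, b, rfl⟩) | ⟨a, b, rfl⟩) | ⟨c, a, rfl⟩) | ⟨a, rfl⟩)
  · rw [map_sub, map_one, hg, map_one, sub_self]
  · rw [map_sub, map_add, hg, hg, hg, map_add, sub_self]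
  · rw [map_sub, map_mul, hg, hg, hg, map_mul, sub_self]
  · rw [map_sub, map_smul, hg, hg, map_smul, sub_self]
  · rw [map_sub, map_star, hg, hg, map_star, sub_self]

/-- The tensor product of two `*`-homomorphisms. -/
noncomputable def StarAlgHom.tensor {A B A' B' : Type}
    [Ring A] [StarRing A] [Algebra ℂ A] [StarModule ℂ A]
    [Ring B] [StarRing B] [Algebra ℂ B] [StarModule ℂ B]
    [Ring A'] [StarRing A'] [Algebra ℂ A'] [StarModule ℂ A']
    [Ring B'] [StarRing B'] [Algebra ℂ B'] [StarModule ℂ B']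
    (f : A →⋆ₐ[ℂ] A') (g : B →⋆ₐ[ℂ] B') : A ⊗[ℂ] B →⋆ₐ[ℂ] A' ⊗[ℂ] B' where
  toAlgHom := Algebra.TensorProduct.map f.toAlgHom g.toAlgHom
  map_star' x := by
    change Algebra.TensorProduct.map f.toAlgHom g.toAlgHom (star x) =
      star (Algebra.TensorProduct.map f.toAlgHom g.toAlgHom x)
    induction x using TensorProduct.induction_on with
    | zero => simp
    | tmul a b =>
      rw [TensorProduct.star_tmul, Algebra.TensorProduct.map_tmul,
        Algebra.TensorProduct.map_tmul, TensorProduct.star_tmul]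
      exact congrArg₂ _ (map_star f a) (map_star g b)
    | add x y hx hy => rw [star_add, map_add, map_add, star_add, hx, hy]

theorem StarAlgHom.tensor_tmul {A B A' B' : Type}
    [Ring A] [StarRing A] [Algebra ℂ A] [StarModule ℂ A]
    [Ring B] [StarRing B] [Algebra ℂ B] [StarModule ℂ B]
    [Ring A'] [StarRing A'] [Algebra ℂ A'] [StarModule ℂ A']
    [Ring B'] [StarRing B'] [Algebra ℂ B'] [StarModule ℂ B']
    (f : A →⋆ₐ[ℂ] A') (g : B →⋆ₐ[ℂ] B') (a : A) (b : B) :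
    StarAlgHom.tensor f g (a ⊗ₜ b) = f a ⊗ₜ g b := rfl

/-! ### Magic matrices and quantum permutation groups -/

/-- The relations of a magic unitary: the entries are self-adjoint idempotents, every row and every
column sums to `1`, and distinct entries of one row or of one column are orthogonal. -/
structure IsMagic {I J A : Type} [Fintype I] [Fintype J] [Ring A] [StarRing A]
    (u : Matrix I J A) : Prop where
  star_eq : ∀ i j, star (u i j) = u i j
  idem : ∀ i j, u i j * u i j = u i j
  row_sum : ∀ i, ∑ j, u i j = 1
  col_sum : ∀ j, ∑ i, u i j = 1
  row_orth : ∀ i j k, j ≠ k → u i j * u i k = 0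
  col_orth : ∀ i j k, i ≠ k → u i j * u k j = 0

/-- The matrix of variables `(x_{ij})`. -/
noncomputable def varMatrix (I : Type) : Matrix I I (StarPoly (I × I)) :=
  Matrix.of fun i j => var (i, j)

/-- The `*`-polynomials in the variables `x_{ij}` defining magic unitaries. -/
def magicRel (I : Type) [Fintype I] : Set (StarPoly (I × I)) :=
  {r | ∃ i j, r = star (varMatrix I i j) - varMatrix I i j} ∪
  {r | ∃ i j, r = varMatrix I i j * varMatrix I i j - varMatrix I i j} ∪
  {r | ∃ i, r = ∑ j, varMatrix I i j - 1} ∪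
  {r | ∃ j, r = ∑ i, varMatrix I i j - 1} ∪
  {r | ∃ i j k, j ≠ k ∧ r = varMatrix I i j * varMatrix I i k} ∪
  {r | ∃ i j k, i ≠ k ∧ r = varMatrix I i j * varMatrix I k j}

theorem eval_varMatrix {I B : Type} [Ring B] [StarRing B] [Algebra ℂ B] [StarModule ℂ B]
    (v : Matrix I I B) (i j : I) : eval (fun x : I × I => v x.1 x.2) (varMatrix I i j) = v i j :=
  eval_var _ _

theorem isMagic_iff_eval {I B : Type} [Fintype I] [Ring B] [StarRing B] [Algebra ℂ B]
    [StarModule ℂ B] (v : Matrix I I B) :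
    IsMagic v ↔ ∀ r ∈ magicRel I, eval (fun x : I × I => v x.1 x.2) r = 0 := by
  constructor
  · rintro h r (((((⟨i, j, rfl⟩ | ⟨i, j, rfl⟩) | ⟨i, rfl⟩) | ⟨j, rfl⟩) | ⟨i, j, k, hk, rfl⟩) |
      ⟨i, j, k, hk, rfl⟩)
    · rw [map_sub, map_star, eval_varMatrix, h.star_eq, sub_self]
    · rw [map_sub, map_mul, eval_varMatrix, h.idem, sub_self]
    · simp only [map_sub, map_sum, eval_varMatrix, h.row_sum, map_one, sub_self]
    · simp only [map_sub, map_sum, eval_varMatrix, h.col_sum, map_one, sub_self]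
    · rw [map_mul, eval_varMatrix, eval_varMatrix, h.row_orth i j k hk]
    · rw [map_mul, eval_varMatrix, eval_varMatrix, h.col_orth i j k hk]
  · intro h
    refine ⟨fun i j => ?_, fun i j => ?_, fun i => ?_, fun j => ?_, fun i j k hk => ?_,
      fun i j k hk => ?_⟩
    · have := h _ (Or.inl (Or.inl (Or.inl (Or.inl (Or.inl ⟨i, j, rfl⟩)))))
      rwa [map_sub, map_star, eval_varMatrix, sub_eq_zero] at this
    · have := h _ (Or.inl (Or.inl (Or.inl (Or.inl (Or.inr ⟨i, j, rfl⟩)))))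
      rwa [map_sub, map_mul, eval_varMatrix, sub_eq_zero] at this
    · have := h _ (Or.inl (Or.inl (Or.inl (Or.inr ⟨i, rfl⟩))))
      simpa only [map_sub, map_sum, eval_varMatrix, map_one, sub_eq_zero] using this
    · have := h _ (Or.inl (Or.inl (Or.inr ⟨j, rfl⟩)))
      simpa only [map_sub, map_sum, eval_varMatrix, map_one, sub_eq_zero] using this
    · have := h _ (Or.inl (Or.inr ⟨i, j, k, hk, rfl⟩))
      rwa [map_mul, eval_varMatrix, eval_varMatrix] at this
    · have := h _ (Or.inr ⟨i, j, k, hk, rfl⟩)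
      rwa [map_mul, eval_varMatrix, eval_varMatrix] at this

/-- The matrix `(∑ k, u_{ik} ⊗ v_{kj})`. -/
noncomputable def matConv {I A B : Type} [Fintype I] [Ring A] [Algebra ℂ A] [Ring B] [Algebra ℂ B]
    (u : Matrix I I A) (v : Matrix I I B) : Matrix I I (A ⊗[ℂ] B) :=
  Matrix.of fun i j => ∑ k, u i k ⊗ₜ[ℂ] v k j

theorem IsMagic.conv_mul {I A B : Type} [Fintype I]
    [Ring A] [StarRing A] [Algebra ℂ A] [Ring B] [StarRing B] [Algebra ℂ B]
    {u : Matrix I I A} {v : Matrix I I B} (hu : IsMagic u) (i j l : I) :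
    matConv u v i j * matConv u v i l = ∑ k, u i k ⊗ₜ[ℂ] (v k j * v k l) := by
  simp only [matConv, Matrix.of_apply, Finset.sum_mul_sum, Algebra.TensorProduct.tmul_mul_tmul]
  refine Finset.sum_congr rfl fun k _ => ?_
  rw [Finset.sum_eq_single k, hu.idem]
  · intro m _ hm
    rw [hu.row_orth i k m hm.symm, TensorProduct.zero_tmul]
  · simp

theorem IsMagic.conv {I A B : Type} [Fintype I]
    [Ring A] [StarRing A] [Algebra ℂ A] [StarModule ℂ A]
    [Ring B] [StarRing B] [Algebra ℂ B] [StarModule ℂ B]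
    {u : Matrix I I A} {v : Matrix I I B} (hu : IsMagic u) (hv : IsMagic v) :
    IsMagic (matConv u v) where
  star_eq i j := by simp [matConv, star_sum, TensorProduct.star_tmul, hu.star_eq, hv.star_eq]
  idem i j := by
    rw [hu.conv_mul]
    simp only [hv.idem]
    rfl
  row_sum i := by
    simp only [matConv, Matrix.of_apply]
    rw [Finset.sum_comm]
    simp only [← TensorProduct.tmul_sum, hv.row_sum, ← TensorProduct.sum_tmul, hu.row_sum]
    rfl
  col_sum j := by
    simp only [matConv, Matrix.of_apply]
    rw [Finset.sum_comm]
    simp only [← TensorProduct.sum_tmul, hu.col_sum, ← TensorProduct.tmul_sum, hv.col_sum]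
    rfl
  row_orth i j l h := by
    rw [hu.conv_mul]
    exact Finset.sum_eq_zero fun k _ => by rw [hv.row_orth k j l h, TensorProduct.tmul_zero]
  col_orth i j l h := by
    simp only [matConv, Matrix.of_apply, Finset.sum_mul_sum, Algebra.TensorProduct.tmul_mul_tmul]
    refine Finset.sum_eq_zero fun k _ => Finset.sum_eq_zero fun m _ => ?_
    by_cases hkm : k = m
    · subst hkm
      rw [hu.col_orth i k l h, TensorProduct.zero_tmul]
    · rw [hv.col_orth k j m hkm, TensorProduct.tmul_zero]

theorem IsMagic.map {I J A B : Type} [Fintype I] [Fintype J]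
    [Ring A] [StarRing A] [Algebra ℂ A] [Ring B] [StarRing B] [Algebra ℂ B]
    {u : Matrix I J A} (hu : IsMagic u) (f : A →⋆ₐ[ℂ] B) : IsMagic (u.map f) where
  star_eq i j := by rw [Matrix.map_apply, ← map_star, hu.star_eq]
  idem i j := by rw [Matrix.map_apply, ← map_mul, hu.idem]
  row_sum i := by simp only [Matrix.map_apply, ← map_sum, hu.row_sum, map_one]
  col_sum j := by simp only [Matrix.map_apply, ← map_sum, hu.col_sum, map_one]
  row_orth i j k h := by rw [Matrix.map_apply, Matrix.map_apply, ← map_mul, hu.row_orth i j k h,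
    map_zero]
  col_orth i j k h := by rw [Matrix.map_apply, Matrix.map_apply, ← map_mul, hu.col_orth i j k h,
    map_zero]

/-- A quantum permutation group: a unital `*`-algebra generated by the entries of a matrix `u` that
satisfies the relations of a magic unitary, together with the (unique) comultiplication
`u_{ij} ↦ ∑ k, u_{ik} ⊗ u_{kj}`. -/
structure QPermGroup where
  /-- the index set of the fundamental representation -/
  idx : Type
  [fintypeIdx : Fintype idx]
  /-- the algebra of coefficients -/
  alg : Type
  [ringAlg : Ring alg]
  [starRingAlg : StarRing alg]
  [algebraAlg : Algebra ℂ alg]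
  [starModuleAlg : StarModule ℂ alg]
  /-- the fundamental representation -/
  u : Matrix idx idx alg
  magic : IsMagic u
  generated : StarAlgebra.adjoin ℂ (Set.range fun x : idx × idx => u x.1 x.2) = ⊤
  /-- the comultiplication -/
  comul : alg →⋆ₐ[ℂ] alg ⊗[ℂ] alg
  comul_u : ∀ i j, comul (u i j) = ∑ k, u i k ⊗ₜ[ℂ] u k j

attribute [instance] QPermGroup.fintypeIdx QPermGroup.ringAlg QPermGroup.starRingAlg
  QPermGroup.algebraAlg QPermGroup.starModuleAlg

namespace QPermGroup

/-- Isomorphism of quantum permutation groups (of possibly different sizes): an isomorphism of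
`*`-algebras that is compatible with the comultiplications. -/
def Isomorphic (P Q : QPermGroup) : Prop :=
  ∃ f : P.alg ≃⋆ₐ[ℂ] Q.alg, ∀ a : P.alg,
    Q.comul (f a) = StarAlgHom.tensor (f : P.alg →⋆ₐ[ℂ] Q.alg) (f : P.alg →⋆ₐ[ℂ] Q.alg) (P.comul a)

/-- The trivial quantum group: the algebra of coefficients is `ℂ`. -/
def IsTrivial (P : QPermGroup) : Prop := Function.Bijective (algebraMap ℂ P.alg)

/-- The quantum permutation group defined by the magic relations and further relations `R` that are
compatible with the comultiplication. -/
noncomputable def ofRel (I : Type) [Fintype I] (R : Set (StarPoly (I × I)))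
    (h : ∀ r ∈ R, eval (fun x : I × I =>
      matConv (Matrix.of fun i j => UnivStar.gen (magicRel I ∪ R) (i, j))
        (Matrix.of fun i j => UnivStar.gen (magicRel I ∪ R) (i, j)) x.1 x.2) r = 0) :
    QPermGroup :=
  have hm : IsMagic (Matrix.of fun i j => UnivStar.gen (magicRel I ∪ R) (i, j)) := by
    rw [isMagic_iff_eval]
    intro r hr
    exact (UnivStar.eval_gen r).trans (UnivStar.mk_rel (Or.inl hr))
  { idx := I
    alg := UnivStar (magicRel I ∪ R)
    u := Matrix.of fun i j => UnivStar.gen (magicRel I ∪ R) (i, j)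
    magic := hm
    generated := UnivStar.eq_top_of_gen_mem _ fun x =>
      StarAlgebra.subset_adjoin ℂ _ ⟨x, rfl⟩
    comul := UnivStar.lift _ (by
      rintro r (hr | hr)
      · exact (isMagic_iff_eval _).1 (hm.conv hm) r hr
      · exact h r hr)
    comul_u := fun i j => UnivStar.lift_gen _ _ _ }

/-- The quantum symmetric group `S_n⁺`. -/
noncomputable def symm (n : ℕ) : QPermGroup := ofRel (Fin n) ∅ (by simp)

end QPermGroup

/-! ### Graphs and their quantum automorphism groups -/

open Classical in
/-- The adjacency matrix with entries in a ring. -/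
noncomputable def adjMat {V : Type} (G : SimpleGraph V) (A : Type) [Ring A] : Matrix V V A :=
  G.adjMatrix A

/-- The `*`-polynomials given by the entries of the commutator `[Adj(G), x]`. -/
def commRel {V : Type} [Fintype V] (G : SimpleGraph V) : Set (StarPoly (V × V)) :=
  {r | ∃ x y, r = (adjMat G (StarPoly (V × V)) * varMatrix V -
    varMatrix V * adjMat G (StarPoly (V × V))) x y}

theorem adjMat_mul_apply {V W A : Type} [Fintype V] (G : SimpleGraph V) [Ring A]
    (u : Matrix V W A) (x : V) (y : W) :
    (adjMat G A * u) x y = ∑ z, adjMat G A x z * u z y := rfl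

theorem mul_adjMat_apply {V W A : Type} [Fintype V] (G : SimpleGraph V) [Ring A]
    (u : Matrix W V A) (x : W) (y : V) :
    (u * adjMat G A) x y = ∑ z, u x z * adjMat G A z y := rfl

theorem map_adjMat {V A B F : Type} (G : SimpleGraph V) [Ring A] [Ring B]
    [FunLike F A B] [RingHomClass F A B] (f : F) (x y : V) :
    f (adjMat G A x y) = adjMat G B x y := by
  classical
  simp only [adjMat, SimpleGraph.adjMatrix_apply]
  split_ifs <;> simp

theorem eval_commRel {V B : Type} [Fintype V] (G : SimpleGraph V) [Ring B] [StarRing B]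
    [Algebra ℂ B] [StarModule ℂ B] (v : Matrix V V B) :
    (∀ r ∈ commRel G, eval (fun x : V × V => v x.1 x.2) r = 0) ↔
      adjMat G B * v = v * adjMat G B := by
  have key : ∀ x y, eval (fun x : V × V => v x.1 x.2) ((adjMat G (StarPoly (V × V)) * varMatrix V -
      varMatrix V * adjMat G (StarPoly (V × V))) x y) =
      (adjMat G B * v - v * adjMat G B) x y := by
    intro x y
    simp only [Matrix.sub_apply, adjMat_mul_apply, mul_adjMat_apply, map_sub, map_sum, map_mul,
      eval_varMatrix, map_adjMat]
  constructor
  · intro h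
    rw [← sub_eq_zero]
    ext x y
    rw [← key]
    exact h _ ⟨x, y, rfl⟩
  · rintro h r ⟨x, y, rfl⟩
    rw [key, h, sub_self, Matrix.zero_apply]

theorem adjMat_conv {V A B : Type} [Fintype V] (G : SimpleGraph V)
    [Ring A] [Algebra ℂ A] [Ring B] [Algebra ℂ B] {u : Matrix V V A} {v : Matrix V V B}
    (hu : adjMat G A * u = u * adjMat G A) (hv : adjMat G B * v = v * adjMat G B) :
    adjMat G (A ⊗[ℂ] B) * matConv u v = matConv u v * adjMat G (A ⊗[ℂ] B) := by
  have h1 : ∀ x y, adjMat G (A ⊗[ℂ] B) x y = adjMat G A x y ⊗ₜ 1 := fun x y =>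
    (map_adjMat G (Algebra.TensorProduct.includeLeft : A →ₐ[ℂ] A ⊗[ℂ] B) x y).symm
  have h2 : ∀ x y, adjMat G (A ⊗[ℂ] B) x y = 1 ⊗ₜ adjMat G B x y := fun x y =>
    (map_adjMat G (Algebra.TensorProduct.includeRight : B →ₐ[ℂ] A ⊗[ℂ] B) x y).symm
  have h3 : ∀ x y, adjMat G A x y ⊗ₜ[ℂ] (1 : B) = (1 : A) ⊗ₜ[ℂ] adjMat G B x y := fun x y =>
    (h1 x y).symm.trans (h2 x y)
  ext x y
  calc (adjMat G (A ⊗[ℂ] B) * matConv u v) x y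
      = ∑ k, (adjMat G A * u) x k ⊗ₜ[ℂ] v k y := by
        rw [adjMat_mul_apply]
        simp only [adjMat_mul_apply, h1, matConv, Matrix.of_apply, Finset.mul_sum,
          Algebra.TensorProduct.tmul_mul_tmul, one_mul, TensorProduct.sum_tmul]
        rw [Finset.sum_comm]
    _ = ∑ k, ∑ z, (u x z * adjMat G A z k) ⊗ₜ[ℂ] v k y := by
        simp only [hu, mul_adjMat_apply, TensorProduct.sum_tmul]
    _ = ∑ k, ∑ z, u x z ⊗ₜ[ℂ] (adjMat G B z k * v k y) := by
        refine Finset.sum_congr rfl fun k _ => Finset.sum_congr rfl fun z _ => ?_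
        have e1 : (u x z * adjMat G A z k) ⊗ₜ[ℂ] v k y =
            (u x z ⊗ₜ[ℂ] 1) * (adjMat G A z k ⊗ₜ[ℂ] 1) * (1 ⊗ₜ[ℂ] v k y) := by simp
        have e2 : u x z ⊗ₜ[ℂ] (adjMat G B z k * v k y) =
            (u x z ⊗ₜ[ℂ] 1) * (1 ⊗ₜ[ℂ] adjMat G B z k) * (1 ⊗ₜ[ℂ] v k y) := by simp
        rw [e1, e2, h3]
    _ = ∑ z, u x z ⊗ₜ[ℂ] (v * adjMat G B) z y := by
        rw [Finset.sum_comm]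
        simp only [← TensorProduct.tmul_sum, ← hv, adjMat_mul_apply]
    _ = (matConv u v * adjMat G (A ⊗[ℂ] B)) x y := by
        rw [mul_adjMat_apply]
        simp only [mul_adjMat_apply, h2, matConv, Matrix.of_apply, Finset.sum_mul,
          Algebra.TensorProduct.tmul_mul_tmul, mul_one, TensorProduct.tmul_sum]
        rw [Finset.sum_comm]

/-- The quantum automorphism group of a finite graph: the universal unital `*`-algebra generated by
the entries of a magic matrix commuting with the adjacency matrix. -/
noncomputable def QPermGroup.qAut {V : Type} [Fintype V] (G : SimpleGraph V) : QPermGroup :=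
  QPermGroup.ofRel V (commRel G) (by
    have h : adjMat G _ * (Matrix.of fun i j => UnivStar.gen (magicRel V ∪ commRel G) (i, j)) =
        (Matrix.of fun i j => UnivStar.gen (magicRel V ∪ commRel G) (i, j)) * adjMat G _ :=
      (eval_commRel G _).1 fun r hr =>
        (UnivStar.eval_gen r).trans (UnivStar.mk_rel (Or.inr hr))
    exact (eval_commRel G _).2 (adjMat_conv G h h))

/-! ### Free products and free wreath products -/

namespace QPermGroup

/-- Relations of the unital free product of `*`-algebras, as the universal unital `*`-algebra
generated by copies of the elements of `A` and `B`. -/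
def freeRel (A B : Type) [Ring A] [StarRing A] [Algebra ℂ A] [Ring B] [StarRing B] [Algebra ℂ B] :
    Set (StarPoly (A ⊕ B)) :=
  homRel (fun a : A => var (Sum.inl a : A ⊕ B)) ∪ homRel (fun b : B => var (Sum.inr b : A ⊕ B))

section FreeProduct

variable (P Q : QPermGroup)

/-- The canonical map from the first factor to the unital free product. -/
noncomputable def freeInl : P.alg →⋆ₐ[ℂ] UnivStar (freeRel P.alg Q.alg) :=
  UnivStar.incl (fun a => var (Sum.inl a)) Set.subset_union_left

/-- The canonical map from the second factor to the unital free product. -/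
noncomputable def freeInr : Q.alg →⋆ₐ[ℂ] UnivStar (freeRel P.alg Q.alg) :=
  UnivStar.incl (fun b => var (Sum.inr b)) Set.subset_union_right

/-- The comultiplication of the free product; it extends those of the factors. -/
noncomputable def freeComul : UnivStar (freeRel P.alg Q.alg) →⋆ₐ[ℂ]
    UnivStar (freeRel P.alg Q.alg) ⊗[ℂ] UnivStar (freeRel P.alg Q.alg) :=
  UnivStar.lift
    (Sum.elim (fun a => StarAlgHom.tensor (freeInl P Q) (freeInl P Q) (P.comul a))
      (fun b => StarAlgHom.tensor (freeInr P Q) (freeInr P Q) (Q.comul b))) (by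
    rintro r (hr | hr)
    · exact eval_homRel _ (fun a : P.alg => var (Sum.inl a : P.alg ⊕ Q.alg))
        ((StarAlgHom.tensor (freeInl P Q) (freeInl P Q)).comp P.comul)
        (fun a => eval_var _ _) r hr
    · exact eval_homRel _ (fun b : Q.alg => var (Sum.inr b : P.alg ⊕ Q.alg))
        ((StarAlgHom.tensor (freeInr P Q) (freeInr P Q)).comp Q.comul)
        (fun a => eval_var _ _) r hr)

theorem freeComul_inl (a : P.alg) : freeComul P Q (freeInl P Q a) =
    StarAlgHom.tensor (freeInl P Q) (freeInl P Q) (P.comul a) :=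
  UnivStar.lift_gen _ _ _

theorem freeComul_inr (b : Q.alg) : freeComul P Q (freeInr P Q b) =
    StarAlgHom.tensor (freeInr P Q) (freeInr P Q) (Q.comul b) :=
  UnivStar.lift_gen _ _ _

/-- A star subalgebra that contains the images of the generators under a homomorphism contains the
whole image. -/
theorem map_mem_of_gen {B : Type} [Ring B] [StarRing B] [Algebra ℂ B] [StarModule ℂ B]
    (f : P.alg →⋆ₐ[ℂ] B) (S : StarSubalgebra ℂ B) (h : ∀ i j, f (P.u i j) ∈ S) (a : P.alg) :
    f a ∈ S := by
  have h1 : (⊤ : StarSubalgebra ℂ P.alg) ≤ S.comap f := by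
    rw [← P.generated]
    apply StarAlgebra.adjoin_le
    rintro _ ⟨x, rfl⟩
    exact h x.1 x.2
  exact h1 (show a ∈ (⊤ : StarSubalgebra ℂ P.alg) from trivial)

/-- The free product `P * Q`: the unital free product of the algebras, with block-diagonal
fundamental representation. -/
noncomputable def freeProd : QPermGroup where
  idx := P.idx ⊕ Q.idx
  alg := UnivStar (freeRel P.alg Q.alg)
  u := Matrix.fromBlocks (P.u.map (freeInl P Q)) 0 0 (Q.u.map (freeInr P Q))
  magic := by
    have h1 := P.magic.map (freeInl P Q)
    have h2 := Q.magic.map (freeInr P Q)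
    refine ⟨?_, ?_, ?_, ?_, ?_, ?_⟩
    · rintro (i | i) (j | j) <;> simp [-Matrix.map_apply, h1.star_eq, h2.star_eq]
    · rintro (i | i) (j | j) <;> simp [-Matrix.map_apply, h1.idem, h2.idem]
    · rintro (i | i) <;> simp [-Matrix.map_apply, h1.row_sum, h2.row_sum]
    · rintro (i | i) <;> simp [-Matrix.map_apply, h1.col_sum, h2.col_sum]
    · rintro (i | i) (j | j) (k | k) h <;> simp [-Matrix.map_apply]
      · exact h1.row_orth i j k fun e => h (e ▸ rfl)
      · exact h2.row_orth i j k fun e => h (e ▸ rfl)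
    · rintro (i | i) (j | j) (k | k) h <;> simp [-Matrix.map_apply]
      · exact h1.col_orth i j k fun e => h (e ▸ rfl)
      · exact h2.col_orth i j k fun e => h (e ▸ rfl)
  generated := by
    apply UnivStar.eq_top_of_gen_mem
    rintro (a | b)
    · exact P.map_mem_of_gen (freeInl P Q) _ (fun i j =>
        StarAlgebra.subset_adjoin ℂ _ (Set.mem_range.2 ⟨(Sum.inl i, Sum.inl j), rfl⟩)) a
    · exact Q.map_mem_of_gen (freeInr P Q) _ (fun i j =>
        StarAlgebra.subset_adjoin ℂ _ (Set.mem_range.2 ⟨(Sum.inr i, Sum.inr j), rfl⟩)) b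
  comul := freeComul P Q
  comul_u := by
    rintro (i | i) (j | j)
    · simp [freeComul_inl, P.comul_u, StarAlgHom.tensor_tmul]
    · simp
    · simp
    · simp [freeComul_inr, Q.comul_u, StarAlgHom.tensor_tmul]

end FreeProduct

section Wreath

variable (P : QPermGroup) (n : ℕ)

/-- The letters `ν_i(a)`, with `i < n` and `a ∈ A`, and `s ∈ O(S_n⁺)`. -/
abbrev WreathGen : Type := (Fin n × P.alg) ⊕ (symm n).alg

/-- The element `p_{ij}` of `O(S_n⁺)`. -/
noncomputable def symmU (i j : Fin n) : (symm n).alg := (symm n).u i j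

/-- The relations of `A^{*n} * O(S_n⁺) / ⟨[ν_i(a), p_{ij}]⟩`: all `ν_i : A → W` and
`O(S_n⁺) → W` are unital `*`-homomorphisms, and `ν_i(a)` commutes with `p_{ij}`. -/
def wreathRel : Set (StarPoly (WreathGen P n)) :=
  (⋃ i : Fin n, homRel (fun a : P.alg => var (Sum.inl (i, a) : WreathGen P n))) ∪
  homRel (fun s : (symm n).alg => var (Sum.inr s : WreathGen P n)) ∪
  {r | ∃ (i j : Fin n) (a : P.alg),
    r = var (Sum.inl (i, a)) * var (Sum.inr (symmU n i j)) -
      var (Sum.inr (symmU n i j)) * var (Sum.inl (i, a))}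

/-- The canonical maps `ν_i`. -/
noncomputable def wreathNu (i : Fin n) : P.alg →⋆ₐ[ℂ] UnivStar (wreathRel P n) :=
  UnivStar.incl (fun a => var (Sum.inl (i, a))) fun _ h =>
    Or.inl (Or.inl (Set.mem_iUnion.2 ⟨i, h⟩))

/-- The canonical map from `O(S_n⁺)`. -/
noncomputable def wreathS : (symm n).alg →⋆ₐ[ℂ] UnivStar (wreathRel P n) :=
  UnivStar.incl (fun s => var (Sum.inr s)) fun _ h => Or.inl (Or.inr h)

/-- The image of `p_{ij}`. -/
noncomputable def wreathP (i j : Fin n) : UnivStar (wreathRel P n) :=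
  wreathS P n (symmU n i j)

theorem wreathP_magic : IsMagic (Matrix.of (wreathP P n)) :=
  (symm n).magic.map (wreathS P n)

theorem wreath_comm (i j : Fin n) (a : P.alg) :
    wreathNu P n i a * wreathP P n i j = wreathP P n i j * wreathNu P n i a := by
  have := UnivStar.mk_rel (R := wreathRel P n) (Or.inr ⟨i, j, a, rfl⟩)
  rwa [map_sub, map_mul, map_mul, sub_eq_zero] at this

/-- If the `e_j` are self-adjoint projections with sum `1`, pairwise orthogonal and commuting with
the images of the homomorphisms `h_k`, then `a ↦ ∑ j, h_j(a) e_j` is a homomorphism. -/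
noncomputable def sumHom {A T J : Type} [Fintype J] [Ring A] [StarRing A] [Algebra ℂ A]
    [Ring T] [StarRing T] [Algebra ℂ T] (h : J → A →⋆ₐ[ℂ] T) (e : J → T)
    (e_star : ∀ j, star (e j) = e j) (e_idem : ∀ j, e j * e j = e j)
    (e_orth : ∀ j k, j ≠ k → e j * e k = 0) (e_sum : ∑ j, e j = 1)
    (comm : ∀ j k a, h j a * e k = e k * h j a) : A →⋆ₐ[ℂ] T where
  toAlgHom := AlgHom.ofLinearMap
    { toFun := fun a => ∑ j, h j a * e j
      map_add' := fun a b => by simp [add_mul, Finset.sum_add_distrib]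
      map_smul' := fun c a => by simp [Finset.smul_sum] }
    (by simp [e_sum])
    (fun a b => by
      simp only [LinearMap.coe_mk, AddHom.coe_mk, Finset.sum_mul_sum]
      refine Finset.sum_congr rfl fun j _ => ?_
      rw [Finset.sum_eq_single j]
      · rw [map_mul, mul_assoc (h j a) (e j), ← mul_assoc (e j) (h j b), ← comm, mul_assoc (h j b),
          e_idem, mul_assoc]
      · intro k _ hk
        rw [mul_assoc (h j a) (e j), ← mul_assoc (e j) (h k b), ← comm, mul_assoc (h k b),
          e_orth j k hk.symm, mul_zero, mul_zero]
      · simp)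
  map_star' a := by
    change ∑ j, h j (star a) * e j = star (∑ j, h j a * e j)
    rw [star_sum]
    refine Finset.sum_congr rfl fun j _ => ?_
    rw [star_mul, e_star, ← map_star, comm]

/-- Elements of a tensor product commute as soon as the left and right parts do. -/
theorem tensor_comm {A T : Type} [Ring A] [StarRing A] [Algebra ℂ A] [StarModule ℂ A]
    [Ring T] [StarRing T] [Algebra ℂ T] [StarModule ℂ T] (f g : A →⋆ₐ[ℂ] T) (x y : T)
    (hx : ∀ a, f a * x = x * f a) (hy : ∀ a, g a * y = y * g a) (z : A ⊗[ℂ] A) :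
    StarAlgHom.tensor f g z * (x ⊗ₜ y) = (x ⊗ₜ y) * StarAlgHom.tensor f g z := by
  induction z using TensorProduct.induction_on with
  | zero => simp
  | tmul a b => simp [StarAlgHom.tensor_tmul, hx, hy]
  | add z w hz hw => rw [map_add, add_mul, mul_add, hz, hw]

/-- The map `a ↦ ∑ j, (ν_i ⊗ ν_j)(Δ(a)) (p_{ij} ⊗ 1)`. -/
noncomputable def wreathComulNu (i : Fin n) : P.alg →⋆ₐ[ℂ]
    UnivStar (wreathRel P n) ⊗[ℂ] UnivStar (wreathRel P n) :=
  sumHom (fun j => (StarAlgHom.tensor (wreathNu P n i) (wreathNu P n j)).comp P.comul)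
    (fun j => wreathP P n i j ⊗ₜ 1)
    (fun j => by
      rw [TensorProduct.star_tmul, star_one]
      exact congrArg (· ⊗ₜ[ℂ] (1 : UnivStar (wreathRel P n))) ((wreathP_magic P n).star_eq i j))
    (fun j => by
      rw [Algebra.TensorProduct.tmul_mul_tmul, one_mul]
      exact congrArg (· ⊗ₜ[ℂ] (1 : UnivStar (wreathRel P n))) ((wreathP_magic P n).idem i j))
    (fun j k h => by
      rw [Algebra.TensorProduct.tmul_mul_tmul]
      rw [show wreathP P n i j * wreathP P n i k = 0 from (wreathP_magic P n).row_orth i j k h,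
        TensorProduct.zero_tmul])
    (by
      rw [← TensorProduct.sum_tmul]
      exact congrArg (· ⊗ₜ[ℂ] (1 : UnivStar (wreathRel P n))) ((wreathP_magic P n).row_sum i))
    (fun j k a => tensor_comm _ _ _ _ (wreath_comm P n i k) (by simp) _)

theorem wreathComulNu_apply (i : Fin n) (a : P.alg) : wreathComulNu P n i a =
    ∑ j, StarAlgHom.tensor (wreathNu P n i) (wreathNu P n j) (P.comul a) *
      (wreathP P n i j ⊗ₜ 1) := rfl

theorem wreath_tensorS (i j : Fin n) : StarAlgHom.tensor (wreathS P n) (wreathS P n)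
    ((symm n).comul (symmU n i j)) = ∑ k, wreathP P n i k ⊗ₜ[ℂ] wreathP P n k j := by
  have h : (symm n).comul (symmU n i j) = ∑ k, symmU n i k ⊗ₜ[ℂ] symmU n k j :=
    (symm n).comul_u i j
  rw [h, map_sum]
  rfl

theorem wreathComulNu_mul (i j : Fin n) (a : P.alg) :
    wreathComulNu P n i a * ∑ k, wreathP P n i k ⊗ₜ[ℂ] wreathP P n k j =
      ∑ r, StarAlgHom.tensor (wreathNu P n i) (wreathNu P n r) (P.comul a) *
        (wreathP P n i r ⊗ₜ wreathP P n r j) := by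
  rw [wreathComulNu_apply, Finset.sum_mul]
  refine Finset.sum_congr rfl fun r _ => ?_
  rw [mul_assoc, Finset.mul_sum, Finset.sum_eq_single r]
  · rw [Algebra.TensorProduct.tmul_mul_tmul, one_mul,
      show wreathP P n i r * wreathP P n i r = wreathP P n i r from (wreathP_magic P n).idem i r]
  · intro k _ hk
    rw [Algebra.TensorProduct.tmul_mul_tmul,
      show wreathP P n i r * wreathP P n i k = 0 from (wreathP_magic P n).row_orth i r k hk.symm,
      TensorProduct.zero_tmul]
  · simp

theorem mul_wreathComulNu (i j : Fin n) (a : P.alg) :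
    (∑ k, wreathP P n i k ⊗ₜ[ℂ] wreathP P n k j) * wreathComulNu P n i a =
      ∑ r, StarAlgHom.tensor (wreathNu P n i) (wreathNu P n r) (P.comul a) *
        (wreathP P n i r ⊗ₜ wreathP P n r j) := by
  rw [wreathComulNu_apply, Finset.mul_sum]
  refine Finset.sum_congr rfl fun r _ => ?_
  rw [tensor_comm _ _ _ _ (wreath_comm P n i r) (by simp), ← mul_assoc, Finset.sum_mul,
    Finset.sum_eq_single r]
  · rw [Algebra.TensorProduct.tmul_mul_tmul, mul_one,
      show wreathP P n i r * wreathP P n i r = wreathP P n i r from (wreathP_magic P n).idem i r,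
      tensor_comm _ _ _ _ (wreath_comm P n i r) (wreath_comm P n r j)]
  · intro k _ hk
    rw [Algebra.TensorProduct.tmul_mul_tmul,
      show wreathP P n i k * wreathP P n i r = 0 from (wreathP_magic P n).row_orth i k r hk,
      TensorProduct.zero_tmul]
  · simp

/-- The comultiplication of the wreath product. -/
noncomputable def wreathComul : UnivStar (wreathRel P n) →⋆ₐ[ℂ]
    UnivStar (wreathRel P n) ⊗[ℂ] UnivStar (wreathRel P n) :=
  UnivStar.lift
    (Sum.elim (fun x => wreathComulNu P n x.1 x.2)
      (fun s => StarAlgHom.tensor (wreathS P n) (wreathS P n) ((symm n).comul s))) (by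
    rintro r ((hr | hr) | ⟨i, j, a, rfl⟩)
    · obtain ⟨i, hr⟩ := Set.mem_iUnion.1 hr
      exact eval_homRel _ (fun a : P.alg => var (Sum.inl (i, a) : WreathGen P n))
        (wreathComulNu P n i) (fun a => eval_var _ _) r hr
    · exact eval_homRel _ (fun s : (symm n).alg => var (Sum.inr s : WreathGen P n))
        ((StarAlgHom.tensor (wreathS P n) (wreathS P n)).comp (symm n).comul)
        (fun a => eval_var _ _) r hr
    · rw [map_sub, map_mul, map_mul, eval_var, eval_var, Sum.elim_inl, Sum.elim_inr,
        wreath_tensorS, wreathComulNu_mul, mul_wreathComulNu, sub_self])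

theorem wreathComul_nu (i : Fin n) (a : P.alg) :
    wreathComul P n (wreathNu P n i a) = wreathComulNu P n i a :=
  UnivStar.lift_gen _ _ _

theorem wreathComul_p (i j : Fin n) :
    wreathComul P n (wreathP P n i j) = ∑ k, wreathP P n i k ⊗ₜ[ℂ] wreathP P n k j :=
  (UnivStar.lift_gen _ _ _).trans (wreath_tensorS P n i j)

theorem wreath_u_row_mul (i j j' : Fin n) (a b : P.alg) :
    wreathNu P n i a * wreathP P n i j * (wreathNu P n i b * wreathP P n i j') =
      wreathNu P n i (a * b) * (wreathP P n i j * wreathP P n i j') := by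
  rw [map_mul, mul_assoc, ← mul_assoc (wreathP P n i j), ← wreath_comm]
  simp only [mul_assoc]

/-- The wreath product `P ≀ S_n⁺`, with fundamental representation
`w_{(i,k),(j,l)} = ν_i(u_{kl}) p_{ij}`. -/
noncomputable def wreath [Nonempty P.idx] : QPermGroup where
  idx := Fin n × P.idx
  alg := UnivStar (wreathRel P n)
  u := Matrix.of fun x y => wreathNu P n x.1 (P.u x.2 y.2) * wreathP P n x.1 y.1
  magic := by
    have hp := wreathP_magic P n
    have hu := P.magic
    refine ⟨?_, ?_, ?_, ?_, ?_, ?_⟩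
    · rintro ⟨i, k⟩ ⟨j, l⟩
      simp only [Matrix.of_apply, star_mul, ← map_star, hu.star_eq]
      rw [show star (wreathP P n i j) = wreathP P n i j from hp.star_eq i j, wreath_comm]
    · rintro ⟨i, k⟩ ⟨j, l⟩
      simp only [Matrix.of_apply]
      rw [wreath_u_row_mul, hu.idem,
        show wreathP P n i j * wreathP P n i j = wreathP P n i j from hp.idem i j]
    · rintro ⟨i, k⟩
      simp only [Matrix.of_apply, Fintype.sum_prod_type, ← Finset.sum_mul, ← map_sum, hu.row_sum,
        map_one, one_mul]
      exact hp.row_sum i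
    · rintro ⟨j, l⟩
      simp only [Matrix.of_apply, Fintype.sum_prod_type, ← Finset.sum_mul, ← map_sum, hu.col_sum,
        map_one, one_mul]
      exact hp.col_sum j
    · rintro ⟨i, k⟩ ⟨j, l⟩ ⟨j', l'⟩ h
      simp only [Matrix.of_apply]
      rw [wreath_u_row_mul]
      by_cases hj : j = j'
      · subst hj
        rw [hu.row_orth k l l' fun e => h (e ▸ rfl), map_zero, zero_mul]
      · rw [show wreathP P n i j * wreathP P n i j' = 0 from hp.row_orth i j j' hj, mul_zero]
    · rintro ⟨i, k⟩ ⟨j, l⟩ ⟨i', k'⟩ h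
      simp only [Matrix.of_apply]
      by_cases hi : i = i'
      · subst hi
        rw [wreath_u_row_mul, hu.col_orth k l k' fun e => h (e ▸ rfl), map_zero, zero_mul]
      · rw [wreath_comm P n i', mul_assoc, ← mul_assoc (wreathP P n i j),
          show wreathP P n i j * wreathP P n i' j = 0 from hp.col_orth i j i' hi, zero_mul,
          mul_zero]
  generated := by
    have hp := wreathP_magic P n
    have hu := P.magic
    have hP : ∀ i j, wreathP P n i j ∈ StarAlgebra.adjoin ℂ (Set.range
        fun x : (Fin n × P.idx) × (Fin n × P.idx) => (Matrix.of fun x y : Fin n × P.idx =>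
          wreathNu P n x.1 (P.u x.2 y.2) * wreathP P n x.1 y.1) x.1 x.2) := by
      intro i j
      obtain ⟨k⟩ := ‹Nonempty P.idx›
      have h : wreathP P n i j = ∑ l, wreathNu P n i (P.u k l) * wreathP P n i j := by
        rw [← Finset.sum_mul, ← map_sum, hu.row_sum, map_one, one_mul]
      rw [h]
      exact sum_mem fun l _ => StarAlgebra.subset_adjoin ℂ _ ⟨((i, k), (j, l)), rfl⟩
    apply UnivStar.eq_top_of_gen_mem
    rintro (⟨i, a⟩ | s)
    · refine P.map_mem_of_gen (wreathNu P n i) _ (fun k l => ?_) a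
      have h : wreathNu P n i (P.u k l) = ∑ j, wreathNu P n i (P.u k l) * wreathP P n i j := by
        rw [← Finset.mul_sum, show ∑ j, wreathP P n i j = 1 from hp.row_sum i, mul_one]
      rw [h]
      exact sum_mem fun j _ => StarAlgebra.subset_adjoin ℂ _ ⟨((i, k), (j, l)), rfl⟩
    · exact (symm n).map_mem_of_gen (wreathS P n) _ (fun i j => hP i j) s
  comul := wreathComul P n
  comul_u := by
    rintro ⟨i, k⟩ ⟨j, l⟩
    simp only [Matrix.of_apply]
    rw [map_mul, wreathComul_nu, wreathComul_p, wreathComulNu_mul, Fintype.sum_prod_type]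
    refine Finset.sum_congr rfl fun r _ => ?_
    rw [P.comul_u, map_sum, Finset.sum_mul]
    refine Finset.sum_congr rfl fun t _ => ?_
    rw [StarAlgHom.tensor_tmul, Algebra.TensorProduct.tmul_mul_tmul]

end Wreath

/-- The Jordan closure of a family of quantum permutation groups: the smallest family, closed under
isomorphism, that contains the given one and is stable under free products and under wreath products
with `S_n⁺`. (Wreath products are formed for fundamental representations of nonzero size.) -/
inductive Jor (𝒬 : Set QPermGroup) : QPermGroup → Prop
  | base {P : QPermGroup} (h : P ∈ 𝒬) : Jor 𝒬 P
  | iso {P Q : QPermGroup} (hP : Jor 𝒬 P) (h : Isomorphic P Q) : Jor 𝒬 Q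
  | free {P Q : QPermGroup} (hP : Jor 𝒬 P) (hQ : Jor 𝒬 Q) : Jor 𝒬 (freeProd P Q)
  | wreath {P : QPermGroup} [Nonempty P.idx] (hP : Jor 𝒬 P) (n : ℕ) (hn : 1 ≤ n) :
      Jor 𝒬 (wreath P n)

end QPermGroup

/-! ### Classes of graphs -/

/-- A finite simple graph. -/
structure FinGraph where
  /-- the vertex set -/
  V : Type
  [fintypeV : Fintype V]
  /-- the graph structure -/
  graph : SimpleGraph V

attribute [instance] FinGraph.fintypeV

namespace FinGraph

/-- Isomorphism of graphs. -/
def Iso (G H : FinGraph) : Prop := Nonempty (G.graph ≃g H.graph)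

/-- The sum (disjoint union) of two graphs. -/
def sum (G H : FinGraph) : FinGraph := ⟨G.V ⊕ H.V, G.graph ⊕g H.graph⟩

/-- The complement of a graph. -/
def compl (G : FinGraph) : FinGraph := ⟨G.V, G.graphᶜ⟩

/-- The quantum automorphism group. -/
noncomputable def qu (G : FinGraph) : QPermGroup := QPermGroup.qAut G.graph

/-- A graph has quantum symmetry if the algebra of coefficients of its quantum automorphism group is
not commutative. -/
def HasQuantumSymmetry (G : FinGraph) : Prop := ∃ a b : G.qu.alg, a * b ≠ b * a

/-- Schmidt's criterion: there are two nontrivial automorphisms with disjoint supports. -/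
def SchmidtCriterion (G : FinGraph) : Prop :=
  ∃ f g : G.graph ≃g G.graph, (∃ x, f x ≠ x) ∧ (∃ x, g x ≠ x) ∧
    Disjoint {x | f x ≠ x} {x | g x ≠ x}

/-- Triviality of the automorphism group. -/
def AutTrivial (G : FinGraph) : Prop := Subsingleton (G.graph ≃g G.graph)

/-- Quantum isomorphism: there are a nonzero unital `C*`-algebra `X` and a square magic unitary `P`
with coefficients in `X` such that `P Adj(G) = Adj(H) P`. -/
def QuantumIso (G H : FinGraph) : Prop :=
  Fintype.card G.V = Fintype.card H.V ∧
    ∃ (X : Type) (_ : CStarAlgebra X) (_ : Nontrivial X) (P : Matrix H.V G.V X),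
      IsMagic P ∧ P * adjMat G.graph X = adjMat H.graph X * P

/-- Quantum asymmetry. -/
def QA (F : Set FinGraph) : Prop := ∀ G ∈ F, (G.qu.IsTrivial ↔ G.AutTrivial)

/-- Quantum isomorphism and isomorphism agree. -/
def QI (F : Set FinGraph) : Prop := ∀ G ∈ F, ∀ H ∈ F, (QuantumIso G H ↔ Iso G H)

/-- The Schmidt alternative. -/
def SA (F : Set FinGraph) : Prop := ∀ G ∈ F, (G.HasQuantumSymmetry ↔ G.SchmidtCriterion)

/-- Tractable classes of graphs. -/
def Tractable (F : Set FinGraph) : Prop := QA F ∧ QI F ∧ SA F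

/-- Superrigid classes of graphs. -/
def Superrigid (F : Set FinGraph) : Prop := ∀ G ∈ F, ∀ H : FinGraph, QuantumIso G H → Iso G H

/-- The class of `F`-cographs: the smallest class of graphs (closed under isomorphism) containing
`F` and stable under sums and complements. -/
inductive Co (F : Set FinGraph) : FinGraph → Prop
  | base {G : FinGraph} (h : G ∈ F) : Co F G
  | iso {G H : FinGraph} (hG : Co F G) (h : Iso G H) : Co F H
  | sum {G H : FinGraph} (hG : Co F G) (hH : Co F H) : Co F (sum G H)
  | compl {G : FinGraph} (hG : Co F G) : Co F (compl G)

/-- The class of `F`-cographs, as a set. -/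
def co (F : Set FinGraph) : Set FinGraph := {G | Co F G}

/-- The graphs on at most `n` vertices. -/
def upTo (n : ℕ) : Set FinGraph := {G | Fintype.card G.V ≤ n}

/-- The family (closed under isomorphism) of the quantum automorphism groups of a class. -/
def quFamily (F : Set FinGraph) : Set QPermGroup := {Q | ∃ G ∈ F, QPermGroup.Isomorphic Q G.qu}

end FinGraph

/-- The Jordan closure of a family of quantum permutation groups, as a set. -/
def jordanClosure (𝒬 : Set QPermGroup) : Set QPermGroup := {Q | QPermGroup.Jor 𝒬 Q}

/-! A magic unitary intertwining two adjacency matrices is a matrix of idempotents whose products `P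
x y * P x' y'` vanish unless both pairs are adjacent or both are not. Such matrices can be treated
over any complex algebra, with no involution or norm. The unit `e` to which rows and columns sum is
left arbitrary (`AdjMagic`), because restricting to a pair of blocks replaces `1` by a smaller
idempotent. The only analytic-looking input is counting: if `m • e = n • e` and `e ≠ 0`, then `m =
n`.

The heart is one property, `Rigid`, which bundles three consequences of having a magic matrix out of
`G`: an isomorphism of graphs, at most one nonzero entry in each row for asymmetric `G`, and
commuting entries in the absence of Schmidt's criterion. The three are proved together because the
step from components to their union uses them jointly. Rigidity passes to complements at once, and
from components to the graph by `rigid_of_components`: magic matrices respect reachability, so the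
block units form a matrix between the sets of components, and its nonzero entries join isomorphic
components. Two distinct nonzero entries in a row then produce automorphisms, by moving one
component inside itself or by exchanging two isomorphic ones.

A cograph over graphs on at most five vertices is disconnected, or has a disconnected complement, or
has at most five vertices. In the last case, if it is connected with connected complement, it has at
most one vertex or contains an induced path on four vertices. So it is that path or one of sixteen
one-vertex extensions. Degree data settle these: they determine the graph and force all entries of
the magic matrix to commute. Strong induction gives rigidity of every such cograph, hence
tractability and superrigidity. The remaining implication, from Schmidt's criterion to quantum
symmetry, mixes two disjoint automorphisms by noncommuting projections.

For the Jordan closure, a disconnected graph is split as `m` copies of a component `C` plus a rest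
with no component isomorphic to `C`. Rigidity forbids mixing, so its quantum group is the free
product of `Qu(C) ≀ S_m⁺` with that of the rest. Conversely, complements make graphs connected.
Copies of a connected graph realize wreath products, and sums of connected graphs of different sizes
realize free products, a cone being used to separate equal sizes. -/

noncomputable section

/-! ### Magic matrices with arbitrary unit and their blocks -/

namespace FinGraph

/-- A family `P` of pairwise compatible idempotents, indexed by the vertices of `H` and of `G`, whose
rows and columns are partitions of `e` and which respects adjacency: `P x y * P x' y' = 0` unless
`x, x'` are adjacent exactly when `y, y'` are. -/
structure AdjMagic {A : Type} [Ring A] (G H : FinGraph) (e : A) (P : H.V → G.V → A) : Prop where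
  idem : ∀ x y, P x y * P x y = P x y
  row_sum : ∀ x, ∑ y, P x y = e
  col_sum : ∀ y, ∑ x, P x y = e
  row_orth : ∀ x y y', y ≠ y' → P x y * P x y' = 0
  col_orth : ∀ x x' y, x ≠ x' → P x y * P x' y = 0
  adj : ∀ x x' y y', ¬ (H.graph.Adj x x' ↔ G.graph.Adj y y') → P x y * P x' y' = 0

/-- The induced subgraph on a set of vertices. -/
def ind (G : FinGraph) (S : Set G.V) : FinGraph :=
  letI := Fintype.ofFinite S
  ⟨S, G.graph.induce S⟩

theorem Iso.refl (G : FinGraph) : Iso G G := ⟨SimpleGraph.Iso.refl⟩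

theorem Iso.symm {G H : FinGraph} (h : Iso G H) : Iso H G := h.map SimpleGraph.Iso.symm

theorem Iso.trans {G H K : FinGraph} (h : Iso G H) (h' : Iso H K) : Iso G K :=
  ⟨h.some.trans h'.some⟩

/-- Isomorphism as an equivalence relation. -/
def isoSetoid : Setoid FinGraph := ⟨Iso, Iso.refl, Iso.symm, Iso.trans⟩

theorem compl_adj {G : FinGraph} (y y' : G.V) :
    G.compl.graph.Adj y y' ↔ y ≠ y' ∧ ¬ G.graph.Adj y y' := SimpleGraph.compl_adj _ _ _

namespace AdjMagic

variable {A : Type} [Ring A] {G H : FinGraph} {e : A} {P : H.V → G.V → A}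

theorem transpose (h : AdjMagic G H e P) : AdjMagic H G e (fun y x => P x y) where
  idem y x := h.idem x y
  row_sum := h.col_sum
  col_sum := h.row_sum
  row_orth y x x' := h.col_orth x x' y
  col_orth y y' x := h.row_orth x y y'
  adj y y' x x' hn := h.adj x x' y y' fun h' => hn h'.symm

/-- Complementation changes the adjacency condition only through the requirement of distinctness.
Where exactly one of `x = x'`, `y = y'` holds, orthogonality of rows or columns takes over. -/
theorem compl (h : AdjMagic G H e P) : AdjMagic G.compl H.compl e P where
  idem := h.idem
  row_sum := h.row_sum
  col_sum := h.col_sum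
  row_orth := h.row_orth
  col_orth := h.col_orth
  adj x x' y y' hn := by
    by_cases hx : x = x'
    · subst hx
      by_cases hy : y = y'
      · subst hy
        exact absurd (iff_of_false (SimpleGraph.irrefl _) (SimpleGraph.irrefl _)) hn
      · exact h.row_orth x y y' hy
    · by_cases hy : y = y'
      · subst hy
        exact h.col_orth x x' y hx
      · refine h.adj x x' y y' fun hi => hn ?_
        exact ((compl_adj (G := H) x x').trans (and_congr (iff_of_true hx hy) (not_congr hi))).trans
          (compl_adj (G := G) y y').symm

theorem comp_iso {G' H' : FinGraph} (h : AdjMagic G H e P) (f : G'.graph ≃g G.graph)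
    (g : H'.graph ≃g H.graph) : AdjMagic G' H' e (fun x y => P (g x) (f y)) where
  idem x y := h.idem _ _
  row_sum x := (f.toEquiv.sum_comp fun y => P (g x) y).trans (h.row_sum _)
  col_sum y := (g.toEquiv.sum_comp fun x => P x (f y)).trans (h.col_sum _)
  row_orth x y y' hy := h.row_orth _ _ _ fun h' => hy (f.injective h')
  col_orth x x' y hx := h.col_orth _ _ _ fun h' => hx (g.injective h')
  adj x x' y y' hn := h.adj _ _ _ _ (by rwa [f.map_adj_iff, g.map_adj_iff])

theorem unit_mul (h : AdjMagic G H e P) (x : H.V) (y : G.V) : e * P x y = P x y := by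
  rw [← h.row_sum x, Finset.sum_mul, Finset.sum_eq_single y, h.idem]
  · intro z _ hz
    exact h.row_orth x z y hz
  · simp

theorem mul_unit (h : AdjMagic G H e P) (x : H.V) (y : G.V) : P x y * e = P x y := by
  rw [← h.row_sum x, Finset.mul_sum, Finset.sum_eq_single y, h.idem]
  · intro z _ hz
    exact h.row_orth x y z hz.symm
  · simp

theorem eq_mul_row (h : AdjMagic G H e P) (x x' : H.V) (y : G.V) :
    P x y = ∑ y', P x y * P x' y' := by
  rw [← Finset.mul_sum, h.row_sum, h.mul_unit]

theorem eq_row_mul (h : AdjMagic G H e P) (x x' : H.V) (y : G.V) :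
    P x' y = ∑ y', P x y' * P x' y := by
  rw [← Finset.sum_mul, h.row_sum, h.unit_mul]

theorem eq_mul_col (h : AdjMagic G H e P) (x : H.V) (y y' : G.V) :
    P x y = ∑ x', P x y * P x' y' := by
  rw [← Finset.mul_sum, h.col_sum, h.mul_unit]

theorem mul_row_mul (h : AdjMagic G H e P) (x x' z : H.V) (y y' : G.V) :
    ∑ w, P x y * P z w * P x' y' = P x y * P x' y' := by
  rw [← Finset.sum_mul, ← Finset.mul_sum, h.row_sum, h.mul_unit]

/-- Induction along a walk from `x` to `x'`. Inserting the row of the next vertex between the two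
factors leaves only columns adjacent to `y`, from which `y'` is still unreachable; at the end of the
walk row orthogonality applies. -/
theorem mul_eq_zero_of_reachable (h : AdjMagic G H e P) {x x' : H.V} {y y' : G.V}
    (hx : H.graph.Reachable x x') (hy : ¬ G.graph.Reachable y y') : P x y * P x' y' = 0 := by
  obtain ⟨w⟩ := hx
  induction w generalizing y with
  | nil => exact h.row_orth _ _ _ fun h' => hy (h' ▸ SimpleGraph.Reachable.refl _)
  | @cons a b c hab p ih =>
    rw [← h.mul_row_mul a c b y y']
    refine Finset.sum_eq_zero fun z _ => ?_
    by_cases hyz : G.graph.Adj y z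
    · rw [mul_assoc, ih fun hz => hy (hyz.reachable.trans hz), mul_zero]
    · rw [h.adj a b y z (by tauto), zero_mul]

theorem mul_eq_zero_of_not_reachable_iff (h : AdjMagic G H e P) {x x' : H.V} {y y' : G.V}
    (hn : ¬ (H.graph.Reachable x x' ↔ G.graph.Reachable y y')) : P x y * P x' y' = 0 := by
  by_cases hx : H.graph.Reachable x x'
  · exact h.mul_eq_zero_of_reachable hx (by tauto)
  · exact h.transpose.mul_eq_zero_of_reachable (by tauto) hx

theorem unit_mul_unit (h : AdjMagic G H e P) (x : H.V) : e * e = e := by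
  nth_rw 2 [← h.row_sum x]
  rw [Finset.mul_sum]
  simp only [h.unit_mul, h.row_sum]

/-- Expanding both factors of `e = e * e` along the rows of two mutually unreachable vertices would
make every term vanish. -/
theorem preconnected (h : AdjMagic G H e P) (he : e ≠ 0) (hG : G.graph.Preconnected) :
    H.graph.Preconnected := by
  intro x x'
  by_contra hx
  apply he
  rw [← h.unit_mul_unit x]
  nth_rw 1 [← h.row_sum x]
  rw [← h.row_sum x', Finset.sum_mul_sum]
  refine Finset.sum_eq_zero fun y _ => Finset.sum_eq_zero fun y' _ => ?_
  exact h.mul_eq_zero_of_not_reachable_iff fun hi => hx (hi.2 (hG y y'))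

open Classical in
/-- Vertex functions matched by `P` have matched sums over neighbours. -/
theorem sum_neighbors_eq [Algebra ℂ A] (h : AdjMagic G H e P) (f : G.V → ℕ) (g : H.V → ℕ)
    (hfg : ∀ x y, P x y ≠ 0 → g x = f y) (x : H.V) (y : G.V) (hxy : P x y ≠ 0) :
    (∑ x', if H.graph.Adj x x' then g x' else 0) =
      ∑ y', if G.graph.Adj y y' then f y' else 0 := by
  have hfg' : ∀ x y, (g x : ℂ) • P x y = (f y : ℂ) • P x y := fun x y => by
    by_cases h0 : P x y = 0
    · simp [h0]
    · rw [hfg x y h0]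
  have h1 : ∀ x' y', (if H.graph.Adj x x' then (g x' : ℂ) else 0) • (P x y * P x' y') =
      (if G.graph.Adj y y' then (f y' : ℂ) else 0) • (P x y * P x' y') := fun x' y' => by
    by_cases hi : H.graph.Adj x x' ↔ G.graph.Adj y y'
    · simp only [hi]
      split_ifs
      · rw [← mul_smul_comm, hfg', mul_smul_comm]
      · rfl
    · rw [h.adj x x' y y' hi, smul_zero, smul_zero]
  -- Splitting `P x y` along the rows `x'` on one side and along the columns `y'` on the other turns
  -- both sides into the same double sum, by `h1`. A nonzero vector over `ℂ` then allows the scalars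
  -- to be compared.
  have h2 : (∑ x', if H.graph.Adj x x' then (g x' : ℂ) else 0) • P x y =
      (∑ y', if G.graph.Adj y y' then (f y' : ℂ) else 0) • P x y := by
    rw [Finset.sum_smul, Finset.sum_smul]
    calc _ = ∑ x', ∑ y', (if H.graph.Adj x x' then (g x' : ℂ) else 0) • (P x y * P x' y') := by
          refine Finset.sum_congr rfl fun x' _ => ?_
          rw [← Finset.smul_sum, ← Finset.mul_sum, h.row_sum, h.mul_unit]
      _ = ∑ y', ∑ x', (if G.graph.Adj y y' then (f y' : ℂ) else 0) • (P x y * P x' y') := by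
          rw [Finset.sum_comm]
          simp only [h1]
      _ = _ := by
          refine Finset.sum_congr rfl fun y' _ => ?_
          rw [← Finset.smul_sum, ← Finset.mul_sum, h.col_sum, h.mul_unit]
  rw [← sub_eq_zero, ← sub_smul, smul_eq_zero, or_iff_left hxy, sub_eq_zero] at h2
  exact_mod_cast h2

end AdjMagic

open Classical in
/-- A matrix with constant row and column sums `e ≠ 0` whose support respects two labellings has as
many rows as columns with any given label. -/
theorem card_filter_eq_of_sums {A ι κ K : Type*} [Ring A] [Algebra ℂ A] [Fintype ι] [Fintype κ]
    {e : A} (he : e ≠ 0) (Q : κ → ι → A) (row : ∀ k, ∑ j, Q k j = e) (col : ∀ j, ∑ k, Q k j = e)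
    (f : ι → K) (g : κ → K) (hfg : ∀ k j, Q k j ≠ 0 → g k = f j) (v : K) :
    (Finset.univ.filter fun k => g k = v).card = (Finset.univ.filter fun j => f j = v).card := by
  -- The rows labelled `v` and the columns labelled `v` carry the same nonzero entries. Adding these
  -- entries by rows and by columns gives two integer multiples of `e`.
  have h1 : ∑ k, ∑ j, (if g k = v then Q k j else 0) = ∑ k, ∑ j, if f j = v then Q k j else 0 := by
    refine Finset.sum_congr rfl fun k _ => Finset.sum_congr rfl fun j _ => ?_
    by_cases h0 : Q k j = 0
    · simp [h0]
    · rw [hfg k j h0]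
  have h2 : ∑ k, ∑ j, (if g k = v then Q k j else 0) =
      ((Finset.univ.filter fun k => g k = v).card : ℂ) • e := by
    calc _ = ∑ k, if g k = v then e else 0 := Finset.sum_congr rfl fun k _ => by
          split_ifs
          · exact row k
          · simp
      _ = _ := by
          rw [← Finset.sum_filter, Finset.sum_const, Nat.cast_smul_eq_nsmul]
  have h3 : ∑ k, ∑ j, (if f j = v then Q k j else 0) =
      ((Finset.univ.filter fun j => f j = v).card : ℂ) • e := by
    rw [Finset.sum_comm]
    calc _ = ∑ j, if f j = v then e else 0 := Finset.sum_congr rfl fun j _ => by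
          split_ifs
          · exact col j
          · simp
      _ = _ := by
          rw [← Finset.sum_filter, Finset.sum_const, Nat.cast_smul_eq_nsmul]
  rw [h2, h3, ← sub_eq_zero, ← sub_smul, smul_eq_zero, or_iff_left he, sub_eq_zero] at h1
  exact_mod_cast h1

namespace AdjMagic

variable {A : Type} [Ring A] {G H : FinGraph} {e : A} {P : H.V → G.V → A}

theorem card_eq [Algebra ℂ A] (h : AdjMagic G H e P) (he : e ≠ 0) :
    Fintype.card H.V = Fintype.card G.V := by
  have := card_filter_eq_of_sums he P h.row_sum h.col_sum (fun _ => ()) (fun _ => ())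
    (fun _ _ _ => rfl) ()
  simpa using this

/-- If for all `j ≠ p` at most one `s` satisfies `P i j * P k s * P i p ≠ 0`, then the entries
of `P` commute. -/
theorem commute_of_unique (h : AdjMagic G H e P)
    (hu : ∀ i k j p, j ≠ p → ∀ s s', s ≠ s' →
      P i j * P k s * P i p = 0 ∨ P i j * P k s' * P i p = 0) (i k : H.V) (j l : G.V) :
    P i j * P k l = P k l * P i j := by
  have key : ∀ j p, j ≠ p → P i j * P k l * P i p = 0 := fun j p hjp => by
    by_contra hl
    -- The middle factors sum to the unit, leaving `P i j * P i p = 0`. When at most one term of the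
    -- sum can be nonzero, none is.
    have h0 : ∑ s, P i j * P k s * P i p = 0 := by
      rw [h.mul_row_mul, h.row_orth i j p hjp]
    rw [Finset.sum_eq_single l _ (by simp)] at h0
    · exact hl h0
    · intro s _ hs
      exact (hu i k j p hjp s l hs).resolve_right hl
  have h1 : P i j * P k l = P i j * P k l * P i j := by
    calc _ = ∑ p, P i j * P k l * P i p := by
          rw [← Finset.mul_sum, h.row_sum, mul_assoc, h.mul_unit]
      _ = _ := Finset.sum_eq_single j (fun p _ hp => key j p hp.symm) (by simp)
  have h2 : P k l * P i j = P i j * P k l * P i j := by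
    calc _ = ∑ p, P i p * P k l * P i j := by
          simp only [mul_assoc]
          rw [← Finset.sum_mul, h.row_sum, ← mul_assoc, h.unit_mul]
      _ = _ := Finset.sum_eq_single j (fun p _ hp => key p j hp) (by simp)
  rw [h1, h2]

section Blocks

variable {ι κ : Type} {c : G.V → ι} {d : H.V → κ}

open Classical in
/-- The sum of the entries of the row of `x` over the columns in the block `j`. -/
def blockUnit (P : H.V → G.V → A) (c : G.V → ι) (x : H.V) (j : ι) : A :=
  ∑ y, if c y = j then P x y else 0

/-- Rows of the same block have the same partial sums: both equal the double sum of products `P x y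
* P x' y'` over the columns of block `j`, since `hb` kills the products that leave the block. -/
theorem blockUnit_eq (h : AdjMagic G H e P)
    (hb : ∀ x x' y y', ¬ (d x = d x' ↔ c y = c y') → P x y * P x' y' = 0)
    {x x' : H.V} (hx : d x = d x') (j : ι) : blockUnit P c x j = blockUnit P c x' j := by
  classical
  have key : ∀ x x', d x = d x' → blockUnit P c x j =
      ∑ y, ∑ y', if c y = j then if c y' = j then P x y * P x' y' else 0 else 0 := by
    intro x x' hx
    refine Finset.sum_congr rfl fun y _ => ?_
    split_ifs with hy
    · refine (h.eq_mul_row x x' y).trans ?_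
      refine Finset.sum_congr rfl fun y' _ => ?_
      split_ifs with hy'
      · rfl
      · exact hb _ _ _ _ fun hi => hy' ((hi.1 hx).symm.trans hy)
    · simp
  have key' : blockUnit P c x' j =
      ∑ y, ∑ y', if c y = j then if c y' = j then P x y * P x' y' else 0 else 0 := by
    rw [Finset.sum_comm]
    refine Finset.sum_congr rfl fun y' _ => ?_
    split_ifs with hy'
    · refine (h.eq_row_mul x x' y').trans ?_
      refine Finset.sum_congr rfl fun y _ => ?_
      split_ifs with hy
      · rfl
      · exact hb _ _ _ _ fun hi => hy ((hi.1 hx).trans hy')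
    · simp
  rw [key x x' hx, key']

-- Row sums and column sums over a pair of matched blocks agree. This is what gives the restriction
-- to the blocks a single unit for rows and for columns.
open Classical in
theorem blockUnit_eq_sum_col (h : AdjMagic G H e P)
    (hb : ∀ x x' y y', ¬ (d x = d x' ↔ c y = c y') → P x y * P x' y' = 0)
    (x : H.V) (y : G.V) :
    blockUnit P c x (c y) = ∑ x', if d x' = d x then P x' y else 0 := by
  have h1 : blockUnit P c x (c y) =
      ∑ y', ∑ x', if c y' = c y then if d x' = d x then P x y' * P x' y else 0 else 0 := by
    refine Finset.sum_congr rfl fun y' _ => ?_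
    split_ifs with hy
    · refine (h.eq_mul_col x y' y).trans ?_
      refine Finset.sum_congr rfl fun x' _ => ?_
      split_ifs with hx
      · rfl
      · exact hb _ _ _ _ fun hi => hx (hi.2 hy).symm
    · simp
  rw [h1, Finset.sum_comm]
  refine Finset.sum_congr rfl fun x' _ => ?_
  split_ifs with hx
  · refine Eq.trans ?_ (h.eq_row_mul x x' y).symm
    refine Finset.sum_congr rfl fun y' _ => ?_
    split_ifs with hy
    · rfl
    · exact (hb _ _ _ _ fun hi => hy (hi.1 hx.symm)).symm
  · simp

theorem mul_blockUnit (h : AdjMagic G H e P) (x : H.V) (y : G.V) :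
    P x y * blockUnit P c x (c y) = P x y := by
  classical
  rw [blockUnit, Finset.mul_sum, Finset.sum_eq_single y]
  · simp [h.idem]
  · intro z _ hz
    split_ifs
    · exact h.row_orth x y z hz.symm
    · simp
  · simp

/-- One nonzero entry suffices to make the unit of its block nonzero, which is the condition for
reading off an isomorphism of blocks. -/
theorem blockUnit_ne_zero (h : AdjMagic G H e P) {x : H.V} {y : G.V} (hxy : P x y ≠ 0) :
    blockUnit P c x (c y) ≠ 0 := fun h0 => hxy (by
  rw [← h.mul_blockUnit (c := c) x y, h0, mul_zero])

/-- The restriction to a pair of blocks. -/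
theorem block (h : AdjMagic G H e P)
    (hb : ∀ x x' y y', ¬ (d x = d x' ↔ c y = c y') → P x y * P x' y' = 0)
    (x₀ : H.V) (y₀ : G.V) :
    AdjMagic (G.ind {y | c y = c y₀}) (H.ind {x | d x = d x₀}) (blockUnit P c x₀ (c y₀))
      (fun x y => P x.1 y.1) where
  idem x y := h.idem _ _
  row_sum x := by
    classical
    rw [h.blockUnit_eq hb (x := x₀) (x' := x.1) x.2.symm, blockUnit, ← Finset.sum_filter]
    exact (Finset.sum_subtype _ (by simp) _).symm
  col_sum y := by
    classical
    have hy : c y.1 = c y₀ := y.2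
    have h1 := h.blockUnit_eq_sum_col hb x₀ y.1
    rw [hy, ← Finset.sum_filter] at h1
    exact (h1.trans (Finset.sum_subtype _ (by simp) fun x => P x y.1)).symm
  row_orth x y y' hy := h.row_orth _ _ _ fun h' => hy (Subtype.ext h')
  col_orth x x' y hx := h.col_orth _ _ _ fun h' => hx (Subtype.ext h')
  adj x x' y y' hn := h.adj _ _ _ _ hn

theorem sum_blockUnit [Fintype ι] (h : AdjMagic G H e P) (x : H.V) :
    ∑ j, blockUnit P c x j = e := by
  classical
  simp only [blockUnit]
  rw [Finset.sum_comm]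
  simp [h.row_sum]

end Blocks

end AdjMagic

/-- Two graphs whose blocks can be matched are isomorphic. -/
theorem Iso.glue {G H : FinGraph} {ι κ : Type} (c : G.V → ι) (d : H.V → κ)
    (hc : ∀ y y', G.graph.Adj y y' → c y = c y') (hd : ∀ x x', H.graph.Adj x x' → d x = d x')
    (σ : κ ≃ ι) (φ : ∀ k, Iso (H.ind {x | d x = k}) (G.ind {y | c y = σ k})) : Iso H G := by
  let φ := fun k => (φ k).some
  let f : H.V ≃ G.V := (Equiv.sigmaFiberEquiv d).symm.trans
    ((Equiv.sigmaCongr (β₁ := fun k => {x // d x = k}) (β₂ := fun j => {y // c y = j})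
      σ fun k => (φ k).toEquiv).trans (Equiv.sigmaFiberEquiv c))
  have hf : ∀ x k (hx : d x = k), f x = (φ k ⟨x, hx⟩ : {y // c y = σ k}).1 := by
    rintro x k rfl
    rfl
  have hcf : ∀ x, c (f x) = σ (d x) := fun x => by
    rw [hf x _ rfl]
    exact (φ (d x) ⟨x, rfl⟩).2
  refine ⟨f, fun {x x'} => ?_⟩
  by_cases hx : d x = d x'
  · rw [hf x _ hx, hf x' _ rfl]
    exact (φ (d x')).map_adj_iff
  · refine iff_of_false (fun h => hx ?_) fun h => hx (hd _ _ h)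
    have := hc _ _ h
    rwa [hcf, hcf, σ.apply_eq_iff_eq] at this

/-- An automorphism of a block extends by the identity. -/
theorem exists_extend {G : FinGraph} {ι : Type} (c : G.V → ι)
    (hc : ∀ y y', G.graph.Adj y y' → c y = c y') (j : ι)
    (f : (G.ind {y | c y = j}).graph ≃g (G.ind {y | c y = j}).graph) :
    ∃ F : G.graph ≃g G.graph, (∀ y, F y ≠ y → c y = j) ∧
      ∀ y : {y // c y = j}, F y.1 = (f y : {y // c y = j}).1 := by
  classical
  let F : Equiv.Perm G.V := Equiv.Perm.ofSubtype (p := fun y => c y = j) f.toEquiv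
  have h1 : ∀ y (h : c y = j), F y = (f ⟨y, h⟩ : {y // c y = j}).1 := fun y h =>
    Equiv.Perm.ofSubtype_apply_of_mem (p := fun y => c y = j) f.toEquiv h
  have h2 : ∀ y, c y ≠ j → F y = y := fun y h => 
    Equiv.Perm.ofSubtype_apply_of_not_mem (p := fun y => c y = j) f.toEquiv h
  have h3 : ∀ y, c (F y) = c y := fun y => by
    by_cases h : c y = j
    · rw [h1 y h, h]
      exact (f ⟨y, h⟩).2
    · rw [h2 y h]
  refine ⟨⟨F, fun {y y'} => ?_⟩, fun y hy => by_contra fun h => hy (h2 y h), fun y => h1 y.1 y.2⟩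
  by_cases h : c y = c y'
  · by_cases hj : c y = j
    · rw [h1 y hj, h1 y' (h ▸ hj)]
      exact f.map_adj_iff
    · rw [h2 y hj, h2 y' (h ▸ hj)]
  · exact iff_of_false (fun ha => h (by rw [← h3 y, ← h3 y', hc _ _ ha])) fun ha => h (hc _ _ ha)

/-- Isomorphic blocks can be exchanged. -/
theorem exists_swap {G : FinGraph} {ι : Type} (c : G.V → ι)
    (hc : ∀ y y', G.graph.Adj y y' → c y = c y') {j k : ι} (hjk : j ≠ k)
    (f : Iso (G.ind {y | c y = j}) (G.ind {y | c y = k})) :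
    ∃ F : G.graph ≃g G.graph, (∀ y, F y ≠ y → c y = j ∨ c y = k) ∧ ∀ y, c y = j → F y ≠ y := by
  classical
  obtain ⟨f⟩ := f
  let F : G.V → G.V := fun y => if h : c y = j then (f ⟨y, h⟩ : {y // c y = k}).1
    else if h : c y = k then (f.symm ⟨y, h⟩ : {y // c y = j}).1 else y
  have h1 : ∀ y (h : c y = j), F y = (f ⟨y, h⟩ : {y // c y = k}).1 := fun y h => dif_pos h
  have h2 : ∀ y (h : c y = k), F y = (f.symm ⟨y, h⟩ : {y // c y = j}).1 := fun y h => by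
    have : c y ≠ j := fun h' => hjk (h'.symm.trans h)
    simp only [F]
    rw [dif_neg this, dif_pos h]
  have h3 : ∀ y, c y ≠ j → c y ≠ k → F y = y := fun y h h' => by
    simp only [F]
    rw [dif_neg h, dif_neg h']
  have c1 : ∀ y, c y = j → c (F y) = k := fun y h => by
    rw [h1 y h]
    exact (f ⟨y, h⟩).2
  have c2 : ∀ y, c y = k → c (F y) = j := fun y h => by
    rw [h2 y h]
    exact (f.symm ⟨y, h⟩).2
  have hinv : Function.Involutive F := by
    intro y
    by_cases hj : c y = j
    · rw [h2 _ (c1 y hj)]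
      have : (⟨F y, c1 y hj⟩ : {y // c y = k}) = f ⟨y, hj⟩ := Subtype.ext (h1 y hj)
      exact congrArg Subtype.val ((congrArg f.symm this).trans (f.symm_apply_apply _))
    · by_cases hk : c y = k
      · rw [h1 _ (c2 y hk)]
        have : (⟨F y, c2 y hk⟩ : {y // c y = j}) = f.symm ⟨y, hk⟩ := Subtype.ext (h2 y hk)
        exact congrArg Subtype.val ((congrArg f this).trans (f.apply_symm_apply _))
      · rw [h3 y hj hk, h3 y hj hk]
  have hadj : ∀ y y', G.graph.Adj y y' → G.graph.Adj (F y) (F y') := by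
    intro y y' ha
    have hcc := hc _ _ ha
    by_cases hj : c y = j
    · rw [h1 y hj, h1 y' (hcc ▸ hj)]
      exact f.map_adj_iff.2 ha
    · by_cases hk : c y = k
      · rw [h2 y hk, h2 y' (hcc ▸ hk)]
        exact f.symm.map_adj_iff.2 ha
      · rwa [h3 y hj hk, h3 y' (hcc ▸ hj) (hcc ▸ hk)]
  refine ⟨⟨hinv.toPerm F, fun {y y'} => ⟨fun ha => ?_, hadj y y'⟩⟩, fun y hy => ?_, fun y hy h => ?_⟩
  · have := hadj _ _ ha
    rwa [Function.Involutive.coe_toPerm, hinv, hinv] at this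
  · by_contra hn
    exact hy (h3 y (fun h => hn (Or.inl h)) fun h => hn (Or.inr h))
  · exact hjk (by rw [← hy, ← c1 y hy]; exact (congrArg c h).symm)

end FinGraph

/-! ### Induced paths on four vertices -/

/-- The graph contains an induced path on four vertices. -/
def HasInducedP4 {V : Type} (G : SimpleGraph V) : Prop :=
  ∃ a b c d, G.Adj a b ∧ G.Adj b c ∧ G.Adj c d ∧ ¬ G.Adj a c ∧ ¬ G.Adj a d ∧ ¬ G.Adj b d

/-- The path is self-complementary: `a, b, c, d` in the complement becomes `b, d, a, c`. -/
theorem HasInducedP4.of_compl {V : Type} {G : SimpleGraph V} (h : HasInducedP4 Gᶜ) :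
    HasInducedP4 G := by
  obtain ⟨a, b, c, d, hab, hbc, hcd, hac, had, hbd⟩ := h
  have h1 : a ≠ c := fun h => had (h ▸ hcd)
  have h2 : a ≠ d := fun h => hbd (h ▸ hab.symm)
  have h3 : b ≠ d := fun h => had (h ▸ hab)
  simp only [SimpleGraph.compl_adj, not_and, not_not] at hab hbc hcd hac had hbd
  exact ⟨b, d, a, c, hbd h3, (had h2).symm, hac h1, fun h => hab.2 h.symm, hbc.2,
    fun h => hcd.2 h.symm⟩

theorem HasInducedP4.of_induce {V : Type} {G : SimpleGraph V} {S : Set V}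
    (h : HasInducedP4 (G.induce S)) : HasInducedP4 G := by
  obtain ⟨a, b, c, d, h⟩ := h
  exact ⟨a, b, c, d, h⟩

theorem exists_adj_of_reachable_ne {V : Type} {G : SimpleGraph V} {v w : V}
    (h : G.Reachable v w) (hne : v ≠ w) : ∃ u, G.Adj v u := by
  obtain ⟨p⟩ := h
  cases p with
  | nil => exact absurd rfl hne
  | cons h _ => exact ⟨_, h⟩

theorem exists_adj_of_reachable_induce {V : Type} {G : SimpleGraph V} {v : V} (z : V)
    (hz : z ≠ v) (h : G.Reachable z v) : ∃ u : {x | x ≠ v},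
      (G.induce {x | x ≠ v}).Reachable ⟨z, hz⟩ u ∧ G.Adj u v := by
  obtain ⟨p⟩ := h
  induction p with
  | nil => exact absurd rfl hz
  | @cons a b c hab p ih =>
    by_cases hb : b = c
    · subst hb
      exact ⟨⟨a, hz⟩, SimpleGraph.Reachable.refl _, hab⟩
    · obtain ⟨u, hu, hu'⟩ := ih hb
      refine ⟨u, SimpleGraph.Reachable.trans (SimpleGraph.Adj.reachable ?_) hu, hu'⟩
      exact hab

theorem exists_boundary_of_reachable {V : Type} {G : SimpleGraph V} (p : V → Prop) {a b : V}
    (h : G.Reachable a b) (ha : ¬ p a) (hb : p b) :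
    ∃ x y, G.Reachable a x ∧ G.Adj x y ∧ ¬ p x ∧ p y := by
  obtain ⟨w⟩ := h
  induction w with
  | nil => exact absurd hb ha
  | @cons a b c hab w ih =>
    by_cases hpb : p b
    · exact ⟨a, b, SimpleGraph.Reachable.refl _, hab, ha, hpb⟩
    · obtain ⟨x, y, h1, h2⟩ := ih hpb hb
      exact ⟨x, y, hab.reachable.trans h1, h2⟩

/-- Here `v` is a cut vertex with a non-neighbour `w`. Walking from `w` towards `v` inside its
component of `G - v`, one meets an edge `y z` with `z` adjacent to `v` and `y` not. With a neighbour
`x` of `v` in another component, `y, z, v, x` is an induced path. -/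
theorem hasInducedP4_of_not_preconnected_induce {V : Type} {G : SimpleGraph V} {v : V}
    (hG : G.Preconnected) (hG' : Gᶜ.Preconnected)
    (h : ¬ (G.induce {x | x ≠ v}).Preconnected) : HasInducedP4 G := by
  have h0 : ∃ a b, ¬ (G.induce {x | x ≠ v}).Reachable a b := by
    by_contra hn
    push Not at hn
    exact h hn
  obtain ⟨a, b, hab⟩ := h0
  obtain ⟨w, hw⟩ : ∃ w, Gᶜ.Adj v w := by
    exact exists_adj_of_reachable_ne (hG' v a) a.2.symm
  have hwv : w ≠ v := hw.1.symm
  have hw' : ¬ G.Adj w v := fun h => ((SimpleGraph.compl_adj _ _ _).1 hw).2 h.symm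
  obtain ⟨b, hb⟩ : ∃ b, ¬ (G.induce {x | x ≠ v}).Reachable ⟨w, hwv⟩ b := by
    by_contra hn
    push Not at hn
    exact hab ((hn a).symm.trans (hn b))
  obtain ⟨x, hx, hxv⟩ := exists_adj_of_reachable_induce b.1 b.2 (hG b v)
  obtain ⟨u, hu, huv⟩ := exists_adj_of_reachable_induce w hwv (hG w v)
  obtain ⟨y, z, hy, hyz, hyv, hzv⟩ :=
    exists_boundary_of_reachable (fun y : {x | x ≠ v} => G.Adj y v) hu hw' huv
  have hyx : ∀ t, (G.induce {x | x ≠ v}).Reachable ⟨w, hwv⟩ t → ¬ G.Adj t x := fun t ht ha => by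
    have : (G.induce {x | x ≠ v}).Adj t x := ha
    exact hb (ht.trans (this.reachable.trans hx.symm))
  exact ⟨y, z, v, x, hyz, hzv, hxv.symm, hyv, hyx y hy, hyx z (hy.trans hyz.reachable)⟩

/-- A connected graph with connected complement and at least two vertices contains an induced path
on four vertices. -/
theorem hasInducedP4_of_preconnected (n : ℕ) : ∀ (V : Type) [Fintype V] (G : SimpleGraph V),
    Fintype.card V = n → 2 ≤ n → G.Preconnected → Gᶜ.Preconnected → HasInducedP4 G := by
  classical
  induction n with
  | zero => intros; omega
  | succ n ih =>
    intro V _ G hV hn hG hG'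
    obtain ⟨v, w, hvw⟩ := Fintype.exists_pair_of_one_lt_card (α := V) (by omega)
    by_cases h1 : (G.induce {x | x ≠ v}).Preconnected
    · have hc : (G.induce {x | x ≠ v})ᶜ = Gᶜ.induce {x | x ≠ v} := by
        ext a b
        simp [SimpleGraph.compl_adj, Subtype.ext_iff]
      by_cases h2 : (G.induce {x | x ≠ v})ᶜ.Preconnected
      · have hcard : Fintype.card {x | x ≠ v} = n := by
          have := Fintype.card_subtype_compl (fun x => x = v)
          simp only [Fintype.card_subtype_eq] at this
          exact this.trans (by omega)
        by_cases hn2 : 2 ≤ n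
        · exact (ih _ _ hcard hn2 h1 h2).of_induce
        -- Only `v` and `w` exist here, and connectedness of `G` and of its complement would make `v
        -- w` an edge of both.
        · exfalso
          have hall : ∀ x, x ≠ v → x = w := fun x hx => by
            have : Fintype.card {x | x ≠ v} ≤ 1 := by omega
            have := Fintype.card_le_one_iff.1 this ⟨x, hx⟩ ⟨w, hvw.symm⟩
            exact congrArg Subtype.val this
          have key : ∀ K : SimpleGraph V, K.Preconnected → K.Adj v w := fun K hK => by
            obtain ⟨b, hb⟩ := exists_adj_of_reachable_ne (hK v w) hvw
            exact hall b hb.ne' ▸ hb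
          exact ((SimpleGraph.compl_adj _ _ _).1 (key _ hG')).2 (key _ hG)
      · rw [hc] at h2
        exact (hasInducedP4_of_not_preconnected_induce hG' (by rwa [compl_compl]) h2).of_compl
    · exact hasInducedP4_of_not_preconnected_induce hG hG' h1

/-! ### Graphs on at most five vertices that are connected and co-connected -/

namespace FinGraph

/-- The matrix of the graph on five vertices consisting of the induced path `0, 1, 2, 3` and a vertex
`4` with prescribed neighbours. -/
def extMatrix (a b c d : Bool) : Fin 5 → Fin 5 → Bool :=
  ![![false, true, false, false, a], ![true, false, true, false, b],
    ![false, true, false, true, c], ![false, false, true, false, d], ![a, b, c, d, false]]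

/-- The graph on five vertices with matrix `extMatrix a b c d`. -/
def extP4 (a b c d : Bool) : FinGraph where
  V := Fin 5
  graph :=
    { Adj := fun x y => extMatrix a b c d x y = true
      symm := ⟨by revert a b c d; decide⟩
      loopless := ⟨by revert a b c d; decide⟩ }

/-- The matrix of the path on four vertices. -/
def matP4 : Fin 4 → Fin 4 → Bool :=
  ![![false, true, false, false], ![true, false, true, false],
    ![false, true, false, true], ![false, false, true, false]]

/-- The path on four vertices. -/
def pathP4 : FinGraph where
  V := Fin 4
  graph :=
    { Adj := fun x y => matP4 x y = true
      symm := ⟨by decide⟩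
      loopless := ⟨by decide⟩ }

/-- The connected graphs on at most five vertices with connected complement. -/
theorem exists_iso_of_preconnected (G : FinGraph) (h5 : Fintype.card G.V ≤ 5)
    (hG : G.graph.Preconnected) (hG' : G.compl.graph.Preconnected) :
    Fintype.card G.V ≤ 1 ∨ Iso pathP4 G ∨ ∃ a b c d, Iso (extP4 a b c d) G := by
  classical
  by_cases h1 : Fintype.card G.V ≤ 1
  · exact Or.inl h1
  -- The induced path uses four of at most five vertices. The graph is determined by the adjacencies
  -- of the remaining vertex, if there is one.
  obtain ⟨a, b, c, d, hab, hbc, hcd, hac, had, hbd⟩ :=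
    hasInducedP4_of_preconnected _ G.V G.graph rfl (by omega) hG hG'
  have n1 : a ≠ b := hab.ne
  have n2 : b ≠ c := hbc.ne
  have n3 : c ≠ d := hcd.ne
  have n4 : a ≠ c := fun h => had (h ▸ hcd)
  have n5 : a ≠ d := fun h => hbd (h ▸ hab.symm)
  have n6 : b ≠ d := fun h => had (h ▸ hab)
  by_cases hs : ∃ v, v ≠ a ∧ v ≠ b ∧ v ≠ c ∧ v ≠ d
  · obtain ⟨v, v1, v2, v3, v4⟩ := hs
    refine Or.inr (Or.inr ⟨decide (G.graph.Adj a v), decide (G.graph.Adj b v),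
      decide (G.graph.Adj c v), decide (G.graph.Adj d v), ?_⟩)
    let f : Fin 5 → G.V := ![a, b, c, d, v]
    have hf : Function.Injective f := by
      intro x y hxy
      fin_cases x <;> fin_cases y <;> simp_all [f, eq_comm]
    have hb : Function.Bijective f := by
      rw [Fintype.bijective_iff_injective_and_card]
      refine ⟨hf, le_antisymm ?_ ?_⟩
      · exact Fintype.card_le_of_injective f hf
      · simpa using h5
    refine ⟨⟨Equiv.ofBijective f hb, fun {x y} => ?_⟩⟩
    change G.graph.Adj (f x) (f y) ↔ extMatrix _ _ _ _ x y = true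
    have hba := hab.symm
    have hcb := hbc.symm
    have hdc := hcd.symm
    have hca : ¬ G.graph.Adj c a := fun h => hac h.symm
    have hda : ¬ G.graph.Adj d a := fun h => had h.symm
    have hdb : ¬ G.graph.Adj d b := fun h => hbd h.symm
    fin_cases x <;> fin_cases y <;> simp [f, extMatrix, *] <;> exact G.graph.adj_comm _ _
  · push Not at hs
    refine Or.inr (Or.inl ?_)
    let f : Fin 4 → G.V := ![a, b, c, d]
    have hf : Function.Injective f := by
      intro x y hxy
      fin_cases x <;> fin_cases y <;> simp_all [f, eq_comm]
    have hb : Function.Bijective f := by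
      refine ⟨hf, fun v => ?_⟩
      by_cases v1 : v = a
      · exact ⟨0, v1.symm⟩
      by_cases v2 : v = b
      · exact ⟨1, v2.symm⟩
      by_cases v3 : v = c
      · exact ⟨2, v3.symm⟩
      · exact ⟨3, (hs v v1 v2 v3).symm⟩
    refine ⟨⟨Equiv.ofBijective f hb, fun {x y} => ?_⟩⟩
    change G.graph.Adj (f x) (f y) ↔ matP4 x y = true
    have hba := hab.symm
    have hcb := hbc.symm
    have hdc := hcd.symm
    have hca : ¬ G.graph.Adj c a := fun h => hac h.symm
    have hda : ¬ G.graph.Adj d a := fun h => had h.symm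
    have hdb : ¬ G.graph.Adj d b := fun h => hbd h.symm
    fin_cases x <;> fin_cases y <;> simp [f, matP4, *]

end FinGraph

/-! ### Colours, commutation and the finite checks -/

namespace FinGraph

open Classical in
/-- The degree of a vertex and the sum of the degrees of its neighbours. -/
def color (G : FinGraph) (y : G.V) : ℕ × ℕ :=
  (∑ z, if G.graph.Adj y z then 1 else 0,
    ∑ z, if G.graph.Adj y z then ∑ w, if G.graph.Adj z w then 1 else 0 else 0)

/-- The same quantities computed from a Boolean adjacency matrix. -/
def matColor {n : ℕ} (m : Fin n → Fin n → Bool) (y : Fin n) : ℕ × ℕ :=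
  (∑ z, (m y z).toNat, ∑ z, (m y z).toNat * ∑ w, (m z w).toNat)

theorem color_eq_matColor {n : ℕ} (m : Fin n → Fin n → Bool) (G : SimpleGraph (Fin n))
    (h : ∀ x y, G.Adj x y ↔ m x y = true) (y : Fin n) :
    color ⟨Fin n, G⟩ y = matColor m y := by
  have h1 : ∀ x y (k : ℕ) [Decidable (G.Adj x y)],
      (if G.Adj x y then k else 0) = (m x y).toNat * k := fun x y k _ => by
    cases hm : m x y <;> simp [h, hm]
  simp only [color, matColor, h1, mul_one]

/-- Two rounds of colour refinement, starting from the constant function `1`. -/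
theorem AdjMagic.color_eq {A : Type} [Ring A] [Algebra ℂ A] {G H : FinGraph} {e : A}
    {P : H.V → G.V → A} (h : AdjMagic G H e P) {x : H.V} {y : G.V} (hxy : P x y ≠ 0) :
    color H x = color G y := by
  have h1 := h.sum_neighbors_eq (fun _ => 1) (fun _ => 1) (fun _ _ _ => rfl)
  exact Prod.ext (h1 x y hxy) (h.sum_neighbors_eq _ _ h1 x y hxy)

/-- Two pairs of vertices of equal color each, all four relations between which agree. -/
def HasQuad (G : FinGraph) : Prop :=
  ∃ j p s s', j ≠ p ∧ s ≠ s' ∧ j ≠ s ∧ p ≠ s ∧ j ≠ s' ∧ p ≠ s' ∧ color G j = color G p ∧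
    color G s = color G s' ∧ (G.graph.Adj j s ↔ G.graph.Adj p s) ∧
    (G.graph.Adj j s ↔ G.graph.Adj j s') ∧ (G.graph.Adj j s ↔ G.graph.Adj p s')

/-- A quad is exactly the trace left in `G` by two surviving products `P i j * P k s * P i p` and `P
i j * P k s' * P i p`: all four relations copy the one between `i` and `k`. Without quads the
criterion `commute_of_unique` applies. -/
theorem AdjMagic.commute_of_not_hasQuad {A : Type} [Ring A] [Algebra ℂ A] {G H : FinGraph} {e : A}
    {P : H.V → G.V → A} (h : AdjMagic G H e P) (hG : ¬ HasQuad G) (i k : H.V) (j l : G.V) :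
    P i j * P k l = P k l * P i j := by
  refine h.commute_of_unique (fun i k j p hjp s s' hs => ?_) i k j l
  by_contra hn
  rw [not_or] at hn
  have key : ∀ s, P i j * P k s * P i p ≠ 0 → j ≠ s ∧ p ≠ s ∧
      (H.graph.Adj i k ↔ G.graph.Adj j s) ∧ (H.graph.Adj i k ↔ G.graph.Adj p s) := by
    intro s hs
    have h1 : P i j * P k s ≠ 0 := left_ne_zero_of_mul hs
    have h2 : P k s * P i p ≠ 0 := by
      rw [mul_assoc] at hs
      exact right_ne_zero_of_mul hs
    have a1 : H.graph.Adj i k ↔ G.graph.Adj j s := by_contra fun hc => h1 (h.adj _ _ _ _ hc)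
    have a2 : H.graph.Adj k i ↔ G.graph.Adj s p := by_contra fun hc => h2 (h.adj _ _ _ _ hc)
    have b1 : i = k ↔ j = s :=
      ⟨fun hc => by_contra fun hd => h1 (hc ▸ h.row_orth _ _ _ hd),
        fun hc => by_contra fun hd => h1 (hc ▸ h.col_orth _ _ _ hd)⟩
    have b2 : i = k ↔ p = s :=
      ⟨fun hc => by_contra fun hd => h2 (hc ▸ h.row_orth _ _ _ (Ne.symm hd)),
        fun hc => by_contra fun hd => h2 (hc ▸ h.col_orth _ _ _ (Ne.symm hd))⟩
    -- By orthogonality `i = k`, `j = s` and `p = s` are equivalent, so `j ≠ p` excludes all three.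
    have hjs : j ≠ s := fun hc => hjp (hc.trans (b2.1 (b1.2 hc)).symm)
    refine ⟨hjs, fun hc => hjs (b1.1 (b2.2 hc)), a1, ?_⟩
    rw [G.graph.adj_comm p s, ← a2, H.graph.adj_comm]
  obtain ⟨h1, h2, h3, h4⟩ := key s hn.1
  obtain ⟨h1', h2', h3', h4'⟩ := key s' hn.2
  refine hG ⟨j, p, s, s', hjp, hs, h1, h2, h1', h2', ?_, ?_, h3.symm.trans h4, h3.symm.trans h3',
    h3.symm.trans h4'⟩
  · rw [← h.color_eq (left_ne_zero_of_mul (left_ne_zero_of_mul hn.1)),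
      ← h.color_eq (right_ne_zero_of_mul hn.1)]
  · rw [← h.color_eq (right_ne_zero_of_mul (left_ne_zero_of_mul hn.1)),
      ← h.color_eq (right_ne_zero_of_mul (left_ne_zero_of_mul hn.2))]

/-- The same condition for a Boolean adjacency matrix. -/
def matHasQuad {n : ℕ} (m : Fin n → Fin n → Bool) : Prop :=
  ∃ j p, j ≠ p ∧ matColor m j = matColor m p ∧ ∃ s, j ≠ s ∧ p ≠ s ∧ m j s = m p s ∧
    ∃ s', s ≠ s' ∧ j ≠ s' ∧ p ≠ s' ∧ m j s = m j s' ∧ m j s = m p s' ∧ matColor m s = matColor m s'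

instance {n : ℕ} (m : Fin n → Fin n → Bool) : Decidable (matHasQuad m) := by
  unfold matHasQuad
  infer_instance

theorem not_hasQuad_of_mat {n : ℕ} (m : Fin n → Fin n → Bool) (G : SimpleGraph (Fin n))
    (h : ∀ x y, G.Adj x y ↔ m x y = true) (hm : ¬ matHasQuad m) : ¬ HasQuad ⟨Fin n, G⟩ := by
  rintro ⟨j, p, s, s', h1, h2, h3, h4, h5, h6, h7, h8, h9, h10, h11⟩
  simp only [color_eq_matColor m G h] at h7 h8
  have e : ∀ x y x' y', (G.Adj x y ↔ G.Adj x' y') → m x y = m x' y' := fun x y x' y' hi => by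
    rw [h, h] at hi
    exact Bool.eq_iff_iff.2 hi
  exact hm ⟨j, p, h1, h7, s, h3, h4, e _ _ _ _ h9, s', h2, h5, h6, e _ _ _ _ h10, e _ _ _ _ h11,
    h8⟩

theorem not_hasQuad_pathP4 : ¬ HasQuad pathP4 :=
  not_hasQuad_of_mat matP4 _ (fun _ _ => Iff.rfl) (by decide +kernel)

theorem not_matHasQuad_extMatrix : ∀ a b c d, ¬ matHasQuad (extMatrix a b c d) := by
  decide +kernel

theorem not_hasQuad_extP4 (a b c d : Bool) : ¬ HasQuad (extP4 a b c d) :=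
  not_hasQuad_of_mat (extMatrix a b c d) _ (fun _ _ => Iff.rfl) (not_matHasQuad_extMatrix a b c d)

/-- None of the sixteen graphs is asymmetric. A product of two transpositions (one of them possibly
trivial) always serves, so four indices are searched instead of all permutations. -/
theorem exists_swap_extMatrix : ∀ a b c d, ∃ i j k l : Fin 5,
    Equiv.swap i j (Equiv.swap k l i) ≠ i ∧
    ∀ x y, extMatrix a b c d (Equiv.swap i j (Equiv.swap k l x))
      (Equiv.swap i j (Equiv.swap k l y)) = extMatrix a b c d x y := by
  decide +kernel

theorem not_autTrivial_extP4 (a b c d : Bool) : ¬ AutTrivial (extP4 a b c d) := by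
  obtain ⟨i, j, k, l, h, h'⟩ := exists_swap_extMatrix a b c d
  intro hs
  let f : (extP4 a b c d).graph ≃g (extP4 a b c d).graph :=
    ⟨(Equiv.swap k l).trans (Equiv.swap i j), fun {x y} => by
      exact Bool.eq_iff_iff.1 (h' x y)⟩
  exact h (congrArg (fun f : (extP4 a b c d).graph ≃g (extP4 a b c d).graph => f i)
    (hs.elim f SimpleGraph.Iso.refl))

theorem not_autTrivial_pathP4 : ¬ AutTrivial pathP4 := by
  intro hs
  let f : pathP4.graph ≃g pathP4.graph :=
    ⟨Fin.revPerm, fun {x y} => by revert x y; exact (by decide : ∀ x y : Fin 4,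
      matP4 (Fin.rev x) (Fin.rev y) = true ↔ matP4 x y = true)⟩
  have := congrArg (fun f : pathP4.graph ≃g pathP4.graph => f (0 : Fin 4))
    (hs.elim f SimpleGraph.Iso.refl)
  exact absurd this (by decide : Fin.rev (0 : Fin 4) ≠ 0)

/-- The multiplicities of the colours, which a magic matrix preserves, separate the sixteen graphs
up to reversal of the path. Reversal is an isomorphism, so colours alone decide isomorphism here. -/
theorem extMatrix_eq_or_rev : ∀ a b c d a' b' c' d' : Bool,
    (∀ v : Fin 5, (Finset.univ.filter fun x => matColor (extMatrix a' b' c' d') x =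
        matColor (extMatrix a b c d) v).card =
      (Finset.univ.filter fun x => matColor (extMatrix a b c d) x =
        matColor (extMatrix a b c d) v).card) →
    (a', b', c', d') = (a, b, c, d) ∨ (a', b', c', d') = (d, c, b, a) := by
  decide +kernel

/-- The permutation of the five vertices that reverses the path. -/
def revPath : Equiv.Perm (Fin 5) := (Equiv.swap 0 3).trans (Equiv.swap 1 2)

theorem extMatrix_rev : ∀ a b c d x y, extMatrix a b c d (revPath x) (revPath y) =
    extMatrix d c b a x y := by
  decide +kernel

theorem iso_extP4_rev (a b c d : Bool) : Iso (extP4 d c b a) (extP4 a b c d) :=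
  ⟨⟨revPath, fun {x y} => Bool.eq_iff_iff.1 (extMatrix_rev a b c d x y)⟩⟩

theorem AdjMagic.iso_of_extP4 {A : Type} [Ring A] [Algebra ℂ A] {a b c d a' b' c' d' : Bool}
    {e : A} {P : Fin 5 → Fin 5 → A} (h : AdjMagic (extP4 a b c d) (extP4 a' b' c' d') e P)
    (he : e ≠ 0) : Iso (extP4 a b c d) (extP4 a' b' c' d') := by
  have h2 : ∀ a b c d, color (extP4 a b c d) = matColor (extMatrix a b c d) :=
    fun a b c d => funext (color_eq_matColor (extMatrix a b c d) _ (fun _ _ => Iff.rfl))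
  have h1 := card_filter_eq_of_sums he P h.row_sum h.col_sum (color (extP4 a b c d))
    (color (extP4 a' b' c' d')) (fun x y hxy => h.color_eq hxy)
  rw [h2, h2] at h1
  have h3 := extMatrix_eq_or_rev a b c d a' b' c' d' fun v => by
    convert h1 (matColor (extMatrix a b c d) v) <;> rfl
  simp only [Prod.mk.injEq] at h3
  rcases h3 with ⟨rfl, rfl, rfl, rfl⟩ | ⟨rfl, rfl, rfl, rfl⟩
  · exact Iso.refl _
  · exact iso_extP4_rev _ _ _ _

end FinGraph

namespace FinGraph

/-! ### Automorphisms, isomorphisms and complements -/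

/-- An isomorphism of graphs is an isomorphism of the complements. -/
def complIso {G H : FinGraph} (f : G.graph ≃g H.graph) : G.compl.graph ≃g H.compl.graph :=
  ⟨f.toEquiv, fun {x y} => (compl_adj (G := H) (f x) (f y)).trans
    ((and_congr f.injective.ne_iff (not_congr f.map_adj_iff)).trans
      (compl_adj (G := G) x y).symm)⟩

theorem compl_compl' (G : FinGraph) : G.compl.compl = G := by
  obtain ⟨V, g⟩ := G
  exact congrArg (FinGraph.mk V) (compl_compl g)

/-- The identity map to the double complement. -/
def complComplIso (G : FinGraph) : G.graph ≃g G.compl.compl.graph :=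
  ⟨Equiv.refl _, fun {x y} => by
    change G.graphᶜᶜ.Adj x y ↔ G.graph.Adj x y
    rw [compl_compl]⟩

theorem Iso.compl {G H : FinGraph} (h : Iso G H) : Iso G.compl H.compl := h.map complIso

theorem AutTrivial.of_compl {G : FinGraph} (h : AutTrivial G.compl) : AutTrivial G :=
  ⟨fun f g => by
    ext x
    exact congrArg (fun f : G.compl.graph ≃g G.compl.graph => f x)
      (h.elim (complIso f) (complIso g))⟩

theorem SchmidtCriterion.compl {G : FinGraph} (h : SchmidtCriterion G) :
    SchmidtCriterion G.compl := by
  obtain ⟨f, g, hfg⟩ := h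
  exact ⟨complIso f, complIso g, hfg⟩

theorem AutTrivial.of_iso {G H : FinGraph} (h : AutTrivial G) (f : Iso G H) : AutTrivial H := by
  obtain ⟨f⟩ := f
  refine ⟨fun a b => ?_⟩
  have := h.elim ((f.trans a).trans f.symm) ((f.trans b).trans f.symm)
  ext x
  have h1 := congrArg (fun t : G.graph ≃g G.graph => f (t (f.symm x))) this
  simpa using h1

theorem exists_ne_of_not_autTrivial {G : FinGraph} (h : ¬ AutTrivial G) :
    ∃ f : G.graph ≃g G.graph, ∃ x, f x ≠ x := by
  by_contra hn
  push Not at hn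
  exact h ⟨fun f g => by ext x; rw [hn, hn]⟩

theorem Iso.card_eq {G H : FinGraph} (h : Iso G H) : Fintype.card G.V = Fintype.card H.V :=
  Fintype.card_congr h.some.toEquiv

/-! ### Rigid graphs -/

/-- Graphs `G` such that every magic matrix from `G` to another graph forces an isomorphism, is
determined by its support if `G` is asymmetric, and is commutative unless `G` satisfies Schmidt's
criterion. -/
def Rigid (G : FinGraph) : Prop :=
  ∀ (A : Type) [Ring A] [Algebra ℂ A] (H : FinGraph) (e : A) (P : H.V → G.V → A),
    AdjMagic G H e P → (e ≠ 0 → Iso G H) ∧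
      (AutTrivial G → ∀ i j p, P i j ≠ 0 → P i p ≠ 0 → j = p) ∧
      (¬ SchmidtCriterion G → ∀ i k j l, P i j * P k l = P k l * P i j)

/-- Magic matrices, isomorphisms, asymmetry and Schmidt's criterion are all insensitive to
simultaneous complementation. -/
theorem Rigid.compl {G : FinGraph} (h : Rigid G) : Rigid G.compl := by
  intro A _ _ H e P hP
  obtain ⟨h1, h2, h3⟩ := h A H.compl e P
    (hP.compl.comp_iso (complComplIso G) SimpleGraph.Iso.refl)
  refine ⟨fun he => ?_, fun ha => h2 ha.of_compl, fun hs => h3 fun hs' => hs hs'.compl⟩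
  have := (h1 he).compl
  rwa [compl_compl' H] at this

theorem rigid_of_card_le_one {G : FinGraph} (h1 : Fintype.card G.V ≤ 1) : Rigid G := by
  have : Subsingleton G.V := Fintype.card_le_one_iff_subsingleton.1 h1
  intro A _ _ H e P hP
  refine ⟨fun he => ?_, fun _ i j p _ _ => Subsingleton.elim _ _, fun _ i k j l => ?_⟩
  · have hc := hP.card_eq he
    have : Subsingleton H.V := Fintype.card_le_one_iff_subsingleton.1 (hc ▸ h1)
    refine ⟨⟨Fintype.equivOfCardEq hc.symm, fun {x y} => ?_⟩⟩
    exact iff_of_false (fun h => h.ne (Subsingleton.elim _ _)) fun h => h.ne (Subsingleton.elim _ _)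
  · rw [Subsingleton.elim l j]
    by_cases hik : i = k
    · rw [hik]
    · rw [hP.col_orth i k j hik, hP.col_orth k i j (Ne.symm hik)]

/-- For `e ≠ 0` the target has the same size and is again connected with connected complement, so it
is on the same finite list, where colours identify it. Apart from graphs with at most one vertex,
the clause on asymmetric graphs is vacuous, and commutation holds with or without Schmidt's
criterion since there are no quads. -/
theorem rigid_of_preconnected {G : FinGraph} (h5 : Fintype.card G.V ≤ 5)
    (hG : G.graph.Preconnected) (hG' : G.compl.graph.Preconnected) : Rigid G := by
  rcases exists_iso_of_preconnected G h5 hG hG' with h1 | hK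
  · exact rigid_of_card_le_one h1
  intro A _ _ H e P hP
  have hH : e ≠ 0 → Fintype.card H.V = Fintype.card G.V ∧
      (Fintype.card H.V ≤ 1 ∨ Iso pathP4 H ∨ ∃ a b c d, Iso (extP4 a b c d) H) := fun he =>
    ⟨hP.card_eq he, exists_iso_of_preconnected H (hP.card_eq he ▸ h5) (hP.preconnected he hG)
      (hP.compl.preconnected he hG')⟩
  have hcomm : ∀ K : FinGraph, ¬ HasQuad K → Iso K G →
      ∀ i k j l, P i j * P k l = P k l * P i j := by
    rintro K hK ⟨f⟩ i k j l
    have := (hP.comp_iso f SimpleGraph.Iso.refl).commute_of_not_hasQuad hK i k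
      (f.symm j) (f.symm l)
    simpa using this
  have c4 : Fintype.card pathP4.V = 4 := Fintype.card_fin 4
  have c5 : ∀ a b c d, Fintype.card (extP4 a b c d).V = 5 := fun _ _ _ _ => Fintype.card_fin 5
  rcases hK with hK | ⟨a, b, c, d, hK⟩
  · refine ⟨fun he => ?_, fun ha => absurd (ha.of_iso hK.symm) not_autTrivial_pathP4,
      fun _ => hcomm _ not_hasQuad_pathP4 hK⟩
    have hc := hK.card_eq
    obtain ⟨h1, h2 | h2 | ⟨a, b, c, d, h2⟩⟩ := hH he
    · omega
    · exact hK.symm.trans h2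
    · have := h2.card_eq
      have := c5 a b c d
      omega
  · refine ⟨fun he => ?_, fun ha => absurd (ha.of_iso hK.symm) (not_autTrivial_extP4 _ _ _ _),
      fun _ => hcomm _ (not_hasQuad_extP4 _ _ _ _) hK⟩
    have hc := hK.card_eq
    have := c5 a b c d
    obtain ⟨h1, h2 | h2 | ⟨a', b', c', d', h2⟩⟩ := hH he
    · omega
    · have := h2.card_eq
      omega
    · obtain ⟨f⟩ := hK
      obtain ⟨g⟩ := h2
      exact (Iso.symm ⟨f⟩).trans (((hP.comp_iso f g).iso_of_extP4 he).trans ⟨g⟩)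

/-- Rigidity follows from rigidity of the connected components. -/
theorem rigid_of_components {G : FinGraph}
    (hG : ∀ y, Rigid (G.ind {z | G.graph.connectedComponentMk z = G.graph.connectedComponentMk y})) :
    Rigid G := by
  classical
  intro A _ _ H e P h
  set c := G.graph.connectedComponentMk with hc
  set d := H.graph.connectedComponentMk with hd
  have hcA : ∀ y y', G.graph.Adj y y' → c y = c y' := fun y y' ha =>
    SimpleGraph.ConnectedComponent.eq.2 ha.reachable
  have hdA : ∀ y y', H.graph.Adj y y' → d y = d y' := fun y y' ha =>
    SimpleGraph.ConnectedComponent.eq.2 ha.reachable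
  have hb : ∀ x x' y y', ¬ (d x = d x' ↔ c y = c y') → P x y * P x' y' = 0 := by
    intro x x' y y' hn
    refine h.mul_eq_zero_of_not_reachable_iff fun hi => hn ?_
    rw [hc, hd, SimpleGraph.ConnectedComponent.eq, SimpleGraph.ConnectedComponent.eq, hi]
  -- The block unit plays the role of `e` for the pair of components, so a nonzero one yields an
  -- isomorphism of components.
  have hiso : ∀ x y, AdjMagic.blockUnit P c x (c y) ≠ 0 →
      Iso (G.ind {z | c z = c y}) (H.ind {z | d z = d x}) := fun x y hq =>
    (hG y A _ _ _ (h.block hb x y)).1 hq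
  refine ⟨fun he => ?_, fun ha i j p hj hp => ?_, fun hs => ?_⟩
  · let : Fintype G.graph.ConnectedComponent := Fintype.ofFinite _
    let : Fintype H.graph.ConnectedComponent := Fintype.ofFinite _
    have hrep : ∀ k : H.graph.ConnectedComponent, ∃ x, d x = k := fun k => k.exists_rep
    choose r hr using hrep
    let f : G.graph.ConnectedComponent → Quotient isoSetoid := fun j => ⟦G.ind {z | c z = j}⟧
    let g : H.graph.ConnectedComponent → Quotient isoSetoid := fun k => ⟦H.ind {z | d z = k}⟧
    -- The block units form a matrix between the sets of components, with all row and column sums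
    -- `e`. Labelling components by isomorphism class, `G` and `H` have equally many of each class
    -- and can be glued.
    have hcard := card_filter_eq_of_sums he (fun k j => AdjMagic.blockUnit P c (r k) j)
      (fun k => h.sum_blockUnit (r k))
      (fun j => by
        obtain ⟨y, rfl⟩ : ∃ y, c y = j := j.exists_rep
        simp only [h.blockUnit_eq_sum_col hb, hr]
        rw [Finset.sum_comm]
        simp [h.col_sum])
      f g (fun k j hq => by
        obtain ⟨y, rfl⟩ : ∃ y, c y = j := j.exists_rep
        have := hiso _ _ hq
        rw [hr] at this
        exact Quotient.sound this.symm)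
    have hfib : ∀ v, Nonempty ({k // g k = v} ≃ {j // f j = v}) := fun v => by
      refine ⟨Fintype.equivOfCardEq ?_⟩
      rw [Fintype.card_subtype, Fintype.card_subtype]
      convert hcard v
    have hE : ∀ v, {k // g k = v} ≃ {j // f j = v} := fun v => (hfib v).some
    refine (Iso.glue c d hcA hdA (Equiv.ofFiberEquiv hE) fun k => ?_).symm
    have := Equiv.ofFiberEquiv_map hE k
    exact Quotient.exact this.symm
  · by_contra hjp
    -- Within one component, asymmetry is inherited because automorphisms extend by the identity.
    -- Two different components would both be isomorphic to that of `i`, and exchanging them would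
    -- be a nontrivial automorphism.
    by_cases hcc : c j = c p
    · have ha' : AutTrivial (G.ind {z | c z = c j}) := by
        by_contra hn
        obtain ⟨f, x, hx⟩ := exists_ne_of_not_autTrivial hn
        obtain ⟨F, -, hF⟩ := exists_extend c hcA (c j) f
        refine hx (Subtype.ext ((hF x).symm.trans ?_))
        rw [ha.elim F SimpleGraph.Iso.refl]
        rfl
      have := (hG j A _ _ _ (h.block hb i j)).2.1 ha' ⟨i, rfl⟩ ⟨j, rfl⟩ ⟨p, hcc.symm⟩ hj hp
      exact hjp (congrArg Subtype.val this)
    · obtain ⟨F, -, hF⟩ := exists_swap c hcA hcc ((hiso i j (h.blockUnit_ne_zero hj)).trans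
        (hiso i p (h.blockUnit_ne_zero hp)).symm)
      refine hF j rfl ?_
      rw [ha.elim F SimpleGraph.Iso.refl]
      rfl
  -- Two nonzero entries in a row force a nontrivial automorphism supported on the components of
  -- their columns, by the same alternative of moving one component or exchanging two.
  · have hM : ∀ i j p, j ≠ p → P i j ≠ 0 → P i p ≠ 0 → ∃ F : G.graph ≃g G.graph,
        (∃ y, F y ≠ y) ∧ ∀ y, F y ≠ y → c y = c j ∨ c y = c p := by
      intro i j p hjp hj hp
      by_cases hcc : c j = c p
      · have ha' : ¬ AutTrivial (G.ind {z | c z = c j}) := fun ha' => by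
          have := (hG j A _ _ _ (h.block hb i j)).2.1 ha' ⟨i, rfl⟩ ⟨j, rfl⟩ ⟨p, hcc.symm⟩ hj hp
          exact hjp (congrArg Subtype.val this)
        obtain ⟨f, x, hx⟩ := exists_ne_of_not_autTrivial ha'
        obtain ⟨F, hF, hF'⟩ := exists_extend c hcA (c j) f
        refine ⟨F, ⟨x.1, fun hh => hx (Subtype.ext ?_)⟩, fun y hy => Or.inl (hF y hy)⟩
        exact (hF' x).symm.trans hh
      · obtain ⟨F, hF, hF'⟩ := exists_swap c hcA hcc ((hiso i j (h.blockUnit_ne_zero hj)).trans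
          (hiso i p (h.blockUnit_ne_zero hp)).symm)
        exact ⟨F, ⟨j, hF' j rfl⟩, hF⟩
    refine h.commute_of_unique fun i k j p hjp s s' hss => ?_
    by_contra hn
    rw [not_or] at hn
    have nz : ∀ s, P i j * P k s * P i p ≠ 0 → P i j ≠ 0 ∧ P k s ≠ 0 ∧ P i p ≠ 0 ∧
        (d i = d k ↔ c j = c s) ∧ (d i = d k ↔ c p = c s) := by
      intro s hs
      have h1 : P i j * P k s ≠ 0 := left_ne_zero_of_mul hs
      have h2 : P k s * P i p ≠ 0 := by
        rw [mul_assoc] at hs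
        exact right_ne_zero_of_mul hs
      refine ⟨left_ne_zero_of_mul h1, right_ne_zero_of_mul h1, right_ne_zero_of_mul h2,
        by_contra fun hc => h1 (hb _ _ _ _ hc), by_contra fun hc => h2 (hb _ _ _ _ ?_)⟩
      rwa [eq_comm (a := d k), eq_comm (a := c s)]
    obtain ⟨n1, n2, n3, n4, n5⟩ := nz s hn.1
    obtain ⟨-, n2', -, n4', n5'⟩ := nz s' hn.2
    -- If `i, k` share a component, so do `j, s, p`. Schmidt's criterion fails there too, and
    -- commutation inside the block brings `P i j` next to `P i p`, whose product is zero. Otherwise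
    -- the components of `j, p` differ from those of `s, s'`, and `hM` gives two automorphisms with
    -- disjoint supports.
    by_cases hik : d i = d k
    · have hns : ¬ SchmidtCriterion (G.ind {z | c z = c j}) := by
        rintro ⟨f, g, ⟨x, hx⟩, ⟨y, hy⟩, hfg⟩
        obtain ⟨F, hF, hF'⟩ := exists_extend c hcA (c j) f
        obtain ⟨F₂, hF₂, hF₂'⟩ := exists_extend c hcA (c j) g
        refine hs ⟨F, F₂, ⟨x.1, fun hh => hx (Subtype.ext ((hF' x).symm.trans hh))⟩,
          ⟨y.1, fun hh => hy (Subtype.ext ((hF₂' y).symm.trans hh))⟩, ?_⟩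
        rw [Set.disjoint_left] at hfg ⊢
        intro z hz hz'
        have hzj := hF z hz
        exact hfg (a := ⟨z, hzj⟩) (fun hh => hz ((hF' ⟨z, hzj⟩).trans (congrArg Subtype.val hh)))
          fun hh => hz' ((hF₂' ⟨z, hzj⟩).trans (congrArg Subtype.val hh))
      have := (hG j A _ _ _ (h.block hb i j)).2.2 hns ⟨k, hik.symm⟩ ⟨i, rfl⟩
        ⟨s, (n4.1 hik).symm⟩ ⟨p, (n5.1 hik).trans (n4.1 hik).symm⟩
      apply hn.1
      rw [mul_assoc]
      refine (congrArg (P i j * ·) this).trans ?_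
      rw [← mul_assoc, h.row_orth i j p hjp, zero_mul]
    · obtain ⟨F, hF, hF'⟩ := hM i j p hjp n1 n3
      obtain ⟨F₂, hF₂, hF₂'⟩ := hM k s s' hss n2 n2'
      refine hs ⟨F, F₂, hF, hF₂, ?_⟩
      rw [Set.disjoint_left]
      intro z hz hz'
      rcases hF' z hz with h1 | h1 <;> rcases hF₂' z hz' with h2 | h2
      · exact hik (n4.2 (h1.symm.trans h2))
      · exact hik (n4'.2 (h1.symm.trans h2))
      · exact hik (n5.2 (h1.symm.trans h2))
      · exact hik (n5'.2 (h1.symm.trans h2))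

/-! ### Induced subgraphs of cographs -/

theorem card_ind_le (G : FinGraph) (S : Set G.V) :
    Fintype.card (G.ind S).V ≤ Fintype.card G.V :=
  Fintype.card_le_of_injective (fun x : (G.ind S).V => x.1) Subtype.val_injective

theorem card_ind_lt (G : FinGraph) (S : Set G.V) {x : G.V} (hx : x ∉ S) :
    Fintype.card (G.ind S).V < Fintype.card G.V :=
  Fintype.card_lt_of_injective_of_notMem (fun x : (G.ind S).V => x.1) Subtype.val_injective
    (b := x) (by rintro ⟨y, rfl⟩; exact hx y.2)

theorem iso_ind {G H : FinGraph} (f : G.graph ≃g H.graph) (S : Set H.V) :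
    Iso (G.ind (f ⁻¹' S)) (H.ind S) :=
  ⟨⟨f.toEquiv.subtypeEquiv (p := fun x => x ∈ f ⁻¹' S) (q := fun x => x ∈ S) fun _ => Iff.rfl,
    f.map_adj_iff⟩⟩

theorem iso_ind_compl (G : FinGraph) (S : Set G.V) : Iso (G.ind S).compl (G.compl.ind S) :=
  ⟨⟨Equiv.refl _, fun {x y} => (compl_adj (G := G) x.1 y.1).trans
    ((and_congr (not_congr Subtype.ext_iff.symm) Iff.rfl).trans
      (compl_adj (G := G.ind S) x y).symm)⟩⟩

theorem iso_ind_sum (G H : FinGraph) (S : Set (G.sum H).V) :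
    Iso (((G.ind (Sum.inl ⁻¹' S : Set G.V))).sum (H.ind (Sum.inr ⁻¹' S : Set H.V)))
      ((G.sum H).ind S) := by
  refine ⟨⟨(Equiv.subtypeSum (p := fun x : G.V ⊕ H.V => x ∈ S)).symm, fun {x y} => ?_⟩⟩
  rcases x with x | x <;> rcases y with y | y <;> exact Iff.rfl

/-- Having at most `n` vertices is hereditary, hence so is the class of cographs over such graphs.
Inductions may thus pass to components. -/
theorem Co.ind {n : ℕ} {G : FinGraph} (h : Co (upTo n) G) (S : Set G.V) :
    Co (upTo n) (G.ind S) := by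
  induction h with
  | base h => exact Co.base ((card_ind_le _ S).trans h)
  | iso hG f ih => exact Co.iso (ih _) (iso_ind f.some S)
  | sum _ _ ihG ihH => exact Co.iso (Co.sum (ihG _) (ihH _)) (iso_ind_sum _ _ S)
  | @compl G _ ih => exact Co.iso (Co.compl (ih S)) (iso_ind_compl G S)

theorem Iso.preconnected {G H : FinGraph} (f : Iso G H) (h : G.graph.Preconnected) :
    H.graph.Preconnected := (SimpleGraph.Iso.preconnected_iff f.some).1 h

theorem iso_empty_sum (G H : FinGraph) [hG : IsEmpty G.V] : Iso (G.sum H) H :=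
  ⟨⟨Equiv.emptySum _ _, fun {x y} => by
    rcases x with x | x
    · exact hG.elim x
    rcases y with y | y
    · exact hG.elim y
    exact Iff.rfl⟩⟩

theorem iso_sum_empty (G H : FinGraph) [hH : IsEmpty H.V] : Iso (G.sum H) G :=
  ⟨⟨Equiv.sumEmpty _ _, fun {x y} => by
    rcases x with x | x
    · rcases y with y | y
      · exact Iff.rfl
      · exact hH.elim y
    · exact hH.elim x⟩⟩

/-- The hypothesis is symmetric under complements, and a sum of two nonempty graphs is never
connected. Only the base graphs can satisfy it, up to sums with an empty graph. -/
theorem Co.card_le_of_preconnected {n : ℕ} {G : FinGraph} (h : Co (upTo n) G)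
    (h1 : G.graph.Preconnected) (h2 : G.compl.graph.Preconnected) : Fintype.card G.V ≤ n := by
  induction h with
  | base h => exact h
  | iso hG f ih =>
    rw [← f.card_eq]
    exact ih (f.symm.preconnected h1) (f.compl.symm.preconnected h2)
  | @sum G H _ _ ihG ihH =>
    by_cases hG : IsEmpty G.V
    · have f := iso_empty_sum G H
      rw [f.card_eq]
      exact ihH (f.preconnected h1) (f.compl.preconnected h2)
    by_cases hH : IsEmpty H.V
    · have f := iso_sum_empty G H
      rw [f.card_eq]
      exact ihG (f.preconnected h1) (f.compl.preconnected h2)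
    rw [not_isEmpty_iff] at hG hH
    obtain ⟨x⟩ := hG
    obtain ⟨y⟩ := hH
    exfalso
    obtain ⟨a, b, -, hab, ha, hb⟩ := exists_boundary_of_reachable
      (fun z : G.V ⊕ H.V => z.isRight = true) (h1 (Sum.inl x) (Sum.inr y)) (by simp) (by simp)
    rcases a with a | a <;> rcases b with b | b
    · simp at hb
    · exact Bool.false_ne_true hab
    · exact Bool.false_ne_true hab
    · simp at ha
  | @compl G hG ih =>
    rw [compl_compl'] at h2
    exact ih h2 h1

theorem exists_component_ne {G : FinGraph} (h : ¬ G.graph.Preconnected) (y : G.V) :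
    ∃ z, G.graph.connectedComponentMk z ≠ G.graph.connectedComponentMk y := by
  by_contra hn
  push Not at hn
  simp only [SimpleGraph.ConnectedComponent.eq] at hn
  exact h fun a b => (hn a).trans (hn b).symm

/-- Strong induction on the number of vertices: unless the small case applies, `G` or its complement
is disconnected, and its components are smaller cographs. -/
theorem rigid_of_co {n : ℕ} : ∀ G : FinGraph, Fintype.card G.V = n → Co (upTo 5) G → Rigid G := by
  have step : ∀ n, (∀ m < n, ∀ G : FinGraph, Fintype.card G.V = m → Co (upTo 5) G → Rigid G) →
      ∀ G : FinGraph, Fintype.card G.V = n → Co (upTo 5) G → ¬ G.graph.Preconnected → Rigid G := by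
    intro n ih G hn hG hc
    refine rigid_of_components fun y => ?_
    obtain ⟨z, hz⟩ := exists_component_ne hc y
    exact ih _ (hn ▸ card_ind_lt G _ (x := z) hz) _ rfl (hG.ind _)
  induction n using Nat.strong_induction_on with
  | h n ih =>
    intro G hn hG
    by_cases h1 : G.graph.Preconnected
    · by_cases h2 : G.compl.graph.Preconnected
      · exact rigid_of_preconnected (hG.card_le_of_preconnected h1 h2) h1 h2
      · have := (step n ih G.compl hn hG.compl h2).compl
        rwa [compl_compl'] at this
    · exact step n ih G hn hG h1

end FinGraph

namespace FinGraph

/-! ### Magic unitaries intertwining adjacency matrices -/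

/-- Multiply the `(x, y')` entry of the intertwining relation by `P x y` on the left and by `P x'
y'` on the right. Each side collapses to `P x y * P x' y'` times an adjacency coefficient, of `G` on
one side and of `H` on the other. -/
theorem adjMagic_of_intertwine {A : Type} [Ring A] [StarRing A] {G H : FinGraph}
    {P : Matrix H.V G.V A} (hP : IsMagic P)
    (hc : P * adjMat G.graph A = adjMat H.graph A * P) : AdjMagic G H 1 P where
  idem := hP.idem
  row_sum := hP.row_sum
  col_sum := hP.col_sum
  row_orth := hP.row_orth
  col_orth x x' y := hP.col_orth x y x'
  adj x x' y y' hn := by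
    classical
    have h1 : ∑ z, P x z * adjMat G.graph A z y' = ∑ z, adjMat H.graph A x z * P z y' :=
      congrFun (congrFun hc x) y'
    have h2 : ∑ z, P x y * (P x z * adjMat G.graph A z y') * P x' y' =
        ∑ z, P x y * (adjMat H.graph A x z * P z y') * P x' y' := by
      rw [← Finset.sum_mul, ← Finset.sum_mul, ← Finset.mul_sum, ← Finset.mul_sum, h1]
    rw [Finset.sum_eq_single y, Finset.sum_eq_single x'] at h2
    · simp only [adjMat, SimpleGraph.adjMatrix_apply] at h2
      by_cases hx : H.graph.Adj x x' <;> by_cases hy : G.graph.Adj y y' <;>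
        simp [hx, hy, hP.idem, mul_assoc] at h2 hn ⊢
      · exact h2.symm
      · exact h2
    · intro z _ hz
      rw [mul_assoc, mul_assoc, hP.col_orth z y' x' hz, mul_zero, mul_zero]
    · simp
    · intro z _ hz
      rw [← mul_assoc, hP.row_orth x y z hz.symm, zero_mul, zero_mul]
    · simp

/-- Insert `1` as the sum of column `y`. In each surviving product the adjacency coefficient of `G`
may be replaced by that of `H`, and the other factor is then summed along its row. -/
theorem AdjMagic.intertwine {A : Type} [Ring A] {G H : FinGraph} {P : H.V → G.V → A}
    (h : AdjMagic G H 1 P) :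
    (Matrix.of P : Matrix H.V G.V A) * adjMat G.graph A =
      adjMat H.graph A * (Matrix.of P : Matrix H.V G.V A) := by
  classical
  ext x y
  rw [mul_adjMat_apply, adjMat_mul_apply]
  simp only [adjMat, SimpleGraph.adjMatrix_apply, Matrix.of_apply]
  calc ∑ z, P x z * (if G.graph.Adj z y then 1 else 0)
      = ∑ z, ∑ w, P x z * P w y * (if G.graph.Adj z y then 1 else 0) := by
        refine Finset.sum_congr rfl fun z _ => ?_
        rw [← Finset.sum_mul, ← Finset.mul_sum, h.col_sum, mul_one]
    _ = ∑ w, ∑ z, (if H.graph.Adj x w then 1 else 0) * (P x z * P w y) := by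
        rw [Finset.sum_comm]
        refine Finset.sum_congr rfl fun w _ => Finset.sum_congr rfl fun z _ => ?_
        by_cases hi : H.graph.Adj x w ↔ G.graph.Adj z y
        · simp [hi]
        · rw [h.adj x w z y hi, zero_mul, mul_zero]
    _ = _ := by
        refine Finset.sum_congr rfl fun w _ => ?_
        rw [← Finset.mul_sum, ← Finset.sum_mul, h.row_sum, one_mul]

theorem AdjMagic.isMagic {A : Type} [Ring A] [StarRing A] {G H : FinGraph} {P : H.V → G.V → A}
    (h : AdjMagic G H 1 P) (hs : ∀ x y, star (P x y) = P x y) :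
    IsMagic (Matrix.of P : Matrix H.V G.V A) :=
  ⟨hs, h.idem, h.row_sum, h.col_sum, h.row_orth, fun x y x' => h.col_orth x x' y⟩

open Classical in
/-- The permutation matrix of an isomorphism. -/
theorem adjMagic_perm (A : Type) [Ring A] {G H : FinGraph} (f : G.graph ≃g H.graph) :
    AdjMagic G H (1 : A) (fun x y => if f y = x then 1 else 0) where
  idem x y := by split_ifs <;> simp
  row_sum x := by
    rw [Finset.sum_eq_single (f.symm x)]
    · simp
    · intro y _ hy
      exact if_neg fun h => hy (by rw [← h, f.symm_apply_apply])
    · simp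
  col_sum y := by simp
  row_orth x y y' hy := by
    by_cases h1 : f y = x
    · rw [if_neg (c := f y' = x) fun h2 => hy (f.injective (h1.trans h2.symm)), mul_zero]
    · rw [if_neg h1, zero_mul]
  col_orth x x' y hx := by
    by_cases h1 : f y = x
    · rw [if_neg fun h2 => hx (h1.symm.trans h2), mul_zero]
    · rw [if_neg h1, zero_mul]
  adj x x' y y' hn := by
    by_cases h1 : f y = x
    · by_cases h2 : f y' = x'
      · exact absurd (h1 ▸ h2 ▸ f.map_adj_iff) hn
      · rw [if_neg h2, mul_zero]
    · rw [if_neg h1, zero_mul]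

theorem Iso.quantumIso {G H : FinGraph} (h : Iso G H) : QuantumIso G H := by
  classical
  obtain ⟨f⟩ := h
  have hP := adjMagic_perm ℂ f
  refine ⟨Fintype.card_congr f.toEquiv, ℂ, inferInstance, inferInstance, _,
    hP.isMagic fun x y => ?_, hP.intertwine⟩
  split_ifs <;> simp

theorem superrigid_of_rigid {F : Set FinGraph} (hF : ∀ G ∈ F, Rigid G) : Superrigid F := by
  rintro G hG H ⟨-, X, _, _, P, hP, hc⟩
  exact (hF G hG X H 1 P (adjMagic_of_intertwine hP hc)).1 one_ne_zero

/-! ### The quantum automorphism group -/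

theorem quU_magic (G : FinGraph) : IsMagic (G.qu.u : Matrix G.V G.V G.qu.alg) := G.qu.magic

theorem quU_adjMagic (G : FinGraph) :
    AdjMagic G G (1 : G.qu.alg) (fun x y : G.V => G.qu.u x y) := by
  refine adjMagic_of_intertwine (quU_magic G) (Eq.symm ?_)
  exact (eval_commRel G.graph
    (Matrix.of fun i j => UnivStar.gen (magicRel G.V ∪ commRel G.graph) (i, j))).1 fun r hr =>
      (UnivStar.eval_gen r).trans (UnivStar.mk_rel (Or.inr hr))

/-- The universal property of the quantum automorphism group. -/
def quLift {G : FinGraph} {B : Type} [Ring B] [StarRing B] [Algebra ℂ B] [StarModule ℂ B]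
    (v : G.V → G.V → B) (hv : AdjMagic G G 1 v) (hs : ∀ x y, star (v x y) = v x y) :
    G.qu.alg →⋆ₐ[ℂ] B :=
  UnivStar.lift (R := magicRel G.V ∪ commRel G.graph) (fun x : G.V × G.V => v x.1 x.2) (by
    rintro r (hr | hr)
    · exact (isMagic_iff_eval _).1 (hv.isMagic hs) r hr
    · exact (eval_commRel G.graph (Matrix.of v)).2 hv.intertwine.symm r hr)

theorem quLift_u {G : FinGraph} {B : Type} [Ring B] [StarRing B] [Algebra ℂ B] [StarModule ℂ B]
    (v : G.V → G.V → B) (hv : AdjMagic G G 1 v) (hs : ∀ x y, star (v x y) = v x y) (x y : G.V) :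
    quLift v hv hs (G.qu.u x y) = v x y :=
  UnivStar.lift_gen (R := magicRel G.V ∪ commRel G.graph) _ _ (x, y)

open Classical in
/-- The character of the quantum automorphism group given by an automorphism. -/
def quChar {G : FinGraph} (f : G.graph ≃g G.graph) : G.qu.alg →⋆ₐ[ℂ] ℂ :=
  quLift _ (adjMagic_perm ℂ f) fun x y => by split_ifs <;> simp

open Classical in
theorem quChar_u {G : FinGraph} (f : G.graph ≃g G.graph) (x y : G.V) :
    quChar f (G.qu.u x y) = if f y = x then 1 else 0 := quLift_u _ _ _ x y

/-- Automorphisms are characters of the quantum automorphism group, and `ℂ` has only one. -/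
theorem autTrivial_of_isTrivial {G : FinGraph} (h : G.qu.IsTrivial) : AutTrivial G := by
  refine ⟨fun f g => ?_⟩
  have key : ∀ a : G.qu.alg, quChar f a = quChar g a := fun a => by
    obtain ⟨c, rfl⟩ := h.2 a
    rw [AlgHomClass.commutes, AlgHomClass.commutes]
  ext y
  have := key (G.qu.u (f y) y)
  rw [quChar_u, quChar_u, if_pos rfl] at this
  by_contra hne
  rw [if_neg (Ne.symm hne)] at this
  exact one_ne_zero this

/-- The character of the identity automorphism, which is the counit, splits the map from the
scalars. -/
theorem algebraMap_qu_injective (G : FinGraph) : Function.Injective (algebraMap ℂ G.qu.alg) := by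
  intro a b hab
  have := congrArg (quChar (SimpleGraph.Iso.refl : G.graph ≃g G.graph)) hab
  rwa [AlgHomClass.commutes, AlgHomClass.commutes] at this

theorem _root_.QPermGroup.mem_of_gen (P : QPermGroup) (S : StarSubalgebra ℂ P.alg)
    (h : ∀ i j, P.u i j ∈ S) (a : P.alg) : a ∈ S :=
  P.map_mem_of_gen (StarAlgHom.id ℂ P.alg) S h a

/-- With at most one nonzero entry per row, each generator is `0` or, being the whole row sum, `1`.
-/
theorem isTrivial_of_support {G : FinGraph}
    (h : ∀ i j p : G.V, G.qu.u i j ≠ 0 → G.qu.u i p ≠ 0 → j = p) : G.qu.IsTrivial := by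
  refine ⟨algebraMap_qu_injective G, fun a => ?_⟩
  have := G.qu.mem_of_gen ⊥ (fun i j => ?_) a
  · exact StarSubalgebra.mem_bot.1 this
  · by_cases h0 : G.qu.u i j = 0
    · rw [h0]
      exact zero_mem _
    · have h1 : G.qu.u i j = 1 := by
        rw [← G.qu.magic.row_sum i, Finset.sum_eq_single j]
        · intro p _ hp
          by_contra hip
          exact hp (h i p j hip h0)
        · simp
      rw [h1]
      exact one_mem _

theorem QA_of_rigid {F : Set FinGraph} (hF : ∀ G ∈ F, Rigid G) : QA F := fun G hG =>
  ⟨autTrivial_of_isTrivial, fun ha =>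
    isTrivial_of_support ((hF G hG _ G 1 _ (quU_adjMagic G)).2.1 ha)⟩

theorem _root_.QPermGroup.mul_comm_of_gen (P : QPermGroup)
    (h : ∀ i k j l, P.u i j * P.u k l = P.u k l * P.u i j) (a b : P.alg) : a * b = b * a := by
  have h1 : ∀ i j (b : P.alg), P.u i j * b = b * P.u i j := fun i j b => by
    have := P.mem_of_gen (StarSubalgebra.centralizer ℂ {P.u i j}) (fun k l => by
      simp [StarSubalgebra.mem_centralizer_iff, P.magic.star_eq, h i k j l]) b
    simp only [StarSubalgebra.mem_centralizer_iff, Set.mem_singleton_iff, forall_eq] at this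
    exact this.1
  have := P.mem_of_gen (StarSubalgebra.centralizer ℂ {b}) (fun i j => by
    simp [StarSubalgebra.mem_centralizer_iff, h1]) a
  simp only [StarSubalgebra.mem_centralizer_iff, Set.mem_singleton_iff, forall_eq] at this
  exact this.1.symm

/-! ### Quantum symmetry from Schmidt's criterion -/

open Classical in
/-- A mixture of automorphisms `σ t`, with weights `E t` given by partitions of unity that are
compatible with the automorphisms and with adjacency. -/
theorem adjMagic_mix {G : FinGraph} {A T : Type} [Ring A] [Fintype T] (σ : T → (G.graph ≃g G.graph))
    (E : T → G.V → A) (sum : ∀ y, ∑ t, E t y = 1) (idem : ∀ t y, E t y * E t y = E t y)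
    (orth : ∀ t s y, t ≠ s → E t y * E s y = 0) (inv : ∀ t s y, E t (σ s y) = E t y)
    (adj : ∀ t s y y', ¬ (G.graph.Adj (σ t y) (σ s y') ↔ G.graph.Adj y y') →
      E t y * E s y' = 0) :
    AdjMagic G G 1 fun x y => ∑ t, if σ t y = x then E t y else 0 := by
  have zero : ∀ x x' y y', (∀ t s, σ t y = x → σ s y' = x' → E t y * E s y' = 0) →
      (∑ t, if σ t y = x then E t y else 0) * (∑ s, if σ s y' = x' then E s y' else 0) = 0 := by
    intro x x' y y' h
    rw [Finset.sum_mul_sum]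
    refine Finset.sum_eq_zero fun t _ => Finset.sum_eq_zero fun s _ => ?_
    split_ifs with h1 h2
    · exact h t s h1 h2
    all_goals simp
  refine ⟨fun x y => ?_, fun x => ?_, fun y => ?_, fun x y y' hy => ?_,
    fun x x' y hx => ?_, fun x x' y y' hn => ?_⟩
  · rw [Finset.sum_mul_sum]
    refine Finset.sum_congr rfl fun t _ => ?_
    rw [Finset.sum_eq_single t]
    · split_ifs
      · exact idem t y
      · simp
    · intro s _ hs
      split_ifs
      · exact orth t s y hs.symm
      all_goals simp
    · simp
  · rw [Finset.sum_comm, ← sum x]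
    refine Finset.sum_congr rfl fun t _ => ?_
    rw [Finset.sum_eq_single ((σ t).symm x)]
    · rw [if_pos ((σ t).apply_symm_apply x)]
      nth_rw 2 [← (σ t).apply_symm_apply x]
      rw [inv]
    · intro y _ hy
      exact if_neg fun h => hy (by rw [← h, (σ t).symm_apply_apply])
    · simp
  · rw [Finset.sum_comm, ← sum y]
    refine Finset.sum_congr rfl fun t _ => ?_
    rw [Finset.sum_ite_eq]
    simp
  · refine zero _ _ _ _ fun t s h1 h2 => ?_
    by_cases hts : t = s
    · subst hts
      exact absurd ((σ t).injective (h1.trans h2.symm)) hy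
    · rw [← inv t t, ← inv s s y', h1, h2, orth t s x hts]
  · refine zero _ _ _ _ fun t s h1 h2 => orth t s y ?_
    rintro rfl
    exact hx (h1.symm.trans h2)
  · refine zero _ _ _ _ fun t s h1 h2 => adj t s y y' ?_
    rwa [h1, h2]

/-- Heuristically, `f` is applied with probability `p` and `g` with probability `q`. As their
supports are disjoint, `p` and `q` need not commute. -/
theorem exists_mix {G : FinGraph} (hs : SchmidtCriterion G) {A : Type} [Ring A] [StarRing A]
    {p q : A} (hp : p * p = p) (hq : q * q = q) (hp' : star p = p) (hq' : star q = q) :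
    ∃ v : G.V → G.V → A, AdjMagic G G 1 v ∧ (∀ x y, star (v x y) = v x y) ∧
      (∃ x y, v x y = p) ∧ ∃ x y, v x y = q := by
  classical
  obtain ⟨f, g, ⟨a, ha⟩, ⟨b, hb⟩, hfg⟩ := hs
  rw [Set.disjoint_left] at hfg
  have hfg : ∀ x, f x = x ∨ g x = x := fun x => by
    by_contra hn
    rw [not_or] at hn
    exact hfg (a := x) hn.1 hn.2
  have hff : ∀ x, f (f x) = f x ↔ f x = x := fun x => f.injective.eq_iff
  have hgg : ∀ x, g (g x) = g x ↔ g x = x := fun x => g.injective.eq_iff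
  have hfg' : ∀ x, f (g x) = g x ↔ f x = x := fun x => by
    by_cases h1 : g x = x
    · rw [h1]
    · exact iff_of_true ((hfg (g x)).resolve_right fun h => h1 ((hgg x).1 h))
        ((hfg x).resolve_right h1)
  let h : G.graph ≃g G.graph := g.trans f
  have h1 : ∀ x, f x = x → h x = g x := fun x hx => (hfg' x).2 hx
  have h2 : ∀ x, g x = x → h x = f x := fun x hx => congrArg f hx
  have hfh : ∀ x, f (h x) = h x ↔ f x = x := fun x => (hff (g x)).trans (hfg' x)
  -- If exactly one of the two vertices is moved by `f`, then `h` acts on `y` as `f` or as `g`, and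
  -- that automorphism fixes `y'`.
  have hadj : ∀ y y', ¬ (f y = y ↔ f y' = y') →
      (G.graph.Adj (h y) y' ↔ G.graph.Adj y y') := by
    intro y y' hne
    by_cases h3 : f y = y
    · have h5 := (hfg y').resolve_left (by tauto)
      rw [h1 y h3]
      nth_rw 1 [← h5]
      exact g.map_adj_iff
    · have h4 : f y' = y' := by tauto
      rw [h2 y ((hfg y).resolve_left h3)]
      nth_rw 1 [← h4]
      exact f.map_adj_iff
  -- The column of `y` mixes `h` with weight `F y` and the identity with weight `1 - F y`. Points
  -- fixed by both `f` and `g` carry weight `q` harmlessly.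
  let F : G.V → A := fun y => if f y = y then q else p
  have hF : ∀ y, F y * F y = F y := fun y => by
    simp only [F]
    split_ifs
    · exact hq
    · exact hp
  have hFs : ∀ y, star (F y) = F y := fun y => by
    simp only [F]
    split_ifs
    · exact hq'
    · exact hp'
  have hF1 : ∀ y y', (f y = y ↔ f y' = y') → F y = F y' := fun y y' hi => by
    simp only [F, hi]
  let σ : Bool → (G.graph ≃g G.graph) := fun t => bif t then h else SimpleGraph.Iso.refl
  let E : Bool → G.V → A := fun t y => bif t then F y else 1 - F y
  have horth : ∀ t s y, t ≠ s → E t y * E s y = 0 := by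
    rintro (_ | _) (_ | _) y hts
    · exact absurd rfl hts
    · change (1 - F y) * F y = 0
      rw [sub_mul, one_mul, hF, sub_self]
    · change F y * (1 - F y) = 0
      rw [mul_sub, mul_one, hF, sub_self]
    · exact absurd rfl hts
  have hE1 : ∀ t y y', (f y = y ↔ f y' = y') → E t y = E t y' := fun t y y' hi => by
    simp only [E, hF1 y y' hi]
  have hmix := adjMagic_mix σ E (fun y => by simp [E]) (by
    rintro (_ | _) y
    · change (1 - F y) * (1 - F y) = 1 - F y
      rw [mul_sub, mul_one, sub_mul, one_mul, hF, sub_self, sub_zero]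
    · exact hF y) horth (by
    rintro t (_ | _) y
    · rfl
    · exact hE1 t _ _ (hfh y)) (by
    intro t s y y' hn
    by_cases hts : t = s
    · subst hts
      exact absurd (σ t).map_adj_iff hn
    · by_cases hi : f y = y ↔ f y' = y'
      · rw [hE1 t y y' hi]
        exact horth t s y' hts
      · refine absurd ?_ hn
        rcases t with _ | _ <;> rcases s with _ | _
        · exact absurd rfl hts
        · change G.graph.Adj y (h y') ↔ _
          rw [G.graph.adj_comm y, G.graph.adj_comm y]
          exact hadj y' y fun hi' => hi hi'.symm
        · exact hadj y y' hi
        · exact absurd rfl hts)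
  have hv : ∀ y, y ≠ h y → (∑ t, if σ t y = h y then E t y else 0) = F y := fun y hy => by
    rw [Fintype.sum_bool, if_pos (show σ true y = h y from rfl),
      if_neg (show ¬ σ false y = h y from hy), add_zero]
    rfl
  refine ⟨_, hmix, fun x y => ?_, ⟨h a, a, (hv a ?_).trans (if_neg ha)⟩,
    ⟨h b, b, (hv b ?_).trans (if_pos ((hfg b).resolve_right hb))⟩⟩
  · rw [star_sum]
    refine Finset.sum_congr rfl fun t _ => ?_
    split_ifs
    · cases t
      · exact (star_sub _ _).trans (by rw [star_one, hFs]; rfl)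
      · exact hFs y
    · exact star_zero _
  · rw [h2 a ((hfg a).resolve_left ha)]
    exact ha.symm
  · rw [h1 b ((hfg b).resolve_right hb)]
    exact hb.symm

theorem hasQuantumSymmetry_of_schmidt {G : FinGraph} (hs : SchmidtCriterion G) :
    HasQuantumSymmetry G := by
  -- Two projections in `M₂(ℂ)` whose products in the two orders differ in the `(0, 1)` entry.
  let p : Matrix (Fin 2) (Fin 2) ℂ := !![1, 0; 0, 0]
  let q : Matrix (Fin 2) (Fin 2) ℂ := !![1 / 2, 1 / 2; 1 / 2, 1 / 2]
  have hp : p * p = p := by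
    ext i j
    fin_cases i <;> fin_cases j <;> simp [p]
  have hq : q * q = q := by
    ext i j
    fin_cases i <;> fin_cases j <;> norm_num [q]
  have hp' : star p = p := by
    ext i j
    fin_cases i <;> fin_cases j <;> simp [p]
  have hq' : star q = q := by
    ext i j
    fin_cases i <;> fin_cases j <;> simp [q, Matrix.star_apply]
  obtain ⟨v, hv, hvs, ⟨x, y, hxy⟩, ⟨x', y', hxy'⟩⟩ := exists_mix hs hp hq hp' hq'
  refine ⟨G.qu.u x y, G.qu.u x' y', fun h => ?_⟩
  have h1 := congrArg (quLift v hv hvs) h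
  rw [map_mul, map_mul, quLift_u, quLift_u, hxy, hxy'] at h1
  have h2 := congrFun (congrFun h1 0) 1
  simp [p, q] at h2

theorem SA_of_rigid {F : Set FinGraph} (hF : ∀ G ∈ F, Rigid G) : SA F := fun G hG =>
  ⟨fun ⟨a, b, hab⟩ => by
    by_contra hs
    exact hab (G.qu.mul_comm_of_gen ((hF G hG _ G 1 _ (quU_adjMagic G)).2.2 hs) a b),
  hasQuantumSymmetry_of_schmidt⟩

theorem tractable_of_rigid {F : Set FinGraph} (hF : ∀ G ∈ F, Rigid G) : Tractable F :=
  ⟨QA_of_rigid hF, fun G hG H _ => ⟨superrigid_of_rigid hF G hG H, Iso.quantumIso⟩,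
    SA_of_rigid hF⟩

end FinGraph

/-! ### Homomorphisms and isomorphisms of quantum permutation groups -/

theorem StarAlgHom.tensor_tensor {A B A' B' A'' B'' : Type}
    [Ring A] [StarRing A] [Algebra ℂ A] [StarModule ℂ A]
    [Ring B] [StarRing B] [Algebra ℂ B] [StarModule ℂ B]
    [Ring A'] [StarRing A'] [Algebra ℂ A'] [StarModule ℂ A']
    [Ring B'] [StarRing B'] [Algebra ℂ B'] [StarModule ℂ B']
    [Ring A''] [StarRing A''] [Algebra ℂ A''] [StarModule ℂ A'']
    [Ring B''] [StarRing B''] [Algebra ℂ B''] [StarModule ℂ B'']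
    (f' : A' →⋆ₐ[ℂ] A'') (g' : B' →⋆ₐ[ℂ] B'') (f : A →⋆ₐ[ℂ] A') (g : B →⋆ₐ[ℂ] B')
    (z : A ⊗[ℂ] B) : StarAlgHom.tensor f' g' (StarAlgHom.tensor f g z) =
      StarAlgHom.tensor (f'.comp f) (g'.comp g) z := by
  induction z using TensorProduct.induction_on with
  | zero => simp
  | tmul a b => rfl
  | add z w hz hw => simp only [map_add, hz, hw]

theorem StarAlgHom.tensor_id {A B : Type}
    [Ring A] [StarRing A] [Algebra ℂ A] [StarModule ℂ A]
    [Ring B] [StarRing B] [Algebra ℂ B] [StarModule ℂ B] (z : A ⊗[ℂ] B) :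
    StarAlgHom.tensor (StarAlgHom.id ℂ A) (StarAlgHom.id ℂ B) z = z := by
  induction z using TensorProduct.induction_on with
  | zero => simp
  | tmul a b => rfl
  | add z w hz hw => simp only [map_add, hz, hw]

theorem UnivStar.hom_ext {X B : Type} {R : Set (StarPoly X)} [Ring B] [StarRing B] [Algebra ℂ B]
    [StarModule ℂ B] {f g : UnivStar R →⋆ₐ[ℂ] B} (h : ∀ x, f (gen R x) = g (gen R x)) : f = g := by
  have hS := UnivStar.eq_top_of_gen_mem (StarAlgHom.equalizer f g) h
  ext a
  exact (hS ▸ StarSubalgebra.mem_top : a ∈ StarAlgHom.equalizer f g)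

namespace QPermGroup

theorem hom_ext (P : QPermGroup) {B : Type} [Ring B] [StarRing B] [Algebra ℂ B] [StarModule ℂ B]
    {f g : P.alg →⋆ₐ[ℂ] B} (h : ∀ i j, f (P.u i j) = g (P.u i j)) : f = g := by
  ext a
  exact P.mem_of_gen (StarAlgHom.equalizer f g) h a

theorem isomorphic_of_inverse {P Q : QPermGroup} (f : P.alg →⋆ₐ[ℂ] Q.alg)
    (g : Q.alg →⋆ₐ[ℂ] P.alg) (hgf : g.comp f = StarAlgHom.id ℂ P.alg)
    (hfg : f.comp g = StarAlgHom.id ℂ Q.alg)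
    (hc : Q.comul.comp f = (StarAlgHom.tensor f f).comp P.comul) : Isomorphic P Q :=
  ⟨StarAlgEquiv.ofStarAlgHom f g hgf hfg, fun a => by
    exact DFunLike.congr_fun hc a⟩

theorem Isomorphic.exists_inverse {P Q : QPermGroup} (h : Isomorphic P Q) :
    ∃ (f : P.alg →⋆ₐ[ℂ] Q.alg) (g : Q.alg →⋆ₐ[ℂ] P.alg), g.comp f = StarAlgHom.id ℂ P.alg ∧
      f.comp g = StarAlgHom.id ℂ Q.alg ∧ Q.comul.comp f = (StarAlgHom.tensor f f).comp P.comul := by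
  obtain ⟨f, hf⟩ := h
  refine ⟨f, f.symm, ?_, ?_, ?_⟩
  · ext a
    exact f.symm_apply_apply a
  · ext a
    exact f.apply_symm_apply a
  · ext a
    exact hf a

theorem Isomorphic.refl (P : QPermGroup) : Isomorphic P P :=
  isomorphic_of_inverse (StarAlgHom.id ℂ _) (StarAlgHom.id ℂ _) rfl rfl (by
    ext a
    exact (StarAlgHom.tensor_id _).symm)

theorem Isomorphic.symm {P Q : QPermGroup} (h : Isomorphic P Q) : Isomorphic Q P := by
  obtain ⟨f, g, hgf, hfg, hc⟩ := h.exists_inverse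
  refine isomorphic_of_inverse g f hfg hgf ?_
  ext b
  have h1 : f (g b) = b := DFunLike.congr_fun hfg b
  have h2 : Q.comul (f (g b)) = StarAlgHom.tensor f f (P.comul (g b)) := DFunLike.congr_fun hc (g b)
  change P.comul (g b) = StarAlgHom.tensor g g (Q.comul b)
  rw [h1] at h2
  rw [h2, StarAlgHom.tensor_tensor, hgf, StarAlgHom.tensor_id]

theorem Isomorphic.trans {P Q R : QPermGroup} (h : Isomorphic P Q) (h' : Isomorphic Q R) :
    Isomorphic P R := by
  obtain ⟨f, g, hgf, hfg, hc⟩ := h.exists_inverse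
  obtain ⟨f', g', hgf', hfg', hc'⟩ := h'.exists_inverse
  refine isomorphic_of_inverse (f'.comp f) (g.comp g') ?_ ?_ ?_
  · ext a
    exact (congrArg g (DFunLike.congr_fun hgf' (f a))).trans (DFunLike.congr_fun hgf a)
  · ext a
    exact (congrArg f' (DFunLike.congr_fun hfg (g' a))).trans (DFunLike.congr_fun hfg' a)
  · ext a
    refine (DFunLike.congr_fun hc' (f a)).trans ?_
    refine (congrArg (StarAlgHom.tensor f' f') (DFunLike.congr_fun hc a)).trans ?_
    exact StarAlgHom.tensor_tensor _ _ _ _ _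

/-- Mutually inverse homomorphisms matching the fundamental representations give an isomorphism. -/
theorem isomorphic_of_u {P Q : QPermGroup} (e : P.idx ≃ Q.idx) (f : P.alg →⋆ₐ[ℂ] Q.alg)
    (g : Q.alg →⋆ₐ[ℂ] P.alg) (hf : ∀ i j, f (P.u i j) = Q.u (e i) (e j))
    (hg : ∀ i j, g (Q.u (e i) (e j)) = P.u i j) : Isomorphic P Q := by
  refine isomorphic_of_inverse f g (P.hom_ext fun i j => ?_) (Q.hom_ext fun i j => ?_)
    (P.hom_ext fun i j => ?_)
  · exact (congrArg g (hf i j)).trans (hg i j)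
  · obtain ⟨i, rfl⟩ := e.surjective i
    obtain ⟨j, rfl⟩ := e.surjective j
    exact (congrArg f (hg i j)).trans (hf i j)
  · change Q.comul (f (P.u i j)) = StarAlgHom.tensor f f (P.comul (P.u i j))
    rw [hf, Q.comul_u, P.comul_u, map_sum, ← e.sum_comp]
    simp only [StarAlgHom.tensor_tmul, hf]

theorem isomorphic_of_isTrivial {P Q : QPermGroup} (hP : P.IsTrivial) (hQ : Q.IsTrivial) :
    Isomorphic P Q := by
  let e := StarAlgEquiv.ofBijective (StarAlgHom.ofId ℂ P.alg) hP
  let e' := StarAlgEquiv.ofBijective (StarAlgHom.ofId ℂ Q.alg) hQ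
  refine ⟨e.symm.trans e', fun a => ?_⟩
  obtain ⟨c, rfl⟩ := hP.2 a
  simp only [AlgHomClass.commutes]

/-! ### Functoriality of the free product and of the wreath product -/

section Free

variable {P Q : QPermGroup} {B : Type} [Ring B] [StarRing B] [Algebra ℂ B] [StarModule ℂ B]

/-- The universal property of the free product. -/
def freeLift (f : P.alg →⋆ₐ[ℂ] B) (g : Q.alg →⋆ₐ[ℂ] B) : UnivStar (freeRel P.alg Q.alg) →⋆ₐ[ℂ] B :=
  UnivStar.lift (Sum.elim f g) (by
    rintro r (hr | hr)
    · exact eval_homRel _ (fun a : P.alg => var (Sum.inl a : P.alg ⊕ Q.alg)) f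
        (fun a => eval_var _ _) r hr
    · exact eval_homRel _ (fun b : Q.alg => var (Sum.inr b : P.alg ⊕ Q.alg)) g
        (fun a => eval_var _ _) r hr)

theorem freeLift_inl (f : P.alg →⋆ₐ[ℂ] B) (g : Q.alg →⋆ₐ[ℂ] B) (a : P.alg) :
    freeLift f g (freeInl P Q a) = f a := UnivStar.lift_gen _ _ _

theorem freeLift_inr (f : P.alg →⋆ₐ[ℂ] B) (g : Q.alg →⋆ₐ[ℂ] B) (b : Q.alg) :
    freeLift f g (freeInr P Q b) = g b := UnivStar.lift_gen _ _ _

theorem free_hom_ext {f g : UnivStar (freeRel P.alg Q.alg) →⋆ₐ[ℂ] B}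
    (hl : ∀ a, f (freeInl P Q a) = g (freeInl P Q a))
    (hr : ∀ b, f (freeInr P Q b) = g (freeInr P Q b)) : f = g :=
  UnivStar.hom_ext (by
    rintro (a | b)
    · exact hl a
    · exact hr b)

/-- Isomorphisms may ignore the fundamental representations, so `isomorphic_of_u` is not available;
compatibility with the comultiplications is checked on all elements of the two factors. -/
theorem Isomorphic.freeProd {P' Q' : QPermGroup} (hP : Isomorphic P P') (hQ : Isomorphic Q Q') :
    Isomorphic (freeProd P Q) (freeProd P' Q') := by
  obtain ⟨f, f', h1, h2, h3⟩ := hP.exists_inverse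
  obtain ⟨g, g', k1, k2, k3⟩ := hQ.exists_inverse
  let M : UnivStar (freeRel P.alg Q.alg) →⋆ₐ[ℂ] UnivStar (freeRel P'.alg Q'.alg) :=
    freeLift ((freeInl P' Q').comp f) ((freeInr P' Q').comp g)
  let M' : UnivStar (freeRel P'.alg Q'.alg) →⋆ₐ[ℂ] UnivStar (freeRel P.alg Q.alg) :=
    freeLift ((freeInl P Q).comp f') ((freeInr P Q).comp g')
  have hMl : ∀ a, M (freeInl P Q a) = freeInl P' Q' (f a) := fun a => freeLift_inl _ _ _
  have hMr : ∀ a, M (freeInr P Q a) = freeInr P' Q' (g a) := fun a => freeLift_inr _ _ _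
  have hMl' : ∀ a, M' (freeInl P' Q' a) = freeInl P Q (f' a) := fun a => freeLift_inl _ _ _
  have hMr' : ∀ a, M' (freeInr P' Q' a) = freeInr P Q (g' a) := fun a => freeLift_inr _ _ _
  refine isomorphic_of_inverse (P := QPermGroup.freeProd P Q) (Q := QPermGroup.freeProd P' Q') M M'
    (free_hom_ext (fun a => ?_) fun b => ?_) (free_hom_ext (fun a => ?_) fun b => ?_)
    (free_hom_ext (fun a => ?_) fun b => ?_)
  · exact (congrArg M' (hMl a)).trans ((hMl' _).trans
      (congrArg (freeInl P Q) (DFunLike.congr_fun h1 a)))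
  · exact (congrArg M' (hMr b)).trans ((hMr' _).trans
      (congrArg (freeInr P Q) (DFunLike.congr_fun k1 b)))
  · exact (congrArg M (hMl' a)).trans ((hMl _).trans
      (congrArg (freeInl P' Q') (DFunLike.congr_fun h2 a)))
  · exact (congrArg M (hMr' b)).trans ((hMr _).trans
      (congrArg (freeInr P' Q') (DFunLike.congr_fun k2 b)))
  · change freeComul P' Q' (M (freeInl P Q a)) =
      StarAlgHom.tensor M M (freeComul P Q (freeInl P Q a))
    have h3a : P'.comul (f a) = StarAlgHom.tensor f f (P.comul a) := DFunLike.congr_fun h3 a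
    have hM : M.comp (freeInl P Q) = (freeInl P' Q').comp f := by
      ext a
      exact hMl a
    rw [hMl, freeComul_inl, freeComul_inl, h3a, StarAlgHom.tensor_tensor,
      StarAlgHom.tensor_tensor, hM]
  · change freeComul P' Q' (M (freeInr P Q b)) =
      StarAlgHom.tensor M M (freeComul P Q (freeInr P Q b))
    have k3b : Q'.comul (g b) = StarAlgHom.tensor g g (Q.comul b) := DFunLike.congr_fun k3 b
    have hM : M.comp (freeInr P Q) = (freeInr P' Q').comp g := by
      ext a
      exact hMr a
    rw [hMr, freeComul_inr, freeComul_inr, k3b, StarAlgHom.tensor_tensor,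
      StarAlgHom.tensor_tensor, hM]

end Free

section WreathMap

variable {P : QPermGroup} {n : ℕ} {B : Type} [Ring B] [StarRing B] [Algebra ℂ B] [StarModule ℂ B]

/-- The universal property of the wreath product. -/
def wreathLift (ν : Fin n → P.alg →⋆ₐ[ℂ] B) (s : (symm n).alg →⋆ₐ[ℂ] B)
    (hc : ∀ i j a, ν i a * s (symmU n i j) = s (symmU n i j) * ν i a) :
    UnivStar (wreathRel P n) →⋆ₐ[ℂ] B :=
  UnivStar.lift (Sum.elim (fun x => ν x.1 x.2) s) (by
    rintro r ((hr | hr) | ⟨i, j, a, rfl⟩)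
    · obtain ⟨i, hr⟩ := Set.mem_iUnion.1 hr
      exact eval_homRel _ (fun a : P.alg => var (Sum.inl (i, a) : WreathGen P n)) (ν i)
        (fun a => eval_var _ _) r hr
    · exact eval_homRel _ (fun s : (symm n).alg => var (Sum.inr s : WreathGen P n)) s
        (fun a => eval_var _ _) r hr
    · rw [map_sub, map_mul, map_mul, eval_var, eval_var, Sum.elim_inl, Sum.elim_inr, hc, sub_self])

theorem wreathLift_nu (ν : Fin n → P.alg →⋆ₐ[ℂ] B) (s : (symm n).alg →⋆ₐ[ℂ] B)
    (hc : ∀ i j a, ν i a * s (symmU n i j) = s (symmU n i j) * ν i a) (i : Fin n) (a : P.alg) :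
    wreathLift ν s hc (wreathNu P n i a) = ν i a := UnivStar.lift_gen _ _ _

theorem wreathLift_S (ν : Fin n → P.alg →⋆ₐ[ℂ] B) (s : (symm n).alg →⋆ₐ[ℂ] B)
    (hc : ∀ i j a, ν i a * s (symmU n i j) = s (symmU n i j) * ν i a) (a : (symm n).alg) :
    wreathLift ν s hc (wreathS P n a) = s a := UnivStar.lift_gen _ _ _

theorem wreath_hom_ext {f g : UnivStar (wreathRel P n) →⋆ₐ[ℂ] B}
    (hν : ∀ i a, f (wreathNu P n i a) = g (wreathNu P n i a))
    (hs : ∀ s, f (wreathS P n s) = g (wreathS P n s)) : f = g :=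
  UnivStar.hom_ext (by
    rintro (⟨i, a⟩ | s)
    · exact hν i a
    · exact hs s)

theorem wreathComul_S (s : (symm n).alg) : wreathComul P n (wreathS P n s) =
    StarAlgHom.tensor (wreathS P n) (wreathS P n) ((symm n).comul s) := UnivStar.lift_gen _ _ _

/-- The wreath product depends only on the Hopf algebra: the comultiplication of `ν_i(a)` is
expressed by `P.comul a` and the `p_{ij}`, without the matrix `P.u`. -/
theorem Isomorphic.wreath {P' : QPermGroup} [Nonempty P.idx] [Nonempty P'.idx]
    (hP : Isomorphic P P') (n : ℕ) : Isomorphic (wreath P n) (wreath P' n) := by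
  obtain ⟨f, f', h1, h2, h3⟩ := hP.exists_inverse
  let M : UnivStar (wreathRel P n) →⋆ₐ[ℂ] UnivStar (wreathRel P' n) :=
    wreathLift (fun i => (wreathNu P' n i).comp f) (wreathS P' n)
      fun i j a => wreath_comm P' n i j (f a)
  let M' : UnivStar (wreathRel P' n) →⋆ₐ[ℂ] UnivStar (wreathRel P n) :=
    wreathLift (fun i => (wreathNu P n i).comp f') (wreathS P n)
      fun i j a => wreath_comm P n i j (f' a)
  have hν : ∀ i a, M (wreathNu P n i a) = wreathNu P' n i (f a) := fun i a =>
    wreathLift_nu _ _ _ i a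
  have hS : ∀ s, M (wreathS P n s) = wreathS P' n s := fun s => wreathLift_S _ _ _ s
  have hν' : ∀ i a, M' (wreathNu P' n i a) = wreathNu P n i (f' a) := fun i a =>
    wreathLift_nu _ _ _ i a
  have hS' : ∀ s, M' (wreathS P' n s) = wreathS P n s := fun s => wreathLift_S _ _ _ s
  refine isomorphic_of_inverse (P := QPermGroup.wreath P n) (Q := QPermGroup.wreath P' n) M M'
    (wreath_hom_ext (fun i a => ?_) fun b => ?_) (wreath_hom_ext (fun i a => ?_) fun b => ?_)
    (wreath_hom_ext (fun i a => ?_) fun b => ?_)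
  · exact (congrArg M' (hν i a)).trans ((hν' _ _).trans
      (congrArg (wreathNu P n i) (DFunLike.congr_fun h1 a)))
  · exact (congrArg M' (hS b)).trans (hS' b)
  · exact (congrArg M (hν' i a)).trans ((hν _ _).trans
      (congrArg (wreathNu P' n i) (DFunLike.congr_fun h2 a)))
  · exact (congrArg M (hS' b)).trans (hS b)
  · change wreathComul P' n (M (wreathNu P n i a)) =
      StarAlgHom.tensor M M (wreathComul P n (wreathNu P n i a))
    have h3a : P'.comul (f a) = StarAlgHom.tensor f f (P.comul a) := DFunLike.congr_fun h3 a
    have hM : ∀ i, M.comp (wreathNu P n i) = (wreathNu P' n i).comp f := fun i => by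
      ext a
      exact hν i a
    rw [hν, wreathComul_nu, wreathComul_nu, wreathComulNu_apply, wreathComulNu_apply, map_sum]
    refine Finset.sum_congr rfl fun j _ => ?_
    rw [map_mul, StarAlgHom.tensor_tensor, StarAlgHom.tensor_tmul, map_one, h3a,
      StarAlgHom.tensor_tensor, hM, hM, wreathP, wreathP, hS]
  · change wreathComul P' n (M (wreathS P n b)) =
      StarAlgHom.tensor M M (wreathComul P n (wreathS P n b))
    have hM : M.comp (wreathS P n) = wreathS P' n := by
      ext a
      exact hS a
    rw [hS, wreathComul_S, wreathComul_S, StarAlgHom.tensor_tensor, hM]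

end WreathMap

end QPermGroup

/-! ### Quantum automorphism groups of complements, sums and copies -/

namespace FinGraph
open QPermGroup (Isomorphic freeProd freeInl freeInr freeLift freeLift_inl freeLift_inr)

theorem quU_star (G : FinGraph) (x y : G.V) : star (G.qu.u x y) = G.qu.u x y :=
  G.qu.magic.star_eq x y

theorem Iso.qu {G H : FinGraph} (h : Iso G H) : Isomorphic G.qu H.qu := by
  obtain ⟨φ⟩ := h
  have h1 := (quU_adjMagic H).comp_iso φ φ
  have h2 := (quU_adjMagic G).comp_iso φ.symm φ.symm
  refine QPermGroup.isomorphic_of_u (P := G.qu) (Q := H.qu) φ.toEquiv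
    (quLift _ h1 fun _ _ => quU_star H _ _) (quLift _ h2 fun _ _ => quU_star G _ _)
    (fun x y => quLift_u _ h1 _ x y) fun x y => ?_
  refine (quLift_u _ h2 _ (φ x) (φ y)).trans ?_
  exact congrArg₂ _ (φ.symm_apply_apply x) (φ.symm_apply_apply y)

theorem qu_compl (G : FinGraph) : Isomorphic G.compl.qu G.qu := by
  have h1 : AdjMagic G.compl G.compl 1 (fun x y : G.V => G.qu.u x y) := (quU_adjMagic G).compl
  have h2 : AdjMagic G G 1 (fun x y : G.V => G.compl.qu.u x y) :=
    (quU_adjMagic G.compl).compl.comp_iso (complComplIso G) (complComplIso G)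
  exact QPermGroup.isomorphic_of_u (P := G.compl.qu) (Q := G.qu) (Equiv.refl _)
    (quLift _ h1 fun _ _ => quU_star G _ _) (quLift _ h2 fun _ _ => quU_star G.compl _ _)
    (fun x y => quLift_u _ h1 _ x y) fun x y => quLift_u _ h2 _ x y

theorem isTrivial_qu_of_card_le_one {G : FinGraph} (h : Fintype.card G.V ≤ 1) :
    G.qu.IsTrivial :=
  isTrivial_of_support fun _ j p _ _ => Fintype.card_le_one_iff.1 h j p

/-- The quantum automorphism group of a sum without mixing is the free product. -/
theorem isomorphic_sum {G H : FinGraph}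
    (hoff : ∀ x y, (G.sum H).qu.u (Sum.inl x) (Sum.inr y) = 0 ∧
      (G.sum H).qu.u (Sum.inr y) (Sum.inl x) = 0) :
    Isomorphic (G.sum H).qu (freeProd G.qu H.qu) := by
  have hm := (freeProd G.qu H.qu).magic
  have hv : AdjMagic (G.sum H) (G.sum H) (1 : (freeProd G.qu H.qu).alg)
      (fun x y : G.V ⊕ H.V => (freeProd G.qu H.qu).u x y) := by
    refine ⟨hm.idem, hm.row_sum, hm.col_sum, hm.row_orth, fun x x' y => hm.col_orth x y x', ?_⟩
    have e1 : ∀ x y, (freeProd G.qu H.qu).u (Sum.inl x) (Sum.inl y) =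
        freeInl G.qu H.qu (G.qu.u x y) := fun _ _ => rfl
    have e2 : ∀ x y, (freeProd G.qu H.qu).u (Sum.inr x) (Sum.inr y) =
        freeInr G.qu H.qu (H.qu.u x y) := fun _ _ => rfl
    have e3 : ∀ x y, (freeProd G.qu H.qu).u (Sum.inl x) (Sum.inr y) = 0 := fun _ _ => rfl
    have e4 : ∀ x y, (freeProd G.qu H.qu).u (Sum.inr x) (Sum.inl y) = 0 := fun _ _ => rfl
    -- Off-diagonal factors are zero. Where both factors are diagonal but from different blocks,
    -- neither pair of vertices is adjacent, so `hn` fails.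
    rintro (x | x) (x' | x') (y | y) (y' | y') hn
    · exact (map_mul (freeInl G.qu H.qu) _ _).symm.trans
        ((congrArg _ ((quU_adjMagic G).adj x x' y y' hn)).trans (map_zero _))
    · exact (congrArg _ (e3 x' y')).trans (mul_zero _)
    · exact (congrArg (· * _) (e3 x y)).trans (zero_mul _)
    · exact (congrArg (· * _) (e3 x y)).trans (zero_mul _)
    · exact (congrArg _ (e4 x' y')).trans (mul_zero _)
    · exact absurd Iff.rfl hn
    · exact (congrArg (· * _) (e3 x y)).trans (zero_mul _)
    · exact (congrArg (· * _) (e3 x y)).trans (zero_mul _)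
    · exact (congrArg (· * _) (e4 x y)).trans (zero_mul _)
    · exact (congrArg (· * _) (e4 x y)).trans (zero_mul _)
    · exact absurd Iff.rfl hn
    · exact (congrArg _ (e3 x' y')).trans (mul_zero _)
    · exact (congrArg (· * _) (e4 x y)).trans (zero_mul _)
    · exact (congrArg (· * _) (e4 x y)).trans (zero_mul _)
    · exact (congrArg _ (e4 x' y')).trans (mul_zero _)
    · exact (map_mul (freeInr G.qu H.qu) _ _).symm.trans
        ((congrArg _ ((quU_adjMagic H).adj x x' y y' hn)).trans (map_zero _))
  have hU := quU_adjMagic (G.sum H)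
  have hsum : ∀ f : G.V ⊕ H.V → (G.sum H).qu.alg,
      ∑ z, f z = ∑ x, f (Sum.inl x) + ∑ y, f (Sum.inr y) := fun f => Fintype.sum_sum_type f
  -- Once the off-diagonal blocks vanish, each diagonal block is magic with unit `1` and receives a
  -- homomorphism from its own quantum group.
  have hl : AdjMagic G G 1 (fun x y => (G.sum H).qu.u (Sum.inl x) (Sum.inl y)) := by
    refine ⟨fun x y => hU.idem _ _, fun x => ?_, fun y => ?_,
      fun x y y' hy => hU.row_orth _ _ _ fun h => hy (Sum.inl_injective h),
      fun x x' y hx => hU.col_orth _ _ _ fun h => hx (Sum.inl_injective h),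
      fun x x' y y' hn => hU.adj _ _ _ _ hn⟩
    · rw [← hU.row_sum (Sum.inl x)]
      refine Eq.trans ?_ (hsum _).symm
      simp [(hoff _ _).1]
    · rw [← hU.col_sum (Sum.inl y)]
      refine Eq.trans ?_ (hsum _).symm
      simp [(hoff _ _).2]
  have hr : AdjMagic H H 1 (fun x y => (G.sum H).qu.u (Sum.inr x) (Sum.inr y)) := by
    refine ⟨fun x y => hU.idem _ _, fun x => ?_, fun y => ?_,
      fun x y y' hy => hU.row_orth _ _ _ fun h => hy (Sum.inr_injective h),
      fun x x' y hx => hU.col_orth _ _ _ fun h => hx (Sum.inr_injective h),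
      fun x x' y y' hn => hU.adj _ _ _ _ hn⟩
    · rw [← hU.row_sum (Sum.inr x)]
      refine Eq.trans ?_ (hsum _).symm
      simp [(hoff _ _).2]
    · rw [← hU.col_sum (Sum.inr y)]
      refine Eq.trans ?_ (hsum _).symm
      simp [(hoff _ _).1]
  let g : (freeProd G.qu H.qu).alg →⋆ₐ[ℂ] (G.sum H).qu.alg :=
    freeLift (P := G.qu) (Q := H.qu) (quLift _ hl fun _ _ => quU_star (G.sum H) _ _)
      (quLift _ hr fun _ _ => quU_star (G.sum H) _ _)
  refine QPermGroup.isomorphic_of_u (P := (G.sum H).qu) (Q := freeProd G.qu H.qu) (Equiv.refl _)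
    (quLift _ hv fun x y => (freeProd G.qu H.qu).magic.star_eq x y) g
    (fun x y => quLift_u _ hv _ x y) ?_
  rintro (x | x) (y | y)
  · exact (freeLift_inl _ _ _).trans (quLift_u _ hl _ x y)
  · exact (map_zero g).trans (hoff x y).1.symm
  · exact (map_zero g).trans (hoff y x).2.symm
  · exact (freeLift_inr _ _ _).trans (quLift_u _ hr _ x y)

/-- The disjoint union of `n` copies of a graph. -/
def copies (n : ℕ) (C : FinGraph) : FinGraph where
  V := Fin n × C.V
  graph :=
    { Adj := fun x y => x.1 = y.1 ∧ C.graph.Adj x.2 y.2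
      symm := ⟨fun _ _ h => ⟨h.1.symm, h.2.symm⟩⟩
      loopless := ⟨fun _ h => h.2.ne rfl⟩ }

theorem reachable_copies_iff {n : ℕ} {C : FinGraph} (hC : C.graph.Preconnected)
    (x y : Fin n × C.V) : (copies n C).graph.Reachable x y ↔ x.1 = y.1 := by
  constructor
  · rintro ⟨w⟩
    induction w with
    | nil => rfl
    | cons h _ ih => exact h.1.trans ih
  · obtain ⟨i, x⟩ := x
    obtain ⟨j, y⟩ := y
    rintro rfl
    let f : C.graph →g (copies n C).graph := ⟨fun z => (i, z), fun h => ⟨rfl, h⟩⟩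
    exact (hC x y).map f

/-- The universal property of `S_n⁺`. -/
def symmLift {n : ℕ} {B : Type} [Ring B] [StarRing B] [Algebra ℂ B] [StarModule ℂ B]
    {v : Matrix (Fin n) (Fin n) B} (hv : IsMagic v) : (QPermGroup.symm n).alg →⋆ₐ[ℂ] B :=
  UnivStar.lift (R := magicRel (Fin n) ∪ ∅) (fun x : Fin n × Fin n => v x.1 x.2) (by
    rintro r (hr | hr)
    · exact (isMagic_iff_eval _).1 hv r hr
    · exact hr.elim)

theorem symmLift_u {n : ℕ} {B : Type} [Ring B] [StarRing B] [Algebra ℂ B] [StarModule ℂ B]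
    {v : Matrix (Fin n) (Fin n) B} (hv : IsMagic v) (i j : Fin n) :
    symmLift hv (QPermGroup.symmU n i j) = v i j :=
  UnivStar.lift_gen (R := magicRel (Fin n) ∪ ∅) _ _ (i, j)

/-- The quantum automorphism group of a disjoint union of copies of a connected graph is a wreath
product. -/
theorem isomorphic_copies {C : FinGraph} (hC : C.graph.Preconnected) [hne : Nonempty C.qu.idx]
    (n : ℕ) : Isomorphic (copies n C).qu (QPermGroup.wreath C.qu n) := by
  classical
  have hm := (QPermGroup.wreath C.qu n).magic
  have hp := QPermGroup.wreathP_magic C.qu n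
  have hv : AdjMagic (copies n C) (copies n C) (1 : (QPermGroup.wreath C.qu n).alg)
      (fun x y : Fin n × C.V => (QPermGroup.wreath C.qu n).u x y) := by
    refine ⟨hm.idem, hm.row_sum, hm.col_sum, hm.row_orth, fun x x' y => hm.col_orth x y x', ?_⟩
    rintro ⟨i, k⟩ ⟨i', k'⟩ ⟨j, l⟩ ⟨j', l'⟩ hn
    change ¬ ((i = i' ∧ C.graph.Adj k k') ↔ (j = j' ∧ C.graph.Adj l l')) at hn
    change QPermGroup.wreathNu C.qu n i (C.qu.u k l) * QPermGroup.wreathP C.qu n i j *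
      (QPermGroup.wreathNu C.qu n i' (C.qu.u k' l') * QPermGroup.wreathP C.qu n i' j') = 0
    by_cases hi : i = i'
    · subst hi
      rw [QPermGroup.wreath_u_row_mul]
      by_cases hj : j = j'
      · subst hj
        have h0 : C.qu.u k l * C.qu.u k' l' = 0 :=
          (quU_adjMagic C).adj k k' l l' fun h => hn (and_congr (iff_of_true rfl rfl) h)
        rw [h0, map_zero, zero_mul]
      · rw [show QPermGroup.wreathP C.qu n i j * QPermGroup.wreathP C.qu n i j' = 0 from
          hp.row_orth i j j' hj, mul_zero]
    · have hj : j = j' := by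
        by_contra hj
        exact hn (iff_of_false (fun h => hi h.1) fun h => hj h.1)
      subst hj
      rw [QPermGroup.wreath_comm C.qu n i', mul_assoc, ← mul_assoc (QPermGroup.wreathP C.qu n i j),
        show QPermGroup.wreathP C.qu n i j * QPermGroup.wreathP C.qu n i' j = 0 from
          hp.col_orth i j i' hi, zero_mul, mul_zero]
  let U : Fin n × C.V → Fin n × C.V → (copies n C).qu.alg := fun x y => (copies n C).qu.u x y
  have hU : AdjMagic (copies n C) (copies n C) 1 U := quU_adjMagic (copies n C)
  have hUs : ∀ x y, star (U x y) = U x y := quU_star (copies n C)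
  let c : (copies n C).V → Fin n := Prod.fst
  have hb : ∀ x x' y y', ¬ (c x = c x' ↔ c y = c y') → U x y * U x' y' = 0 := by
    intro x x' y y' hn
    refine hU.mul_eq_zero_of_not_reachable_iff fun h => hn ?_
    exact (reachable_copies_iff hC x x').symm.trans (h.trans (reachable_copies_iff hC y y'))
  have hne' : Nonempty C.V := hne
  obtain ⟨k₀⟩ := hne'
  -- This is the block unit, to become the `p_{ij}` of `S_n⁺`: copy `i` is matched with copy `j`.
  -- The choice of `k₀` is immaterial, by `hp1`.
  let p : Fin n → Fin n → (copies n C).qu.alg := fun i j => ∑ l, U (i, k₀) (j, l)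
  have hfib : ∀ (f : Fin n × C.V → (copies n C).qu.alg) (j : Fin n)
      [DecidablePred fun y : Fin n × C.V => y.1 = j], (∑ y, if y.1 = j then f y else 0) = ∑ l, f (j, l) := by
    intro f j _
    rw [Fintype.sum_prod_type, Finset.sum_eq_single j]
    · simp
    · intro b _ hb
      simp [hb]
    · simp
  have hblk : ∀ x j, AdjMagic.blockUnit (G := copies n C) (H := copies n C) U c x j =
      ∑ l, U x (j, l) := fun x j => @hfib (U x) j fun _ => Classical.propDecidable _
  have hp1 : ∀ i j k, ∑ l, U (i, k) (j, l) = p i j := fun i j k =>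
    (hblk (i, k) j).symm.trans
      ((hU.blockUnit_eq hb (x := (i, k)) (x' := (i, k₀)) rfl j).trans (hblk _ j))
  have hp2 : ∀ i j l, ∑ k, U (i, k) (j, l) = p i j := fun i j l =>
    (@hfib (fun x => U x (j, l)) i fun _ => Classical.propDecidable _).symm.trans
      ((hU.blockUnit_eq_sum_col hb (i, k₀) (j, l)).symm.trans (hblk _ j))
  have hrow : ∀ x, ∑ j, ∑ l, U x (j, l) = 1 := fun x =>
    (Fintype.sum_prod_type _).symm.trans (hU.row_sum x)
  have hcol : ∀ y, ∑ i, ∑ k, U (i, k) y = 1 := fun y =>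
    (Fintype.sum_prod_type fun x => U x y).symm.trans (hU.col_sum y)
  have hpm : IsMagic (Matrix.of p) := by
    refine ⟨fun i j => ?_, fun i j => ?_, fun i => hrow _, fun j => ?_, fun i j j' hj => ?_,
      fun i j i' hi => ?_⟩
    · exact (star_sum _ _).trans (Finset.sum_congr rfl fun l _ => hUs _ _)
    · change p i j * p i j = p i j
      refine (Finset.sum_mul_sum _ _ _ _).trans (Finset.sum_congr rfl fun l _ => ?_)
      rw [Finset.sum_eq_single l]
      · exact hU.idem _ _
      · intro l' _ hl
        exact hU.row_orth _ _ _ fun h => hl (Prod.ext_iff.1 h).2.symm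
      · simp
    · refine Eq.trans (Finset.sum_congr rfl fun i _ => ?_) (hcol (j, k₀))
      exact (hp2 i j k₀).symm
    · refine (Finset.sum_mul_sum _ _ _ _).trans ?_
      refine Finset.sum_eq_zero fun l _ => Finset.sum_eq_zero fun l' _ => ?_
      exact hU.row_orth _ _ _ fun h => hj (Prod.ext_iff.1 h).1
    · change p i j * p i' j = 0
      rw [← hp2 i j k₀, ← hp2 i' j k₀]
      refine (Finset.sum_mul_sum _ _ _ _).trans ?_
      refine Finset.sum_eq_zero fun l _ => Finset.sum_eq_zero fun l' _ => ?_
      exact hU.col_orth _ _ _ fun h => hi (Prod.ext_iff.1 h).1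
  -- The future `ν_i(u_{kl})`: summing `ν_i(u_{kl}) p_{ij}` over `j` forgets the copy and keeps the
  -- position in it.
  let N : Fin n → C.V → C.V → (copies n C).qu.alg := fun i k l => ∑ j, U (i, k) (j, l)
  have hN : ∀ i, AdjMagic C C 1 (N i) := by
    intro i
    have zero : ∀ k k' l l', (∀ j, U (i, k) (j, l) * U (i, k') (j, l') = 0) →
        N i k l * N i k' l' = 0 := by
      intro k k' l l' h
      refine (Finset.sum_mul_sum _ _ _ _).trans ?_
      refine Finset.sum_eq_zero fun j _ => Finset.sum_eq_zero fun j' _ => ?_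
      by_cases hj : j = j'
      · rw [← hj]
        exact h j
      · exact hb (i, k) (i, k') (j, l) (j', l') fun hi => hj (hi.1 rfl)
    refine ⟨fun k l => ?_, fun k => ?_, fun l => ?_, fun k l l' hl => zero _ _ _ _ fun j => ?_,
      fun k k' l hk => zero _ _ _ _ fun j => ?_, fun k k' l l' hn => zero _ _ _ _ fun j => ?_⟩
    · refine (Finset.sum_mul_sum _ _ _ _).trans (Finset.sum_congr rfl fun j _ => ?_)
      rw [Finset.sum_eq_single j]
      · exact hU.idem _ _
      · intro j' _ hj
        exact hU.row_orth _ _ _ fun h => hj (Prod.ext_iff.1 h).1.symm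
      · simp
    · exact Finset.sum_comm.trans (hrow (i, k))
    · refine Finset.sum_comm.trans (Eq.trans (Finset.sum_congr rfl fun j _ => ?_) (hpm.row_sum i))
      exact hp2 i j l
    · exact hU.row_orth _ _ _ fun h => hl (Prod.ext_iff.1 h).2
    · exact hU.col_orth _ _ _ fun h => hk (Prod.ext_iff.1 h).2
    · refine hU.adj _ _ _ _ fun h => hn ?_
      change (i = i ∧ C.graph.Adj k k') ↔ (j = j ∧ C.graph.Adj l l') at h
      simpa using h
  have hNs : ∀ i k l, star (N i k l) = N i k l := fun i k l =>
    (star_sum _ _).trans (Finset.sum_congr rfl fun j _ => hUs _ _)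
  have hNp : ∀ i j k l, N i k l * p i j = U (i, k) (j, l) := by
    intro i j k l
    rw [← hp1 i j k]
    refine (Finset.sum_mul_sum _ _ _ _).trans ?_
    rw [Finset.sum_eq_single j, Finset.sum_eq_single l]
    · exact hU.idem _ _
    · intro l' _ hl
      exact hU.row_orth _ _ _ fun h => hl (Prod.ext_iff.1 h).2.symm
    · simp
    · intro j' _ hj
      exact Finset.sum_eq_zero fun l' _ => hU.row_orth _ _ _ fun h => hj (Prod.ext_iff.1 h).1
    · simp
  -- Taking adjoints in `hNp` reverses the product, so `N i k l` and `p i j` commute.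
  have hpN : ∀ i j k l, p i j * N i k l = U (i, k) (j, l) := by
    intro i j k l
    rw [← hUs, ← hNp i j k l, star_mul, hNs, show star (p i j) = p i j from hpm.star_eq i j]
  let ν : Fin n → C.qu.alg →⋆ₐ[ℂ] (copies n C).qu.alg := fun i => quLift (N i) (hN i) (hNs i)
  have hν : ∀ i k l, ν i (C.qu.u k l) = N i k l := fun i k l => quLift_u _ _ _ k l
  have hcomm : ∀ i j a, ν i a * symmLift hpm (QPermGroup.symmU n i j) =
      symmLift hpm (QPermGroup.symmU n i j) * ν i a := by
    intro i j a
    rw [symmLift_u]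
    have := C.qu.map_mem_of_gen (ν i) (StarSubalgebra.centralizer ℂ {p i j}) (fun k l => by
      rw [StarSubalgebra.mem_centralizer_iff]
      rintro _ rfl
      rw [show star (p i j) = p i j from hpm.star_eq i j, hν i k l, and_self]
      exact (hpN i j k l).trans (hNp i j k l).symm) a
    rw [StarSubalgebra.mem_centralizer_iff] at this
    exact (this _ rfl).1.symm
  let g : (QPermGroup.wreath C.qu n).alg →⋆ₐ[ℂ] (copies n C).qu.alg :=
    QPermGroup.wreathLift ν (symmLift hpm) hcomm
  refine QPermGroup.isomorphic_of_u (P := (copies n C).qu) (Q := QPermGroup.wreath C.qu n)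
    (Equiv.refl _) (quLift _ hv fun x y => hm.star_eq x y) g (fun x y => quLift_u _ hv _ x y) ?_
  rintro ⟨i, k⟩ ⟨j, l⟩
  refine (map_mul g _ _).trans ?_
  refine (congrArg₂ _ (QPermGroup.wreathLift_nu ν (symmLift hpm) hcomm i _)
    (QPermGroup.wreathLift_S ν (symmLift hpm) hcomm _)).trans ?_
  rw [symmLift_u]
  exact (congrArg (· * p i j) (hν i k l)).trans (hNp i j k l)

end FinGraph

namespace FinGraph
open QPermGroup (Isomorphic freeProd Jor)

/-! ### Decomposition into isotypic parts -/

theorem iso_ind_sum_ind_compl {G : FinGraph} (S : Set G.V)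
    (hS : ∀ x y, G.graph.Adj x y → (x ∈ S ↔ y ∈ S)) :
    ∃ φ : ((G.ind S).sum (G.ind Sᶜ)).graph ≃g G.graph,
      (∀ x : S, φ (Sum.inl x) = x.1) ∧ ∀ y : (Sᶜ : Set G.V), φ (Sum.inr y) = y.1 := by
  classical
  refine ⟨⟨Equiv.Set.sumCompl S, fun {x y} => ?_⟩, fun _ => rfl, fun _ => rfl⟩
  rcases x with x | x <;> rcases y with y | y
  · exact Iff.rfl
  · exact iff_of_false (fun h => y.2 ((hS _ _ h).1 x.2)) Bool.false_ne_true
  · exact iff_of_false (fun h => x.2 ((hS _ _ h).2 y.2)) Bool.false_ne_true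
  · exact Iff.rfl

/-- The induced subgraph on the component of `y`. -/
abbrev component (G : FinGraph) (y : G.V) : FinGraph :=
  G.ind {z | G.graph.connectedComponentMk z = G.graph.connectedComponentMk y}

theorem component_preconnected (G : FinGraph) (y : G.V) : (G.component y).graph.Preconnected :=
  (G.graph.connectedComponentMk y).connected_toSimpleGraph.preconnected

theorem component_eq_of_adj {G : FinGraph} {x y : G.V} (h : G.graph.Adj x y) :
    G.component x = G.component y := by
  rw [component, component, SimpleGraph.ConnectedComponent.eq.2 h.reachable]

/-- Restrict to the components of `x` and `y`; the unit is nonzero there, so rigidity of the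
component applies. -/
theorem AdjMagic.iso_component {A : Type} [Ring A] [Algebra ℂ A] {G H : FinGraph} {e : A}
    {P : H.V → G.V → A} (h : AdjMagic G H e P) (hG : ∀ y, Rigid (G.component y)) {x : H.V} {y : G.V}
    (hxy : P x y ≠ 0) : Iso (G.component y) (H.component x) :=
  (hG y A _ _ _ (h.block (c := G.graph.connectedComponentMk) (d := H.graph.connectedComponentMk)
    (fun x x' y y' hn => h.mul_eq_zero_of_not_reachable_iff fun hi => hn (by
      rw [SimpleGraph.ConnectedComponent.eq, SimpleGraph.ConnectedComponent.eq, hi])) x y)).1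
    (h.blockUnit_ne_zero hxy)

/-- The vertices whose component is isomorphic to `C` span a disjoint union of copies of `C`. -/
theorem exists_iso_copies {G : FinGraph} (y : G.V) :
    ∃ m, 1 ≤ m ∧ Iso (copies m (G.component y))
      (G.ind {z | Iso (G.component z) (G.component y)}) := by
  set C := G.component y with hC
  let J := {j : G.graph.ConnectedComponent //
    Iso (G.ind {z | G.graph.connectedComponentMk z = j}) C}
  let S : Set G.V := {z | Iso (G.component z) C}
  have : Nonempty J := ⟨⟨G.graph.connectedComponentMk y, Iso.refl _⟩⟩
  refine ⟨Nat.card J, Nat.card_pos, ?_⟩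
  let c : (G.ind S).V → J := fun s => ⟨G.graph.connectedComponentMk s.1, s.2⟩
  refine Iso.glue (G := G.ind S) (H := copies (Nat.card J) C) c Prod.fst (fun s t h => ?_)
    (fun s t h => h.1) (Finite.equivFin J).symm fun k => ?_
  · exact Subtype.ext (SimpleGraph.ConnectedComponent.eq.2
      (show G.graph.Adj s.1 t.1 from h).reachable)
  · set j := (Finite.equivFin J).symm k
    have h1 : Iso ((copies (Nat.card J) C).ind {x | x.1 = k}) C :=
      ⟨⟨⟨fun x => x.1.2, fun z => ⟨(k, z), rfl⟩, by
          rintro ⟨⟨i, z⟩, rfl⟩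
          rfl, fun _ => rfl⟩, by
        rintro ⟨⟨i, z⟩, rfl⟩ ⟨⟨i', z'⟩, h⟩
        obtain rfl : i' = i := h
        exact ⟨fun h => ⟨rfl, h⟩, fun h => h.2⟩⟩⟩
    have h2 : Iso (G.ind {z | G.graph.connectedComponentMk z = j.1}) ((G.ind S).ind {s | c s = j}) := by
      have hmem : ∀ w, G.graph.connectedComponentMk w = j.1 → w ∈ S := fun w hw => by
        change Iso (G.component w) C
        rw [component, hw]
        exact j.2
      exact ⟨⟨⟨fun w => ⟨⟨w.1, hmem w.1 w.2⟩, Subtype.ext w.2⟩,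
        fun s => ⟨s.1.1, congrArg Subtype.val s.2⟩, fun _ => rfl, fun _ => rfl⟩, Iff.rfl⟩⟩
    exact h1.trans (j.2.symm.trans h2)

/-- The isotypic part of a component `C` contributes a wreath product, and the rest is a free
factor, since a nonzero entry would join isomorphic components. Taking the whole isotypic part at
once is what rules out mixing. The rest may be empty, and it is always smaller, as it misses `y`. -/
theorem jor_qu_of_not_preconnected {G : FinGraph} (hG : Co (upTo 5) G)
    (hc : ¬ G.graph.Preconnected)
    (ih : ∀ G' : FinGraph, Fintype.card G'.V < Fintype.card G.V → Co (upTo 5) G' →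
      Jor (quFamily (upTo 5)) G'.qu) : Jor (quFamily (upTo 5)) G.qu := by
  obtain ⟨y⟩ : Nonempty G.V := by
    by_contra hn
    rw [not_nonempty_iff] at hn
    exact hc fun x => hn.elim x
  have hrigid : ∀ z, Rigid (G.component z) := fun z => rigid_of_co _ rfl (hG.ind _)
  have hne : Nonempty (G.component y).qu.idx := ⟨⟨y, rfl⟩⟩
  set S : Set G.V := {z | Iso (G.component z) (G.component y)} with hS
  obtain ⟨φ, hl, hr⟩ := iso_ind_sum_ind_compl S fun x z h => by
    change Iso _ _ ↔ Iso _ _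
    rw [component_eq_of_adj h]
  obtain ⟨z, hz⟩ := exists_component_ne hc y
  have h1 : Jor (quFamily (upTo 5)) (G.ind S).qu := by
    obtain ⟨m, hm, f⟩ := exists_iso_copies y
    -- The induction is applied to the component and not to its isotypic part, which may be all of
    -- `G`.
    have h0 := ih (G.component y) (card_ind_lt G _ (x := z) hz) (hG.ind _)
    exact ((h0.wreath m hm).iso (isomorphic_copies (component_preconnected G y) m).symm).iso f.qu
  have h2 : Jor (quFamily (upTo 5)) (G.ind Sᶜ).qu :=
    ih _ (card_ind_lt G _ (x := y) fun h => h (Iso.refl _)) (hG.ind _)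
  refine ((h1.free h2).iso (isomorphic_sum fun x z => ?_).symm).iso (Iso.qu ⟨φ⟩)
  have hP := (quU_adjMagic ((G.ind S).sum (G.ind Sᶜ))).comp_iso φ.symm φ.symm
  have e1 : φ.symm x.1 = Sum.inl x := (congrArg φ.symm (hl x)).symm.trans (φ.symm_apply_apply _)
  have e2 : φ.symm z.1 = Sum.inr z := (congrArg φ.symm (hr z)).symm.trans (φ.symm_apply_apply _)
  have hx : Iso (G.component x.1) (G.component y) := x.2
  have hz : ¬ Iso (G.component z.1) (G.component y) := z.2
  constructor
  · by_contra hn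
    rw [← e1, ← e2] at hn
    exact hz ((hP.iso_component hrigid hn).trans hx)
  · by_contra hn
    rw [← e1, ← e2] at hn
    exact hz ((hP.iso_component hrigid hn).symm.trans hx)

theorem preconnected_or_preconnected_compl (G : FinGraph) :
    G.graph.Preconnected ∨ G.compl.graph.Preconnected := by
  by_cases h : IsEmpty G.V
  · exact Or.inl fun x => h.elim x
  · rw [not_isEmpty_iff] at h
    exact (G.graph.connected_or_preconnected_compl).imp_left fun h => h.preconnected

theorem jor_qu_of_co {n : ℕ} : ∀ G : FinGraph, Fintype.card G.V = n → Co (upTo 5) G →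
    Jor (quFamily (upTo 5)) G.qu := by
  induction n using Nat.strong_induction_on with
  | h n ih =>
    intro G hn hG
    have ih' : ∀ G' : FinGraph, Fintype.card G'.V < Fintype.card G.V → Co (upTo 5) G' →
      Jor (quFamily (upTo 5)) G'.qu := fun G' h => ih _ (hn ▸ h) G' rfl
    by_cases h1 : G.graph.Preconnected
    · by_cases h2 : G.compl.graph.Preconnected
      · exact Jor.base ⟨G, hG.card_le_of_preconnected h1 h2, Isomorphic.refl _⟩
      · exact (jor_qu_of_not_preconnected hG.compl h2 ih').iso (qu_compl G)
    · exact jor_qu_of_not_preconnected hG h1 ih'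

/-! ### Realizing the Jordan closure -/

theorem reachable_sum_iff {G H : FinGraph} (hG : G.graph.Preconnected)
    (hH : H.graph.Preconnected) (x y : G.V ⊕ H.V) :
    (G.sum H).graph.Reachable x y ↔ x.isLeft = y.isLeft := by
  constructor
  · rintro ⟨w⟩
    induction w with
    | nil => rfl
    | @cons a b c h _ ih =>
      refine Eq.trans ?_ ih
      rcases a with a | a <;> rcases b with b | b
      · rfl
      · exact absurd h Bool.false_ne_true
      · exact absurd h Bool.false_ne_true
      · rfl
  · intro h
    rcases x with x | x <;> rcases y with y | y
    · exact (hG x y).map (SimpleGraph.Embedding.sumInl (G := G.graph) (H := H.graph)).toHom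
    · exact absurd h (by simp)
    · exact absurd h (by simp)
    · exact (hH x y).map (SimpleGraph.Embedding.sumInr (G := G.graph) (H := H.graph)).toHom

/-- The quantum automorphism group of the sum of two connected graphs of different sizes. -/
theorem isomorphic_sum_of_card_ne {G H : FinGraph} (hG : G.graph.Preconnected)
    (hH : H.graph.Preconnected) (hc : Fintype.card G.V ≠ Fintype.card H.V) :
    Isomorphic (G.sum H).qu (freeProd G.qu H.qu) := by
  have hU := quU_adjMagic (G.sum H)
  let c : (G.sum H).V → Bool := Sum.isLeft
  have hb : ∀ x x' y y', ¬ (c x = c x' ↔ c y = c y') →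
      (G.sum H).qu.u x y * (G.sum H).qu.u x' y' = 0 := fun x x' y y' hn =>
    hU.mul_eq_zero_of_not_reachable_iff fun h => hn
      ((reachable_sum_iff hG hH x x').symm.trans (h.trans (reachable_sum_iff hG hH y y')))
  have hl : ∀ x, Fintype.card ((G.sum H).ind {z | c z = c (Sum.inl x)}).V = Fintype.card G.V :=
    fun x => Fintype.card_congr (Equiv.symm
      ⟨fun z => ⟨Sum.inl z, rfl⟩, fun z => z.1.getLeft z.2, fun _ => rfl, by
        rintro ⟨z | z, h⟩
        · rfl
        · exact absurd h Bool.false_ne_true⟩)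
  have hr : ∀ x, Fintype.card ((G.sum H).ind {z | c z = c (Sum.inr x)}).V = Fintype.card H.V :=
    fun x => Fintype.card_congr (Equiv.symm
      ⟨fun z => ⟨Sum.inr z, rfl⟩, fun z => z.1.getRight (by
          have h : z.1.isLeft = false := z.2
          cases hz : z.1 <;> simp_all), fun _ => rfl, by
        rintro ⟨z | z, h⟩
        · exact absurd h (Ne.symm Bool.false_ne_true)
        · rfl⟩)
  -- A nonzero entry gives a magic matrix with nonzero unit between its blocks, which must then have
  -- the same size.
  have key : ∀ x y, (G.sum H).qu.u x y ≠ 0 →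
      Fintype.card ((G.sum H).ind {z | c z = c x}).V =
        Fintype.card ((G.sum H).ind {z | c z = c y}).V := fun x y hxy =>
    (hU.block hb x y).card_eq (hU.blockUnit_ne_zero hxy)
  refine isomorphic_sum fun x y => ⟨?_, ?_⟩
  · by_contra hn
    have := key _ _ hn
    rw [hl, hr] at this
    exact hc this
  · by_contra hn
    have := key _ _ hn
    rw [hl, hr] at this
    exact hc this.symm

/-- The graph with no vertices. -/
def emptyGraph : FinGraph := ⟨Empty, ⊥⟩

/-- The graph with one vertex. -/
def point : FinGraph := ⟨Unit, ⊥⟩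

theorem co_emptyGraph : Co (upTo 5) emptyGraph :=
  Co.base (show Fintype.card Empty ≤ 5 by simp)

theorem co_point : Co (upTo 5) point := Co.base (show Fintype.card Unit ≤ 5 by simp)

instance : IsEmpty emptyGraph.V := inferInstanceAs (IsEmpty Empty)

theorem qu_isomorphic_emptyGraph {G : FinGraph} (h : Fintype.card G.V ≤ 1) :
    Isomorphic G.qu emptyGraph.qu :=
  QPermGroup.isomorphic_of_isTrivial (isTrivial_qu_of_card_le_one h)
    (isTrivial_qu_of_card_le_one (show Fintype.card Empty ≤ 1 by simp))

theorem freeProd_emptyGraph (G : FinGraph) : Isomorphic (freeProd G.qu emptyGraph.qu) G.qu :=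
  (isomorphic_sum fun _ y => isEmptyElim (α := emptyGraph.V) y).symm.trans
    (iso_sum_empty G emptyGraph).qu

theorem emptyGraph_freeProd (G : FinGraph) : Isomorphic (freeProd emptyGraph.qu G.qu) G.qu :=
  (isomorphic_sum fun x _ => isEmptyElim (α := emptyGraph.V) x).symm.trans
    (iso_empty_sum emptyGraph G).qu

/-- The join of a graph with a point. -/
def cone (G : FinGraph) : FinGraph := (G.sum point).compl

theorem cone_preconnected (G : FinGraph) : G.cone.graph.Preconnected := by
  have h : ∀ x : G.V ⊕ Unit, G.cone.graph.Reachable x (Sum.inr ()) := by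
    rintro (x | ⟨⟩)
    · refine SimpleGraph.Adj.reachable ((compl_adj (G := G.sum point) _ _).2 ⟨?_, ?_⟩)
      · exact Sum.inl_ne_inr
      · exact Bool.false_ne_true
    · exact SimpleGraph.Reachable.refl _
  exact fun x y => (h x).trans (h y).symm

theorem card_cone (G : FinGraph) : Fintype.card G.cone.V = Fintype.card G.V + 1 :=
  Fintype.card_sum

/-- Up to complement the cone is the sum of `G` and a point. The sizes differ because `G` has at
least two vertices, and the point contributes only a trivial free factor. -/
theorem cone_qu {G : FinGraph} (hG : G.graph.Preconnected) (h : 2 ≤ Fintype.card G.V) :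
    Isomorphic G.cone.qu G.qu := by
  have hp : point.graph.Preconnected := fun x y => by
    rw [show x = y from rfl]
  have hc : Fintype.card point.V = 1 := Fintype.card_unit
  exact (qu_compl _).trans ((isomorphic_sum_of_card_ne hG hp (by omega)).trans
    (((Isomorphic.refl _).freeProd (qu_isomorphic_emptyGraph hc.le)).trans (freeProd_emptyGraph G)))

theorem exists_preconnected {G : FinGraph} (hG : Co (upTo 5) G) : ∃ G' : FinGraph,
    Co (upTo 5) G' ∧ G'.graph.Preconnected ∧ Fintype.card G'.V = Fintype.card G.V ∧
      Isomorphic G'.qu G.qu := by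
  rcases preconnected_or_preconnected_compl G with h | h
  · exact ⟨G, hG, h, rfl, Isomorphic.refl _⟩
  · exact ⟨G.compl, hG.compl, h, rfl, qu_compl G⟩

/-- Graphs with at most one vertex are neutral for free products. Otherwise both graphs are made
connected by complementation, and connected summands of different sizes do not mix. -/
theorem exists_freeProd {G H : FinGraph} (hG : Co (upTo 5) G) (hH : Co (upTo 5) H) :
    ∃ K : FinGraph, Co (upTo 5) K ∧ Isomorphic (freeProd G.qu H.qu) K.qu := by
  by_cases h1 : Fintype.card G.V ≤ 1
  · exact ⟨H, hH, ((qu_isomorphic_emptyGraph h1).freeProd (Isomorphic.refl _)).trans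
      (emptyGraph_freeProd H)⟩
  by_cases h2 : Fintype.card H.V ≤ 1
  · exact ⟨G, hG, ((Isomorphic.refl _).freeProd (qu_isomorphic_emptyGraph h2)).trans
      (freeProd_emptyGraph G)⟩
  obtain ⟨G', hG', cG, nG, iG⟩ := exists_preconnected hG
  obtain ⟨H', hH', cH, nH, iH⟩ := exists_preconnected hH
  by_cases hc : Fintype.card G'.V = Fintype.card H'.V
  -- Coning one summand increases its size by one and keeps it connected, without changing its
  -- quantum group.
  · refine ⟨G'.cone.sum H', (hG'.sum co_point).compl.sum hH', ?_⟩
    refine (((cone_qu cG (by omega)).trans iG).symm.freeProd iH.symm).trans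
      (isomorphic_sum_of_card_ne (cone_preconnected G') cH ?_).symm
    have := card_cone G'
    omega
  · exact ⟨G'.sum H', hG'.sum hH',
      (iG.symm.freeProd iH.symm).trans (isomorphic_sum_of_card_ne cG cH hc).symm⟩

theorem co_copies {C : FinGraph} (hC : Co (upTo 5) C) (n : ℕ) : Co (upTo 5) (copies n C) := by
  induction n with
  | zero =>
    have : IsEmpty (copies 0 C).V := inferInstanceAs (IsEmpty (Fin 0 × C.V))
    refine Co.iso co_emptyGraph ⟨⟨Equiv.equivOfIsEmpty _ _, fun {x} => isEmptyElim x⟩⟩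
  | succ n ih =>
    refine Co.iso (hC.sum ih) (Iso.symm ⟨⟨?_, ?_⟩⟩)
    · exact
        { toFun := fun x => Fin.cases (motive := fun _ => C.V ⊕ (Fin n × C.V)) (Sum.inl x.2)
            (fun i => Sum.inr (i, x.2)) x.1
          invFun := Sum.elim (fun z => (0, z)) fun x => (x.1.succ, x.2)
          left_inv := by
            rintro ⟨i, z⟩
            refine Fin.cases ?_ (fun i => ?_) i <;> rfl
          right_inv := by
            rintro (z | ⟨i, z⟩) <;> rfl }
    · rintro ⟨i, z⟩ ⟨j, w⟩
      refine Fin.cases ?_ (fun i => ?_) i <;> refine Fin.cases ?_ (fun j => ?_) j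
      · exact ⟨fun h => ⟨rfl, h⟩, fun h => h.2⟩
      · exact iff_of_false Bool.false_ne_true fun h => Fin.succ_ne_zero j h.1.symm
      · exact iff_of_false Bool.false_ne_true fun h => Fin.succ_ne_zero i h.1
      · exact ⟨fun h => ⟨congrArg Fin.succ h.1, h.2⟩, fun h => ⟨Fin.succ_injective _ h.1, h.2⟩⟩

theorem exists_of_jor {P : QPermGroup} (h : Jor (quFamily (upTo 5)) P) :
    ∃ G : FinGraph, Co (upTo 5) G ∧ Isomorphic P G.qu := by
  induction h with
  | base h =>
    obtain ⟨G, hG, hP⟩ := h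
    exact ⟨G, Co.base hG, hP⟩
  | iso _ f ih =>
    obtain ⟨G, hG, hP⟩ := ih
    exact ⟨G, hG, f.symm.trans hP⟩
  | free _ _ ihP ihQ =>
    obtain ⟨G, hG, hP⟩ := ihP
    obtain ⟨H, hH, hQ⟩ := ihQ
    obtain ⟨K, hK, hPQ⟩ := exists_freeProd hG hH
    exact ⟨K, hK, (hP.freeProd hQ).trans hPQ⟩
  | wreath _ n _ ih =>
    obtain ⟨G, hG, hP⟩ := ih
    obtain ⟨C, hC, hc, hne, hCP⟩ : ∃ C : FinGraph, Co (upTo 5) C ∧ C.graph.Preconnected ∧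
        Nonempty C.V ∧ Isomorphic C.qu G.qu := by
      -- Isomorphism does not preserve size, so a group of nonzero size may be realized by the empty
      -- graph. A point replaces it, because the formula for copies needs a vertex.
      by_cases h0 : Fintype.card G.V = 0
      · refine ⟨point, co_point, fun x y => ?_, ⟨()⟩,
          (qu_isomorphic_emptyGraph Fintype.card_unit.le).trans
            (qu_isomorphic_emptyGraph (by omega)).symm⟩
        rw [show x = y from rfl]
      · obtain ⟨C, h1, h2, h3, h4⟩ := exists_preconnected hG
        exact ⟨C, h1, h2, Fintype.card_pos_iff.1 (by omega), h4⟩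
    have hne' : Nonempty C.qu.idx := hne
    exact ⟨copies n C, co_copies hC n,
      ((hP.trans hCP.symm).wreath n).trans (isomorphic_copies hc n).symm⟩

end FinGraph
end

theorem mainTheorem9 :
    FinGraph.Tractable (FinGraph.co (FinGraph.upTo 5)) ∧
    FinGraph.Superrigid (FinGraph.co (FinGraph.upTo 5)) ∧
    FinGraph.quFamily (FinGraph.co (FinGraph.upTo 5)) =
      jordanClosure (FinGraph.quFamily (FinGraph.upTo 5)) := by
  have hF : ∀ G ∈ FinGraph.co (FinGraph.upTo 5), FinGraph.Rigid G := fun G hG =>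
    FinGraph.rigid_of_co G rfl hG
  refine ⟨FinGraph.tractable_of_rigid hF, FinGraph.superrigid_of_rigid hF, Set.ext fun Q => ?_⟩
  constructor
  · rintro ⟨G, hG, hQ⟩
    exact (FinGraph.jor_qu_of_co G rfl hG).iso hQ.symm
  · exact FinGraph.exists_of_jor
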